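/- Let $d\ge 1$, let $N$ be an $\mathbb N$-valued random variable and $A_1,A_2,\dots$ random real $d\times d$ matrices, all defined on one probability space. Write $|x|=\sum_i|x_i|$ for $x\in\mathbb R^d$, $\mathbb S^{d-1}=\{|x|=1\}$, $\|a\|$ for the operator norm of a matrix $a$ with respect to $|\cdot|$, $r(a)$ for its spectral radius, and $a>0$ if all entries of $a$ are strictly positive. The support $\mathrm{supp}$ of a law is the set of points all of whose neighbourhoods have positive probability. Assume the following. 1. $N\ge 1$ a.s., $1<\mathbb E[N]<\infty$, and a.s. all $A_i$ have nonnegative entries, $A_i\ne 0$ for $1\le i\le N$ and $A_i=0$ for $i>N$. 2. Let $\mu$ be the probability measure $\mu(B)=\frac1{\mathbb E[N]}\,\mathbb E\big[\sum_{i=1}^N\mathbf 1_{\{A_i\in B\}}\big]$ and $\Gamma=\{a_1\cdots a_n: n\ge 0,\ a_i\in\mathrm{supp}(\mu)\}$ (the empty product being the identity matrix). Every row and every column of each $a\in\Gamma$ has a strictly positive entry, and $\Gamma$ contains some $a>0$. 3. Let $\mathbb U=\bigcup_{n\ge 0}(\mathbb N^*)^n$ be the set of finite words of positive integers. A set $U\subset\mathbb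 U$ is a cover set if every infinite sequence of positive integers has exactly one prefix in $U$; it has finite level if the lengths of its words are bounded. For $k\le|u|$, $u|k$ is the prefix of $u$ of length $k$. There are two cover sets $U_1,U_2$ of finite level and, for $i=1,2$ and each $v\in\mathbb U$, a sequence $(a^{(i)}_{v1},a^{(i)}_{v2},\dots)$ in the support of the law of $(A_1,A_2,\dots)$ (for the product topology), such that the sums $l_i=\sum_{u\in U_i}a^{(i)}_{u|1}a^{(i)}_{u|2}\cdots a^{(i)}_{u||u|}$ converge and $l_1>0$, $l_2>0$, $r(l_1)<1<r(l_2)$. 4. Let $I_\mu=\{s\ge 0:\int\|a\|^s\mu(da)<\infty\}$ and, for $s\in I_\mu$, $\kappa(s)=\lim_{n\to\infty}\big(\mathbb E\|M_n\cdots M_1\|^s\big)^{1/n}$, where $M_1,M_2,\dots$ are i.i.d. with law $\mu$; put $m(s)=\mathbb E[N]\kappa(s)$. There is $\alpha\in(0,1]$ in the interior of $I_\mu$ such that $m(\alpha)=1$, and $m$ is differentiable at $\alpha$ with $m'(\alpha)<0$. 5. For $t\in\mathbb R^d$ let $N(t)=\#\{i\ge1:A_i^Tt\ne0\}$. Almost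 surely $N(t)\ge 1$ for all $t\ne 0$ simultaneously; $\mathbb P[N(t)=1]<1$ for every $t\ne 0$; and there are $\varepsilon_0>0$ and, for each $t\in\mathbb S^{d-1}$, a (possibly random) index $i(t)\in\mathbb N^*$ with $A_{i(t)}^Tt\ne 0$ a.s., such that $\sup_{t\in\mathbb S^{d-1}}\mathbb E\big[|A_{i(t)}^Tt|^{-\varepsilon_0}\big]<\infty$. 6. For $a>0$ let $v(a)$ be its Perron–Frobenius eigenvector, i.e. the unique strictly positive vector with $a\,v(a)=r(a)v(a)$ and $|v(a)|=1$. The set $\Lambda=\overline{\{v(a):a\in\Gamma,\ a>0\}}$ contains $d$ linearly independent vectors. Let $Z$ be an $\mathbb R_+^d$-valued random variable with $\mathbb P[Z=0]=0$ that solves $$Z\overset{\mathcal L}{=}\sum_{i=1}^N A_iZ_i,$$ where $Z_1,Z_2,\dots$ are i.i.d. copies of $Z$, independent of $(N,A_1,A_2,\dots)$. Then the law of $Z$ is absolutely continuous with respect to the Lebesgue measure on $\mathbb R^d$. -/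

import Mathlib

open MeasureTheory Filter Topology
open scoped ENNReal Matrix

noncomputable section

namespace SmoothingTransform

/-- Real `d × d` matrices. -/
abbrev Mat (d : ℕ) : Type := Matrix (Fin d) (Fin d) ℝ

instance instMeasurableSpaceMat (d : ℕ) : MeasurableSpace (Mat d) :=
  inferInstanceAs (MeasurableSpace (Fin d → Fin d → ℝ))

instance instBorelSpaceMat (d : ℕ) : BorelSpace (Mat d) :=
  inferInstanceAs (BorelSpace (Fin d → Fin d → ℝ))

/-- The `L¹` norm `|x| = ∑ |x_i|`. -/
def l1 {d : ℕ} (x : Fin d → ℝ) : ℝ := ∑ i, |x i|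

/-- The operator norm of a matrix acting on `ℝ^d` with the `L¹` norm. -/
def opNorm {d : ℕ} (a : Mat d) : ℝ :=
  ‖LinearMap.toContinuousLinearMap (Matrix.toLpLin 1 1 a)‖

/-- The spectral radius of a real matrix: the largest modulus of a complex eigenvalue. -/
def specRad {d : ℕ} (a : Mat d) : ℝ :=
  (spectralRadius ℂ (a.map (algebraMap ℝ ℂ))).toReal

/-- Strict positivity of all entries. -/
def StrictlyPos {d : ℕ} (a : Mat d) : Prop := ∀ i j, 0 < a i j

/-! In everything below the family `A` is indexed from `0`: `A i` stands for `A_{i+1}`. -/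

section Model

variable {d : ℕ} {Ω : Type*} [MeasurableSpace Ω]

/-- `E[N]`. -/
def meanN (P : Measure Ω) (N : Ω → ℕ) : ℝ≥0∞ := ∫⁻ ω, (N ω : ℝ≥0∞) ∂P

/-- `N ≥ 1` a.s., `1 < E[N] < ∞`, the matrices are nonnegative, the first `N` of them are nonzero
and the others vanish. -/
def CondN (P : Measure Ω) (N : Ω → ℕ) (A : ℕ → Ω → Mat d) : Prop :=
  (∀ᵐ ω ∂P, 1 ≤ N ω) ∧ 1 < meanN P N ∧ meanN P N < ⊤ ∧
  (∀ᵐ ω ∂P, ∀ i, (∀ j k, 0 ≤ A i ω j k) ∧ (i < N ω → A i ω ≠ 0) ∧ (N ω ≤ i → A i ω = 0))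

/-- `μ(B) = E[#{i ≤ N : A_i ∈ B}] / E[N]`. -/
def mu (P : Measure Ω) (N : Ω → ℕ) (A : ℕ → Ω → Mat d) : Measure (Mat d) :=
  (meanN P N)⁻¹ • Measure.sum fun i => (P.restrict {ω | i < N ω}).map (A i)

/-- The semigroup (with identity) generated by the support of a measure on matrices. -/
def Gam (μ : Measure (Mat d)) : Submonoid (Mat d) := Submonoid.closure μ.support

/-- Allowability and positivity. -/
def CondMu (μ : Measure (Mat d)) : Prop :=
  (∀ a ∈ Gam μ, (∀ i, ∃ j, 0 < a i j) ∧ (∀ j, ∃ i, 0 < a i j)) ∧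
  ∃ a ∈ Gam μ, StrictlyPos a

/-- The support of the law of the sequence `(A_1, A_2, …)`, in the product topology. -/
def seqSupport (P : Measure Ω) (A : ℕ → Ω → Mat d) : Set (ℕ → Mat d) :=
  (P.map fun ω i => A i ω).support

/-- `U` is a cover set: every infinite sequence has exactly one prefix in `U`. -/
def IsCoverSet (U : Set (List ℕ)) : Prop :=
  ∀ s : ℕ → ℕ, ∃! k : ℕ, (List.range k).map s ∈ U

/-- The words of `U` have bounded length. -/
def FiniteLevel (U : Set (List ℕ)) : Prop := ∃ L : ℕ, ∀ u ∈ U, u.length ≤ L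

/-- `a_{u|1} a_{u|2} ⋯ a_{u||u|}`, where `a v i` stands for `a_{vi}`. -/
def pathProd (a : List ℕ → ℕ → Mat d) (u : List ℕ) : Mat d :=
  (List.ofFn fun k : Fin u.length => a (u.take k) (u.get k)).prod

/-- `l` is a convergent sum `∑_{u ∈ U} a_{u|1} ⋯ a_{u||u|}`, for a cover set `U` of finite level
and realizations `(a_{v1}, a_{v2}, …)`, `v` a word, in the support of `(A_1, A_2, …)`. -/
def IsCoverSum (P : Measure Ω) (A : ℕ → Ω → Mat d) (l : Mat d) : Prop :=
  ∃ U : Set (List ℕ), IsCoverSet U ∧ FiniteLevel U ∧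
    ∃ a : List ℕ → ℕ → Mat d, (∀ v, a v ∈ seqSupport P A) ∧
      HasSum (fun u : U => pathProd a u) l

/-- There are strictly positive cover sums with spectral radius below and above `1`. -/
def CondCover (P : Measure Ω) (A : ℕ → Ω → Mat d) : Prop :=
  ∃ l₁ l₂ : Mat d, IsCoverSum P A l₁ ∧ IsCoverSum P A l₂ ∧
    StrictlyPos l₁ ∧ StrictlyPos l₂ ∧ specRad l₁ < 1 ∧ 1 < specRad l₂

/-- `I_μ = {s ≥ 0 : ∫ ‖a‖^s dμ < ∞}`. -/
def momentSet (μ : Measure (Mat d)) : Set ℝ :=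
  {s | 0 ≤ s ∧ ∫⁻ a, ENNReal.ofReal (opNorm a ^ s) ∂μ < ⊤}

/-- `E ‖M_n ⋯ M_1‖^s` for independent matrices `M_1, …, M_n` of law `μ`. -/
def normMoment (μ : Measure (Mat d)) (s : ℝ) (n : ℕ) : ℝ :=
  ∫ M : Fin n → Mat d, opNorm (List.ofFn M).reverse.prod ^ s ∂(Measure.pi fun _ => μ)

/-- `κ(s) = lim_n (E ‖M_n ⋯ M_1‖^s)^{1/n}`; for `s ∈ I_μ` the sequence of moments is
submultiplicative, so that the limit exists. -/
def kappa (μ : Measure (Mat d)) (s : ℝ) : ℝ :=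
  limUnder atTop fun n : ℕ => normMoment μ s n ^ (1 / (n : ℝ))

/-- `m(s) = E[N] κ(s)`. -/
def mFun (P : Measure Ω) (N : Ω → ℕ) (A : ℕ → Ω → Mat d) (s : ℝ) : ℝ :=
  (meanN P N).toReal * kappa (mu P N A) s

/-- There is `α ∈ (0, 1] ∩ int I_μ` with `m(α) = 1` and `m'(α) < 0`. -/
def CondAlpha (P : Measure Ω) (N : Ω → ℕ) (A : ℕ → Ω → Mat d) : Prop :=
  ∃ α : ℝ, 0 < α ∧ α ≤ 1 ∧ α ∈ interior (momentSet (mu P N A)) ∧ mFun P N A α = 1 ∧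
    ∃ m' : ℝ, HasDerivAt (mFun P N A) m' α ∧ m' < 0

/-- `N(t) = #{i : A_iᵀ t ≠ 0}`. -/
def countNonzero (A : ℕ → Ω → Mat d) (t : Fin d → ℝ) (ω : Ω) : ℕ∞ :=
  {i : ℕ | (A i ω)ᵀ *ᵥ t ≠ 0}.encard

/-- A.s. `N(t) ≥ 1` for all `t ≠ 0`; `P[N(t) = 1] < 1` for all `t ≠ 0`; and for some random
indices `i(t)` with `A_{i(t)}ᵀ t ≠ 0` a.s., `sup_{|t| = 1} E |A_{i(t)}ᵀ t|^{-ε} < ∞`. -/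
def CondHarmonic (P : Measure Ω) (A : ℕ → Ω → Mat d) : Prop :=
  (∀ᵐ ω ∂P, ∀ t : Fin d → ℝ, t ≠ 0 → 1 ≤ countNonzero A t ω) ∧
  (∀ t : Fin d → ℝ, t ≠ 0 → P {ω | countNonzero A t ω = 1} < 1) ∧
  ∃ ε : ℝ, 0 < ε ∧ ∃ i : (Fin d → ℝ) → Ω → ℕ,
    (∀ t, l1 t = 1 → Measurable (i t) ∧ ∀ᵐ ω ∂P, (A (i t ω) ω)ᵀ *ᵥ t ≠ 0) ∧
    (⨆ (t : Fin d → ℝ) (_ : l1 t = 1),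
      ∫⁻ ω, ENNReal.ofReal (l1 ((A (i t ω) ω)ᵀ *ᵥ t)) ^ (-ε) ∂P) < ⊤

/-- The closure of the set of normalized Perron-Frobenius eigenvectors of the strictly positive
elements of the semigroup. -/
def Lam (μ : Measure (Mat d)) : Set (Fin d → ℝ) :=
  closure {x | ∃ a ∈ Gam μ, StrictlyPos a ∧ (∀ i, 0 < x i) ∧ l1 x = 1 ∧ a *ᵥ x = specRad a • x}

/-- `S(η)`: the law of `∑_{i ≤ N} A_i Z_i`, where the `Z_i` are i.i.d. with law `η` and independent
of `(N, A_1, A_2, …)`. -/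
def smoothing (P : Measure Ω) (N : Ω → ℕ) (A : ℕ → Ω → Mat d) (η : Measure (Fin d → ℝ)) :
    Measure (Fin d → ℝ) :=
  (P.prod (Measure.infinitePi fun _ : ℕ => η)).map
    fun p => ∑ i ∈ Finset.range (N p.1), A i p.1 *ᵥ p.2 i

/-- `η` is a probability measure on `ℝ_+^d` with `S(η) = η`. -/
def IsFixedPoint (P : Measure Ω) (N : Ω → ℕ) (A : ℕ → Ω → Mat d) (η : Measure (Fin d → ℝ)) :
    Prop :=
  IsProbabilityMeasure η ∧ (∀ᵐ z ∂η, ∀ i, 0 ≤ z i) ∧ smoothing P N A η = η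

end Model

end SmoothingTransform

end

/-! Let η be the law of Z. Iterating the fixed-point equation through n generations of the branching
process shows that η is a mixture of the laws of Σ ℓ_k Z_k, where ℓ is the random family of
generation-n weights and the Z_k are independent copies of Z. Given ℓ, the characteristic function
at t is the product of the `cf η` at the vectors ℓ_kᵀ t. Suppose |`cf η` t| ≤ C |t|^(-a), and
suppose that for every t ≠ 0 at least k > d/a of the vectors ℓ_kᵀ t are nonzero. By compactness of
the sphere the product is then O(|t|^(-ak)), hence integrable, and the conditional law has a density
(`sumLaw_absolutelyContinuous`). The probability that ℓ is not of this kind tends to 0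
(`tendsto_pow_compl_forall_big`): a direction never dies, and it splits with probability bounded
below. An induction on dimension makes this simultaneous in all directions. So η charges no null
set.

The decay of `cf η` needs three facts.

(a) |`cf η`| < 1 off the origin (`norm_cf_lt_one`). The set where the modulus is one is invariant
under the A_jᵀ. Since m(s) < 1 for some s > α, weights become small without killing directions, so
this set accumulates at 0, and then t ⬝ Z is almost surely constant for all t in some nonzero
subspace V. V is invariant under the transposed semigroup. As Λ spans, a Perron–Frobenius argument
yields a strictly positive w in V. On V the fixed-point equation is deterministic, which gives w ⬝
l^n z ≤ w ⬝ z for a cover sum l and a typical value z of Z. This forces r(l) ≤ 1, contradicting the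
existence of a cover sum with r(l) > 1.

(b) |`cf η`| ≤ ρ < 1 outside the unit ball (`exists_norm_cf_le`), by a maximum argument in which two
surviving particles square the modulus.

(c) Polynomial decay (`exists_decay`). In one generation, a second surviving particle gains a factor
ρ with probability at least p, while following one chosen particle costs little by the negative
moment. For a small exponent a the gain wins. -/

noncomputable section

namespace SmoothingTransform

open ProbabilityTheory

/-! ### Characteristic functions on `Fin d → ℝ` -/

/-- The characteristic function of a measure on `ℝ^d`. -/
def cf {d : ℕ} (η : Measure (Fin d → ℝ)) (t : Fin d → ℝ) : ℂ :=
  ∫ x, Complex.exp ((t ⬝ᵥ x : ℝ) * Complex.I) ∂η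

section CharFun

variable {d : ℕ}

@[fun_prop]
lemma continuous_dotProduct_left (t : Fin d → ℝ) : Continuous fun x : Fin d → ℝ => t ⬝ᵥ x := by
  unfold dotProduct; fun_prop

@[fun_prop]
lemma measurable_dotProduct_left (t : Fin d → ℝ) : Measurable fun x : Fin d → ℝ => t ⬝ᵥ x :=
  (continuous_dotProduct_left t).measurable

lemma integrable_cf (η : Measure (Fin d → ℝ)) [IsFiniteMeasure η] (t : Fin d → ℝ) :
    Integrable (fun x => Complex.exp ((t ⬝ᵥ x : ℝ) * Complex.I)) η := by
  refine Integrable.of_bound (C := 1) (by fun_prop) (ae_of_all _ fun x => ?_)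
  rw [Complex.norm_exp_ofReal_mul_I]

lemma norm_cf_le_one (η : Measure (Fin d → ℝ)) [IsProbabilityMeasure η] (t : Fin d → ℝ) :
    ‖cf η t‖ ≤ 1 := by
  refine (norm_integral_le_integral_norm _).trans ?_
  simp [Complex.norm_exp_ofReal_mul_I]

@[simp]
lemma cf_zero (η : Measure (Fin d → ℝ)) [IsProbabilityMeasure η] : cf η 0 = 1 := by
  simp [cf]

lemma continuous_cf (η : Measure (Fin d → ℝ)) [IsProbabilityMeasure η] : Continuous (cf η) := by
  refine continuous_of_dominated (bound := fun _ => 1) (fun t => by fun_prop)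
    (fun t => ae_of_all _ fun x => ?_) (integrable_const _) (ae_of_all _ fun x => ?_)
  · rw [Complex.norm_exp_ofReal_mul_I]
  · unfold dotProduct; fun_prop

lemma ext_of_cf {μ ν : Measure (Fin d → ℝ)} [IsFiniteMeasure μ] [IsFiniteMeasure ν]
    (h : ∀ t, cf μ t = cf ν t) : μ = ν := by
  refine Measure.ext_of_charFunDual (funext fun L => ?_)
  have hL : ∀ x, L x = (fun i => L (Pi.single i 1)) ⬝ᵥ x := fun x => by
    conv_lhs => rw [pi_eq_sum_univ' x]
    rw [map_sum]
    exact Finset.sum_congr rfl fun i _ => by rw [map_smul, smul_eq_mul, mul_comm]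
  have hcf : ∀ ρ : Measure (Fin d → ℝ),
      charFunDual ρ L = cf ρ fun i => L (Pi.single i 1) := fun ρ => by
    rw [charFunDual_apply, cf]
    exact integral_congr_ae (ae_of_all _ fun x => by simp only [hL x])
  rw [hcf, hcf, h]

lemma integral_infinitePi_prod {X : Type*} [MeasurableSpace X] (P : Measure X)
    [IsProbabilityMeasure P] (s : Finset ℕ) (f : ℕ → X → ℂ) (hf : ∀ k, Measurable (f k)) :
    ∫ z, ∏ k ∈ s, f k (z k) ∂(Measure.infinitePi fun _ : ℕ => P) = ∏ k ∈ s, ∫ x, f k x ∂P := by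
  have := integral_restrict_infinitePi (μ := fun _ : ℕ => P) (s := s)
    (f := fun y => ∏ k : s, f k (y k))
    (Finset.measurable_fun_prod _ fun (k : s) _ =>
      (hf k).comp (measurable_pi_apply k)).aestronglyMeasurable
  rw [integral_fintype_prod_eq_prod (fun k : s => f k)] at this
  rw [← Finset.prod_coe_sort s fun k => ∫ x, f k x ∂P, ← this]
  congr 1; ext z
  rw [← Finset.prod_coe_sort]
  rfl

lemma cf_map {X : Type*} [MeasurableSpace X] (P : Measure X) {f : X → Fin d → ℝ}
    (hf : AEMeasurable f P) (t : Fin d → ℝ) :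
    cf (P.map f) t = ∫ x, Complex.exp ((t ⬝ᵥ f x : ℝ) * Complex.I) ∂P :=
  integral_map hf (by fun_prop)

lemma dotProduct_mulVec_transpose (t : Fin d → ℝ) (B : Mat d) (x : Fin d → ℝ) :
    t ⬝ᵥ (B *ᵥ x) = (Bᵀ *ᵥ t) ⬝ᵥ x := by
  rw [Matrix.dotProduct_mulVec, Matrix.mulVec_transpose]

lemma integral_exp_sum_mulVec (η : Measure (Fin d → ℝ)) [IsProbabilityMeasure η] (s : Finset ℕ)
    (B : ℕ → Mat d) (t : Fin d → ℝ) :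
    ∫ z : ℕ → Fin d → ℝ, Complex.exp ((t ⬝ᵥ ∑ k ∈ s, B k *ᵥ z k : ℝ) * Complex.I)
      ∂(Measure.infinitePi fun _ : ℕ => η) = ∏ k ∈ s, cf η ((B k)ᵀ *ᵥ t) := by
  unfold cf
  rw [← integral_infinitePi_prod η s
    (fun k x => Complex.exp ((((B k)ᵀ *ᵥ t) ⬝ᵥ x : ℝ) * Complex.I)) (fun k => by fun_prop)]
  congr 1; ext z
  simp only [dotProduct_sum, dotProduct_mulVec_transpose, Complex.ofReal_sum, Finset.sum_mul,
    Complex.exp_sum]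

lemma cf_bind {X : Type*} [MeasurableSpace X] (m : Measure X) [IsProbabilityMeasure m]
    (κ : Kernel X (Fin d → ℝ)) [IsMarkovKernel κ] (t : Fin d → ℝ) :
    cf (m.bind κ) t = ∫ x, cf (κ x) t ∂m := by
  have := Kernel.integral_comp (κ := Kernel.const Unit m) (η := κ) (a := ())
    (f := fun x => Complex.exp ((t ⬝ᵥ x : ℝ) * Complex.I)) (by
      have : IsProbabilityMeasure ((κ ∘ₖ Kernel.const Unit m) ()) := inferInstance
      exact integrable_cf _ t)
  simpa [Kernel.comp_apply, cf] using this

lemma measurable_cf_kernel {X : Type*} [MeasurableSpace X] (κ : Kernel X (Fin d → ℝ))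
    [IsMarkovKernel κ] (t : Fin d → ℝ) : Measurable fun x => cf (κ x) t := by
  have : StronglyMeasurable fun x => ∫ y, Complex.exp ((t ⬝ᵥ y : ℝ) * Complex.I) ∂(κ x) :=
    StronglyMeasurable.integral_kernel (f := fun y : Fin d → ℝ =>
      Complex.exp ((t ⬝ᵥ y : ℝ) * Complex.I)) (by fun_prop)
  exact this.measurable

end CharFun

/-! ### The weighted branching process as a Markov chain on sequences of matrices -/

section Chain

variable {d : ℕ} {Ω : Type*} [MeasurableSpace Ω]

/-- States of the chain: the weights of one generation. -/
abbrev St (d : ℕ) : Type := ℕ → Mat d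

/-- `∑ ℓ_k z_k`. -/
def weightedSum (p : St d × (ℕ → Fin d → ℝ)) : Fin d → ℝ := ∑' k, p.1 k *ᵥ p.2 k

instance instSecondCountableMat : SecondCountableTopology (Mat d) :=
  inferInstanceAs (SecondCountableTopology (Fin d → Fin d → ℝ))

@[fun_prop]
lemma Measurable.mulVec' {X : Type*} [MeasurableSpace X] {f : X → Mat d} {g : X → Fin d → ℝ}
    (hf : Measurable f) (hg : Measurable g) : Measurable fun x => f x *ᵥ g x :=
  (Continuous.matrix_mulVec (A := fun p : Mat d × (Fin d → ℝ) => p.1) continuous_fst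
    continuous_snd).measurable.comp (hf.prodMk hg)

@[fun_prop]
lemma Measurable.matMul {X : Type*} [MeasurableSpace X] {f g : X → Mat d}
    (hf : Measurable f) (hg : Measurable g) : Measurable fun x => f x * g x :=
  (Continuous.matrix_mul (A := fun p : Mat d × Mat d => p.1) continuous_fst
    continuous_snd).measurable.comp (hf.prodMk hg)

@[fun_prop]
lemma Measurable.matTranspose {X : Type*} [MeasurableSpace X] {f : X → Mat d}
    (hf : Measurable f) : Measurable fun x => (f x)ᵀ :=
  (Continuous.matrix_transpose (A := fun p : Mat d => p) continuous_id).measurable.comp hf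

lemma measurable_weightedSum : Measurable (weightedSum (d := d)) :=
  Measurable.tsum fun k => by fun_prop

lemma measurable_weightedSum_right (ℓ : St d) :
    Measurable fun z : ℕ → Fin d → ℝ => weightedSum (ℓ, z) :=
  measurable_weightedSum.comp (by fun_prop)

lemma weightedSum_eq {ℓ : St d} {s : Finset ℕ} (h : ∀ k ∉ s, ℓ k = 0) (z : ℕ → Fin d → ℝ) :
    weightedSum (ℓ, z) = ∑ k ∈ s, ℓ k *ᵥ z k :=
  tsum_eq_sum fun k hk => by simp [h k hk]

/-- The law of `∑ ℓ_k Z_k` for independent `Z_k` of law `η`. -/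
def sumLaw (η : Measure (Fin d → ℝ)) [IsProbabilityMeasure η] : Kernel (St d) (Fin d → ℝ) :=
  (Kernel.id ×ₖ Kernel.const _ (Measure.infinitePi fun _ : ℕ => η)).map weightedSum

instance (η : Measure (Fin d → ℝ)) [IsProbabilityMeasure η] : IsMarkovKernel (sumLaw η) :=
  Kernel.IsMarkovKernel.map _ measurable_weightedSum

lemma sumLaw_apply (η : Measure (Fin d → ℝ)) [IsProbabilityMeasure η] (ℓ : St d) :
    sumLaw η ℓ = (Measure.infinitePi fun _ : ℕ => η).map fun z => weightedSum (ℓ, z) := by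
  rw [sumLaw, Kernel.map_apply _ measurable_weightedSum, Kernel.prod_apply, Kernel.id_apply,
    Kernel.const_apply, Measure.dirac_prod, Measure.map_map measurable_weightedSum (by fun_prop)]
  rfl

lemma cf_sumLaw (η : Measure (Fin d → ℝ)) [IsProbabilityMeasure η] {ℓ : St d} {s : Finset ℕ}
    (h : ∀ k ∉ s, ℓ k = 0) (t : Fin d → ℝ) :
    cf (sumLaw η ℓ) t = ∏ k ∈ s, cf η ((ℓ k)ᵀ *ᵥ t) := by
  rw [sumLaw_apply, cf_map _ (measurable_weightedSum_right ℓ).aemeasurable]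
  simp only [weightedSum_eq h]
  exact integral_exp_sum_mulVec η s ℓ t

/-- Every factor has modulus at most one, so those outside F can be dropped. Indices of F carrying
zero weight are harmless because `cf η 0 = 1`. -/
lemma norm_cf_sumLaw_le (η : Measure (Fin d → ℝ)) [IsProbabilityMeasure η] {ℓ : St d}
    (hℓ : ∃ K, ∀ k, K ≤ k → ℓ k = 0) (t : Fin d → ℝ) (F : Finset ℕ) :
    ‖cf (sumLaw η ℓ) t‖ ≤ ∏ k ∈ F, ‖cf η ((ℓ k)ᵀ *ᵥ t)‖ := by
  obtain ⟨K, hK⟩ := hℓ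
  rw [cf_sumLaw η (s := Finset.range K ∪ F) (fun k hk => hK k (by simp at hk; omega)), norm_prod]
  exact Finset.prod_le_prod_of_subset_of_le_one Finset.subset_union_right
    (fun _ _ => norm_nonneg _) (fun _ _ _ => norm_cf_le_one η _)

/-- One generation of branching: the family `ℓ_i A_j(ω_i)`, indexed by a pairing of `(i, j)`. -/
def branch (A : ℕ → Ω → Mat d) (p : St d × (ℕ → Ω)) : St d :=
  fun k => p.1 k.unpair.1 * A k.unpair.2 (p.2 k.unpair.1)

lemma measurable_branch {A : ℕ → Ω → Mat d} (hA : ∀ i, Measurable (A i)) :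
    Measurable (branch A) := by
  refine measurable_pi_lambda _ fun k => ?_
  exact Measurable.matMul (by fun_prop) ((hA _).comp (by fun_prop))

lemma measurable_branch_right {A : ℕ → Ω → Mat d} (hA : ∀ i, Measurable (A i)) (ℓ : St d) :
    Measurable fun ω => branch A (ℓ, ω) :=
  (measurable_branch hA).comp (by fun_prop)

/-- The transition kernel of the chain of generations. -/
def step (P : Measure Ω) [IsProbabilityMeasure P] (A : ℕ → Ω → Mat d) : Kernel (St d) (St d) :=
  (Kernel.id ×ₖ Kernel.const _ (Measure.infinitePi fun _ : ℕ => P)).map (branch A)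

variable (P : Measure Ω) [IsProbabilityMeasure P] {N : Ω → ℕ} {A : ℕ → Ω → Mat d}

lemma isMarkovKernel_step (hA : ∀ i, Measurable (A i)) : IsMarkovKernel (step P A) :=
  Kernel.IsMarkovKernel.map _ (measurable_branch hA)

lemma step_apply (hA : ∀ i, Measurable (A i)) (ℓ : St d) :
    step P A ℓ = (Measure.infinitePi fun _ : ℕ => P).map fun ω => branch A (ℓ, ω) := by
  rw [step, Kernel.map_apply _ (measurable_branch hA), Kernel.prod_apply, Kernel.id_apply,
    Kernel.const_apply, Measure.dirac_prod, Measure.map_map (measurable_branch hA) (by fun_prop)]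
  rfl

lemma ae_infinitePi {X : Type*} [MeasurableSpace X] (Q : Measure X) [IsProbabilityMeasure Q]
    {p : X → Prop} (h : ∀ᵐ x ∂Q, p x) :
    ∀ᵐ z ∂(Measure.infinitePi fun _ : ℕ => Q), ∀ i, p (z i) :=
  ae_all_iff.2 fun i =>
    (measurePreserving_eval_infinitePi (fun _ : ℕ => Q) i).quasiMeasurePreserving.ae h

/-- The states with finitely many nonzero weights. -/
def finStates (d : ℕ) : Set (St d) := {ℓ | ∃ K, ∀ k, K ≤ k → ℓ k = 0}

instance : MeasurableSingletonClass (Mat d) :=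
  inferInstanceAs (MeasurableSingletonClass (Fin d → Fin d → ℝ))

lemma measurableSet_finStates : MeasurableSet (finStates d) := by
  have : finStates d = ⋃ K, ⋂ k, ⋂ _ : K ≤ k, {ℓ | ℓ k = 0} := by ext; simp [finStates]
  rw [this]
  exact .iUnion fun K => .iInter fun k => .iInter fun _ =>
    (measurable_pi_apply k) (measurableSet_singleton 0)

omit [MeasurableSpace Ω] in
lemma branch_eq_zero {ℓ : St d} {K : ℕ} (hK : ∀ k, K ≤ k → ℓ k = 0) {ω : ℕ → Ω}
    (hω : ∀ i j, N (ω i) ≤ j → A j (ω i) = 0) (k : ℕ)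
    (hk : k ∉ ((Finset.range K).sigma fun i => Finset.range (N (ω i))).image
      fun p => Nat.pair p.1 p.2) : branch A (ℓ, ω) k = 0 := by
  simp only [branch]
  by_cases h1 : K ≤ k.unpair.1
  · simp [hK _ h1]
  · rw [hω _ _ (not_lt.1 fun h2 => hk ?_), mul_zero]
    simp only [Finset.mem_image, Finset.mem_sigma, Finset.mem_range]
    exact ⟨⟨k.unpair.1, k.unpair.2⟩, ⟨not_le.1 h1, h2⟩, Nat.pair_unpair k⟩

/-- On `finStates` the series in `weightedSum` is a finite sum, so the default value of `tsum` plays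
no role there. The chain stays in this set because finitely many live particles have finitely many
children. -/
lemma step_finStates (hA : ∀ i, Measurable (A i))
    (h0 : ∀ᵐ ω ∂P, ∀ i, N ω ≤ i → A i ω = 0) {ℓ : St d} (hℓ : ℓ ∈ finStates d) :
    ∀ᵐ ℓ' ∂(step P A ℓ), ℓ' ∈ finStates d := by
  rw [step_apply P hA, ae_map_iff (measurable_branch_right hA ℓ).aemeasurable
    (p := fun ℓ' => ℓ' ∈ finStates d) measurableSet_finStates]
  filter_upwards [ae_infinitePi P h0] with ω hω
  obtain ⟨K, hK⟩ := hℓ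
  refine ⟨(((Finset.range K).sigma fun i => Finset.range (N (ω i))).image
      fun p => Nat.pair p.1 p.2).sup id + 1, fun k hk => branch_eq_zero hK hω k fun hmem => ?_⟩
  have := Finset.le_sup (f := id) hmem
  simp only [id] at this
  omega

lemma pair_injOn (s : Set ((_ : ℕ) × ℕ)) :
    Set.InjOn (fun p : (_ : ℕ) × ℕ => Nat.pair p.1 p.2) s := by
  rintro ⟨a, b⟩ _ ⟨a', b'⟩ _ h
  simp only [Nat.pair_eq_pair] at h
  obtain ⟨rfl, rfl⟩ := h
  rfl

variable {η : Measure (Fin d → ℝ)} [IsProbabilityMeasure η]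

lemma measurable_smoothing_sum {N : Ω → ℕ} {A : ℕ → Ω → Mat d} (hN : Measurable N)
    (hA : ∀ i, Measurable (A i)) :
    Measurable fun p : Ω × (ℕ → Fin d → ℝ) => ∑ i ∈ Finset.range (N p.1), A i p.1 *ᵥ p.2 i := by
  have : Measurable fun p : ℕ × (Ω × (ℕ → Fin d → ℝ)) =>
      ∑ i ∈ Finset.range p.1, A i p.2.1 *ᵥ p.2.2 i := by
    refine measurable_from_prod_countable_right fun n => ?_
    change Measurable fun x : Ω × (ℕ → Fin d → ℝ) => ∑ i ∈ Finset.range n, A i x.1 *ᵥ x.2 i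
    refine Finset.measurable_fun_sum _ fun i _ => ?_
    exact Measurable.mulVec' ((hA i).comp measurable_fst) (by fun_prop)
  exact this.comp ((hN.comp measurable_fst).prodMk measurable_id)

lemma cf_smoothing (hN : Measurable N) (hA : ∀ i, Measurable (A i)) (t : Fin d → ℝ) :
    cf (smoothing P N A η) t
      = ∫ ω, ∏ j ∈ Finset.range (N ω), cf η ((A j ω)ᵀ *ᵥ t) ∂P := by
  have hm := measurable_smoothing_sum hN hA
  rw [smoothing, cf_map _ hm.aemeasurable, integral_prod]
  · simp only [integral_exp_sum_mulVec]
  · refine Integrable.of_bound (C := 1) (by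
      have := (measurable_dotProduct_left t).comp hm
      exact ((Complex.measurable_ofReal.comp this).mul_const _).cexp.aestronglyMeasurable)
      (ae_of_all _ fun x => ?_)
    rw [Complex.norm_exp_ofReal_mul_I]

lemma measurable_prod_cf (hN : Measurable N) (hA : ∀ i, Measurable (A i)) (t : Fin d → ℝ) :
    Measurable fun ω => ∏ j ∈ Finset.range (N ω), cf η ((A j ω)ᵀ *ᵥ t) := by
  have : Measurable fun p : ℕ × Ω => ∏ j ∈ Finset.range p.1, cf η ((A j p.2)ᵀ *ᵥ t) := by
    refine measurable_from_prod_countable_right fun n => ?_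
    change Measurable fun ω => ∏ i ∈ Finset.range n, cf η ((A i ω)ᵀ *ᵥ t)
    refine Finset.measurable_fun_prod _ fun i _ => ?_
    have h := Measurable.mulVec' (Measurable.matTranspose (hA i)) (measurable_const (a := t))
    exact (continuous_cf η).measurable.comp h
  have h : Measurable fun ω => (N ω, ω) := hN.prodMk measurable_id
  simpa only [Function.comp_def] using this.comp h

/-- Replacing each Z_k by Σ_j A_j Z_{kj} does not change the law. Independence over k factorises the
integral, and the fixed-point equation for `cf η` applies to each factor separately. -/
lemma bind_step_sumLaw (hN : Measurable N) (hA : ∀ i, Measurable (A i))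
    (h0 : ∀ᵐ ω ∂P, ∀ i, N ω ≤ i → A i ω = 0) (hη : smoothing P N A η = η)
    {ℓ : St d} (hℓ : ℓ ∈ finStates d) :
    (step P A ℓ).bind (sumLaw η) = sumLaw η ℓ := by
  have := isMarkovKernel_step P hA
  refine ext_of_cf fun t => ?_
  rw [cf_bind, step_apply P hA,
    integral_map (measurable_branch_right hA ℓ).aemeasurable
      (measurable_cf_kernel _ t).aestronglyMeasurable]
  obtain ⟨K, hK⟩ := hℓ
  have key : ∀ s : Fin d → ℝ,
      cf η s = ∫ ω, ∏ j ∈ Finset.range (N ω), cf η ((A j ω)ᵀ *ᵥ s) ∂P := fun s => by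
    rw [← cf_smoothing P hN hA, hη]
  rw [cf_sumLaw η (s := Finset.range K) (fun k hk => hK k (by simpa using hk))]
  simp only [key ((ℓ _)ᵀ *ᵥ t)]
  rw [← integral_infinitePi_prod P _
    (fun k ω => ∏ j ∈ Finset.range (N ω), cf η ((A j ω)ᵀ *ᵥ (ℓ k)ᵀ *ᵥ t))
    (fun k => measurable_prod_cf hN hA _)]
  refine integral_congr_ae ?_
  filter_upwards [ae_infinitePi P h0] with ω hω
  rw [cf_sumLaw η (branch_eq_zero hK hω), Finset.prod_image (pair_injOn _), Finset.prod_sigma]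
  refine Finset.prod_congr rfl fun i _ => Finset.prod_congr rfl fun j _ => ?_
  simp [branch, Matrix.transpose_mul, Matrix.mulVec_mulVec]

/-! ### Powers of a kernel and the n-generation form of the fixed-point equation -/

lemma kernel_pow_zero_apply {X : Type*} [MeasurableSpace X] (κ : Kernel X X) (x : X) :
    (κ ^ 0) x = Measure.dirac x := by
  rw [pow_zero]; exact Kernel.id_apply x

lemma kernel_pow_succ {X : Type*} [MeasurableSpace X] (κ : Kernel X X) (n : ℕ) :
    κ ^ (n + 1) = Kernel.comp κ (κ ^ n) :=
  pow_succ' κ n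

lemma kernel_pow_succ_apply {X : Type*} [MeasurableSpace X] (κ : Kernel X X) (n : ℕ) (x : X) :
    (κ ^ (n + 1)) x = ((κ ^ n) x).bind κ := by
  rw [kernel_pow_succ, Kernel.comp_apply]

/-- An absorbing set of states stays absorbing under iteration. -/
lemma ae_pow_of_absorbing {X : Type*} [MeasurableSpace X] (κ : Kernel X X) {B : Set X}
    (hB : MeasurableSet B) (h : ∀ x ∈ B, ∀ᵐ y ∂(κ x), y ∈ B) (n : ℕ) :
    ∀ x ∈ B, ∀ᵐ y ∂((κ ^ n) x), y ∈ B := by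
  induction n with
  | zero =>
    intro x hx
    rw [kernel_pow_zero_apply, ae_dirac_iff (p := fun y => y ∈ B) hB]
    exact hx
  | succ n ih =>
    intro x hx
    rw [kernel_pow_succ_apply]
    have hn : ((κ ^ n) x).bind κ Bᶜ = 0 := by
      rw [Measure.bind_apply hB.compl κ.aemeasurable]
      rw [lintegral_eq_zero_iff (κ.measurable_coe hB.compl)]
      filter_upwards [ih x hx] with y hy using h y hy
    exact hn

lemma isMarkovKernel_pow {X : Type*} [MeasurableSpace X] (κ : Kernel X X) [IsMarkovKernel κ]
    (n : ℕ) : IsMarkovKernel (κ ^ n) := by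
  induction n with
  | zero => rw [pow_zero]; exact inferInstanceAs (IsMarkovKernel Kernel.id)
  | succ n ih => rw [kernel_pow_succ]; infer_instance

lemma bind_step_pow_sumLaw (hN : Measurable N) (hA : ∀ i, Measurable (A i))
    (h0 : ∀ᵐ ω ∂P, ∀ i, N ω ≤ i → A i ω = 0) (hη : smoothing P N A η = η)
    {ℓ : St d} (hℓ : ℓ ∈ finStates d) (n : ℕ) :
    ((step P A ^ n) ℓ).bind (sumLaw η) = sumLaw η ℓ := by
  induction n with
  | zero => rw [kernel_pow_zero_apply, Measure.dirac_bind (Kernel.measurable _)]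
  | succ n ih =>
    rw [kernel_pow_succ_apply, Measure.bind_bind (Kernel.aemeasurable _)
      (Kernel.aemeasurable _), ← ih]
    refine Measure.bind_congr_right ?_
    filter_upwards [ae_pow_of_absorbing (step P A) measurableSet_finStates
      (fun x hx => step_finStates P hA h0 hx) n ℓ hℓ] with ℓ' hℓ'
    exact bind_step_sumLaw P hN hA h0 hη hℓ'

/-- The initial state: one particle with weight the identity. -/
def root (d : ℕ) : St d := Pi.single 0 1

lemma root_mem_finStates : root d ∈ finStates d :=
  ⟨1, fun k hk => by simp [root, Pi.single_apply]; omega⟩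

lemma sumLaw_root : sumLaw η (root d) = η := by
  refine ext_of_cf fun t => ?_
  rw [cf_sumLaw η (s := {0}) (fun k hk => by
    simp [root, Pi.single_apply] at hk ⊢; exact fun h => (hk h).elim)]
  simp [root]

lemma bind_step_pow_root (hN : Measurable N) (hA : ∀ i, Measurable (A i))
    (h0 : ∀ᵐ ω ∂P, ∀ i, N ω ≤ i → A i ω = 0) (hη : smoothing P N A η = η) (n : ℕ) :
    ((step P A ^ n) (root d)).bind (sumLaw η) = η := by
  rw [bind_step_pow_sumLaw P hN hA h0 hη root_mem_finStates, sumLaw_root]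

end Chain

end SmoothingTransform
end

noncomputable section

namespace SmoothingTransform

open ProbabilityTheory

/-! ### Markov kernels and absorbing sets -/

section Absorbing

variable {X : Type*} [MeasurableSpace X] (κ : Kernel X X) [IsMarkovKernel κ]

lemma pow_compl_antitone {B : Set X} (hB : MeasurableSet B)
    (habs : ∀ x ∈ B, ∀ᵐ y ∂(κ x), y ∈ B) (x : X) {m n : ℕ} (hmn : m ≤ n) :
    (κ ^ n) x Bᶜ ≤ (κ ^ m) x Bᶜ := by
  obtain ⟨j, rfl⟩ := Nat.exists_eq_add_of_le hmn
  have := isMarkovKernel_pow κ j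
  rw [Kernel.pow_add_apply_eq_lintegral κ m j x hB.compl, ← lintegral_indicator_one hB.compl]
  refine lintegral_mono fun y => ?_
  by_cases hy : y ∈ B
  · exact ((ae_pow_of_absorbing κ hB habs j y hy : (κ ^ j) y Bᶜ = 0)).le.trans zero_le
  · rw [Set.indicator_of_mem (by exact hy)]
    exact prob_le_one

/-- B' is never left once entered, so being outside B' at time n means having missed it n times in a
row, each time with conditional probability at most q. -/
lemma pow_compl_le_geometric {B B' : Set X} (hB : MeasurableSet B) (hB' : MeasurableSet B')
    (habs : ∀ x ∈ B, ∀ᵐ y ∂(κ x), y ∈ B) (habs' : ∀ x ∈ B', ∀ᵐ y ∂(κ x), y ∈ B')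
    {q : ℝ≥0∞} (hq : ∀ x ∈ B, κ x B'ᶜ ≤ q) (n : ℕ) :
    ∀ x ∈ B, (κ ^ n) x B'ᶜ ≤ q ^ n := by
  have := isMarkovKernel_pow κ
  induction n with
  | zero => exact fun x _ => by rw [pow_zero (M := ℝ≥0∞)]; exact prob_le_one
  | succ n ih =>
    intro x hx
    rw [Kernel.pow_succ_apply_eq_lintegral κ n x hB'.compl]
    calc ∫⁻ y, κ y B'ᶜ ∂((κ ^ n) x) ≤ ∫⁻ y, q * B'ᶜ.indicator 1 y ∂((κ ^ n) x) := by
          refine lintegral_mono_ae ?_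
          filter_upwards [ae_pow_of_absorbing κ hB habs n x hx] with y hy
          by_cases hy' : y ∈ B'
          · exact (habs' y hy' : κ y B'ᶜ = 0).le.trans zero_le
          · rw [Set.indicator_of_mem (by exact hy')]
            simpa using hq y hy
      _ ≤ q ^ (n + 1) := by
          rw [lintegral_const_mul _ (measurable_one.indicator hB'.compl),
            lintegral_indicator_one hB'.compl, pow_succ']
          gcongr
          exact ih x hx

/-- Half of ε pays for reaching `B k`, the other half for passing from there to `B (k + 1)`. The
time m is fixed before the sets B are given. This is what later makes the estimate uniform in the
direction, on which the sets depend. -/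
lemma exists_time_pow_compl_le {q : ℝ≥0∞} (hq1 : q < 1) {ε : ℝ≥0∞} (hε : ε ≠ 0) (k : ℕ) :
    ∃ m : ℕ, ∀ B : ℕ → Set X, (∀ k, MeasurableSet (B k)) →
      (∀ k, ∀ x ∈ B k, ∀ᵐ y ∂(κ x), y ∈ B k) →
      (∀ k, ∀ x ∈ B k, κ x (B (k + 1))ᶜ ≤ q) →
      ∀ n, m ≤ n → ∀ x ∈ B 0, (κ ^ n) x (B k)ᶜ ≤ ε := by
  have := isMarkovKernel_pow κ
  induction k generalizing ε with
  | zero =>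
    refine ⟨0, fun B hB habs _ n _ x hx => ?_⟩
    exact (ae_pow_of_absorbing κ (hB 0) (habs 0) n x hx : (κ ^ n) x (B 0)ᶜ = 0).le.trans zero_le
  | succ k ih =>
    have hε2 : ε / 2 ≠ 0 := (ENNReal.half_pos hε).ne'
    obtain ⟨m, hm⟩ := ih hε2
    obtain ⟨j, hj⟩ : ∃ j : ℕ, q ^ j ≤ ε / 2 := by
      have := (ENNReal.tendsto_pow_atTop_nhds_zero_of_lt_one hq1).eventually_lt_const
        (ENNReal.half_pos hε)
      obtain ⟨j, hj⟩ := this.exists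
      exact ⟨j, hj.le⟩
    refine ⟨m + j, fun B hB habs hstep n hn x hx => ?_⟩
    refine (pow_compl_antitone κ (hB _) (habs _) x hn).trans ?_
    rw [Kernel.pow_add_apply_eq_lintegral κ m j x (hB _).compl]
    calc ∫⁻ y, (κ ^ j) y (B (k + 1))ᶜ ∂((κ ^ m) x)
        ≤ ∫⁻ y, ((B k)ᶜ.indicator 1 y + q ^ j) ∂((κ ^ m) x) := by
          refine lintegral_mono fun y => ?_
          by_cases hy : y ∈ B k
          · exact (pow_compl_le_geometric κ (hB k) (hB _) (habs k) (habs _) (hstep k) j y hy).trans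
              le_add_self
          · rw [Set.indicator_of_mem (by exact hy)]
            exact prob_le_one.trans le_self_add
      _ ≤ ε := by
          rw [lintegral_add_right _ measurable_const, lintegral_indicator_one (hB k).compl,
            lintegral_const, measure_univ, mul_one]
          exact (add_le_add (hm B hB habs hstep m le_rfl x hx) hj).trans (ENNReal.add_halves ε).le

end Absorbing

/-! ### Directions that survive along many particles -/

section Big

variable {d : ℕ} {Ω : Type*} [MeasurableSpace Ω]

/-- At least `k` of the vectors `ℓ_jᵀ t` have norm larger than `r`. -/
def Big (r : ℝ) (k : ℕ) (ℓ : St d) (t : Fin d → ℝ) : Prop :=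
  ∃ F : Finset ℕ, F.card = k ∧ ∀ j ∈ F, r < ‖(ℓ j)ᵀ *ᵥ t‖

lemma Big.mono_left {r r' : ℝ} (h : r' ≤ r) {k : ℕ} {ℓ : St d} {t : Fin d → ℝ}
    (hb : Big r k ℓ t) : Big r' k ℓ t := by
  obtain ⟨F, hF, hb⟩ := hb
  exact ⟨F, hF, fun j hj => h.trans_lt (hb j hj)⟩

lemma Big.of_le {r : ℝ} {k k' : ℕ} (h : k' ≤ k) {ℓ : St d} {t : Fin d → ℝ}
    (hb : Big r k ℓ t) : Big r k' ℓ t := by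
  obtain ⟨F, hF, hb⟩ := hb
  obtain ⟨F', hF', hc⟩ := Finset.exists_subset_card_eq (hF.symm ▸ h)
  exact ⟨F', hc, fun j hj => hb j (hF' hj)⟩

lemma big_smul_iff {r c : ℝ} (hc : 0 < c) {k : ℕ} {ℓ : St d} {t : Fin d → ℝ} :
    Big (c * r) k ℓ (c • t) ↔ Big r k ℓ t := by
  simp only [Big, Matrix.mulVec_smul, norm_smul, Real.norm_of_nonneg hc.le, mul_lt_mul_iff_right₀ hc]

lemma continuous_transpose_mulVec (j : ℕ) :
    Continuous fun p : St d × (Fin d → ℝ) => ‖(p.1 j)ᵀ *ᵥ p.2‖ := by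
  fun_prop

lemma isOpen_big (r : ℝ) (k : ℕ) : IsOpen {p : St d × (Fin d → ℝ) | Big r k p.1 p.2} := by
  have : {p : St d × (Fin d → ℝ) | Big r k p.1 p.2} =
      ⋃ F : Finset ℕ, ⋃ _ : F.card = k, ⋂ j ∈ F, {p | r < ‖(p.1 j)ᵀ *ᵥ p.2‖} := by
    ext p; simp [Big]
  rw [this]
  refine isOpen_iUnion fun F => isOpen_iUnion fun _ => isOpen_biInter_finset fun j _ => ?_
  exact isOpen_lt continuous_const (continuous_transpose_mulVec j)

lemma measurableSet_big (r : ℝ) (k : ℕ) (t : Fin d → ℝ) : MeasurableSet {ℓ : St d | Big r k ℓ t} :=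
  ((isOpen_big r k).preimage (f := fun ℓ : St d => (ℓ, t)) (by fun_prop)).measurableSet

lemma isOpen_forall_big (r : ℝ) (k : ℕ) {C : Set (Fin d → ℝ)} (hC : IsCompact C) :
    IsOpen {ℓ : St d | ∀ t ∈ C, Big r k ℓ t} := by
  refine isOpen_iff_eventually.2 fun ℓ hℓ => ?_
  refine hC.eventually_forall_of_forall_eventually (P := fun ℓ t => Big r k ℓ t) fun t ht => ?_
  have h : (ℓ, t) ∈ {p : St d × (Fin d → ℝ) | Big r k p.1 p.2} := hℓ t ht
  exact (isOpen_big r k).eventually_mem h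

/-- The intersection over C is uncountable, but for compact C it is open, and a σ-compact C needs
only countably many of these. This covers a subspace with the origin removed, which is not compact.
-/
lemma measurableSet_forall_big (r : ℝ) (k : ℕ) {C : Set (Fin d → ℝ)} (hC : IsSigmaCompact C) :
    MeasurableSet {ℓ : St d | ∀ t ∈ C, Big r k ℓ t} := by
  obtain ⟨K, hK, rfl⟩ := hC
  have : {ℓ : St d | ∀ t ∈ ⋃ n, K n, Big r k ℓ t} = ⋂ n, {ℓ | ∀ t ∈ K n, Big r k ℓ t} := by
    ext ℓ
    simp only [Set.mem_iUnion, Set.mem_ofPred_eq, Set.mem_iInter]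
    exact ⟨fun h n t ht => h t ⟨n, ht⟩, fun h t ⟨n, ht⟩ => h n t ht⟩
  rw [this]
  exact .iInter fun n => (isOpen_forall_big r k (hK n)).measurableSet

lemma isSigmaCompact_inter_isOpen {C U : Set (Fin d → ℝ)} (hC : IsClosed C) (hU : IsOpen U) :
    IsSigmaCompact (C ∩ U) := by
  obtain ⟨F, hF, -, hFU, -⟩ := hU.exists_iUnion_isClosed
  rw [← hFU, Set.inter_iUnion]
  exact isSigmaCompact_iUnion _ fun n =>
    isSigmaCompact_univ.of_isClosed_subset (hC.inter (hF n)) (Set.subset_univ _)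

/-- A lower bound on the probability of `k` surviving particles in each direction can be made
quantitative uniformly on a compact set of directions. -/
lemma exists_radius_big (Q : Measure (St d)) {C : Set (Fin d → ℝ)}
    (hC : IsCompact C) (k : ℕ) {c : ℝ≥0∞} (hc : c < ⊤) (h : ∀ t ∈ C, c < Q {ℓ | Big 0 k ℓ t}) :
    ∃ r : ℝ, 0 < r ∧ ∃ b, c < b ∧ ∀ t ∈ C, b ≤ Q {ℓ | Big r k ℓ t} := by
  refine hC.induction_on
    (p := fun S => ∃ r : ℝ, 0 < r ∧ ∃ b, c < b ∧ ∀ t ∈ S, b ≤ Q {ℓ | Big r k ℓ t})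
    ⟨1, one_pos, ⊤, hc, by simp⟩ ?_ ?_ ?_
  · rintro s t hst ⟨r, hr, b, hb, h⟩
    exact ⟨r, hr, b, hb, fun x hx => h x (hst hx)⟩
  · rintro s t ⟨r, hr, b, hb, h⟩ ⟨r', hr', b', hb', h'⟩
    refine ⟨min r r', lt_min hr hr', min b b', lt_min hb hb', fun x hx => ?_⟩
    rcases hx with hx | hx
    · exact (min_le_left _ _).trans ((h x hx).trans
        (measure_mono fun ℓ hl => Big.mono_left (min_le_left _ _) hl))
    · exact (min_le_right _ _).trans ((h' x hx).trans
        (measure_mono fun ℓ hl => Big.mono_left (min_le_right _ _) hl))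
  · intro t₀ ht₀
    -- `E m` asks for size above 1/(m+1) throughout the ball of radius 1/(m+1) around t₀. These
    -- events increase, and their union contains survival at t₀, so some `E m` already has measure
    -- above c.
    set E : ℕ → Set (St d) := fun m =>
      {ℓ | ∀ t ∈ Metric.ball t₀ (1 / ((m : ℝ) + 1)), Big (1 / ((m : ℝ) + 1)) k ℓ t} with hE
    have hmono : Monotone E := fun m n hmn ℓ hℓ t ht => by
      have hle : 1 / ((n : ℝ) + 1) ≤ 1 / ((m : ℝ) + 1) :=
        one_div_le_one_div_of_le (by positivity) (by gcongr)
      exact Big.mono_left hle (hℓ t (Metric.ball_subset_ball hle ht))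
    have hsub : {ℓ | Big 0 k ℓ t₀} ⊆ ⋃ m, E m := by
      rintro ℓ ⟨F, hF, hb⟩
      have h1 : ∀ᶠ p : ℝ × (Fin d → ℝ) in 𝓝 (0, t₀), ∀ j ∈ F, p.1 < ‖(ℓ j)ᵀ *ᵥ p.2‖ := by
        rw [Filter.eventually_all_finset]
        intro j hj
        have : IsOpen {p : ℝ × (Fin d → ℝ) | p.1 < ‖(ℓ j)ᵀ *ᵥ p.2‖} :=
          isOpen_lt continuous_fst (by fun_prop)
        exact this.mem_nhds (hb j hj)
      obtain ⟨ε, hε, hball⟩ := Metric.eventually_nhds_iff_ball.1 h1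
      obtain ⟨m, hm⟩ := exists_nat_one_div_lt hε
      refine Set.mem_iUnion.2 ⟨m, fun t ht => ⟨F, hF, fun j hj => hball (_, t) ?_ j hj⟩⟩
      rw [← ball_prod_same]
      refine ⟨?_, Metric.ball_subset_ball hm.le ht⟩
      have : (0 : ℝ) < 1 / ((m : ℝ) + 1) := by positivity
      rwa [Metric.mem_ball, Real.dist_eq, sub_zero, abs_of_pos this]
    have := (h t₀ ht₀).trans_le (measure_mono hsub)
    rw [hmono.measure_iUnion, lt_iSup_iff] at this
    obtain ⟨m, hm⟩ := this
    refine ⟨Metric.ball t₀ (1 / ((m : ℝ) + 1)),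
      mem_nhdsWithin_of_mem_nhds (Metric.ball_mem_nhds _ (by positivity)),
      1 / ((m : ℝ) + 1), by positivity, Q (E m), hm, fun t ht => measure_mono fun ℓ hℓ => hℓ t ht⟩

end Big

/-! ### Survival of directions along the chain -/

section Survival

variable {d : ℕ} {Ω : Type*} [MeasurableSpace Ω] (P : Measure Ω) [IsProbabilityMeasure P]
  {A : ℕ → Ω → Mat d}

omit [MeasurableSpace Ω] in
lemma big_branch {ℓ : St d} {ω : ℕ → Ω}
    (hω : ∀ i, ∀ t : Fin d → ℝ, t ≠ 0 → ∃ j, (A j (ω i))ᵀ *ᵥ t ≠ 0) {k : ℕ} {t : Fin d → ℝ}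
    (hb : Big 0 k ℓ t) : Big 0 k (branch A (ℓ, ω)) t := by
  obtain ⟨F, hF, hb⟩ := hb
  have : ∀ i ∈ F, ∃ j, (A j (ω i))ᵀ *ᵥ ((ℓ i)ᵀ *ᵥ t) ≠ 0 := fun i hi =>
    hω i _ (norm_pos_iff.1 (hb i hi))
  choose! f hf using this
  refine ⟨F.image fun i => Nat.pair i (f i), ?_, ?_⟩
  · rw [Finset.card_image_of_injective _ fun a b hab => (Nat.pair_eq_pair.1 hab).1, hF]
  · intro j hj
    obtain ⟨i, hi, rfl⟩ := Finset.mem_image.1 hj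
    simp only [branch, Nat.unpair_pair, Matrix.transpose_mul,
      ← Matrix.mulVec_mulVec]
    exact norm_pos_iff.2 (hf i hi)

-- Every live particle keeps one live child `f i`. Of the two live children of i₀, at least one
-- differs from `f i₀`, and it provides the additional index.
omit [MeasurableSpace Ω] in
lemma big_branch_succ {ℓ : St d} {ω : ℕ → Ω}
    (hω : ∀ i, ∀ t : Fin d → ℝ, t ≠ 0 → ∃ j, (A j (ω i))ᵀ *ᵥ t ≠ 0) {k : ℕ} {t : Fin d → ℝ}
    {F : Finset ℕ} (hF : F.card = k) (hb : ∀ j ∈ F, 0 < ‖(ℓ j)ᵀ *ᵥ t‖) {i₀ : ℕ} (hi₀ : i₀ ∈ F)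
    (h2 : Big 0 2 (fun j => A j (ω i₀)) ((ℓ i₀)ᵀ *ᵥ t)) :
    Big 0 (k + 1) (branch A (ℓ, ω)) t := by
  have : ∀ i ∈ F, ∃ j, (A j (ω i))ᵀ *ᵥ ((ℓ i)ᵀ *ᵥ t) ≠ 0 := fun i hi =>
    hω i _ (norm_pos_iff.1 (hb i hi))
  choose! f hf using this
  obtain ⟨G, hG, hGb⟩ := h2
  obtain ⟨j₀, hj₀, hne⟩ := Finset.exists_mem_ne (by omega : 1 < G.card) (f i₀)
  have hnot : Nat.pair i₀ j₀ ∉ F.image fun i => Nat.pair i (f i) := by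
    intro h
    obtain ⟨i, -, hi⟩ := Finset.mem_image.1 h
    obtain ⟨rfl, hj⟩ := Nat.pair_eq_pair.1 hi
    exact hne hj.symm
  refine ⟨insert (Nat.pair i₀ j₀) (F.image fun i => Nat.pair i (f i)), ?_, ?_⟩
  · rw [Finset.card_insert_of_notMem hnot,
      Finset.card_image_of_injective _ fun a b hab => (Nat.pair_eq_pair.1 hab).1, hF]
  · intro j hj
    rcases Finset.mem_insert.1 hj with rfl | hj
    · simp only [branch, Nat.unpair_pair, Matrix.transpose_mul,
        ← Matrix.mulVec_mulVec]
      exact hGb j₀ hj₀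
    · obtain ⟨i, hi, rfl⟩ := Finset.mem_image.1 hj
      simp only [branch, Nat.unpair_pair, Matrix.transpose_mul,
        ← Matrix.mulVec_mulVec]
      exact norm_pos_iff.2 (hf i hi)

lemma step_forall_big (hA : ∀ i, Measurable (A i))
    (hne : ∀ᵐ ω ∂P, ∀ t : Fin d → ℝ, t ≠ 0 → ∃ j, (A j ω)ᵀ *ᵥ t ≠ 0) {k : ℕ}
    {C : Set (Fin d → ℝ)} (hC : IsSigmaCompact C) {ℓ : St d} (hℓ : ∀ t ∈ C, Big 0 k ℓ t) :
    ∀ᵐ ℓ' ∂(step P A ℓ), ∀ t ∈ C, Big 0 k ℓ' t := by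
  rw [step_apply P hA, ae_map_iff (measurable_branch_right hA ℓ).aemeasurable
    (p := fun ℓ' => ∀ t ∈ C, Big 0 k ℓ' t) (measurableSet_forall_big 0 k hC)]
  filter_upwards [ae_infinitePi P hne] with ω hω t ht using big_branch hω (hℓ t ht)

/-- It is enough that one fixed live particle i₀ splits. That event depends on a single coordinate
of the environment, so the bound q does not depend on ℓ. -/
lemma step_compl_big_le (hA : ∀ i, Measurable (A i))
    (hne : ∀ᵐ ω ∂P, ∀ t : Fin d → ℝ, t ≠ 0 → ∃ j, (A j ω)ᵀ *ᵥ t ≠ 0) {q : ℝ≥0∞}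
    (hq : ∀ t : Fin d → ℝ, t ≠ 0 → P {ω | Big 0 2 (fun j => A j ω) t}ᶜ ≤ q)
    {k : ℕ} {t : Fin d → ℝ} {ℓ : St d} (hℓ : Big 0 (k + 1) ℓ t) :
    step P A ℓ {ℓ' | Big 0 (k + 2) ℓ' t}ᶜ ≤ q := by
  obtain ⟨F, hF, hb⟩ := hℓ
  obtain ⟨i₀, hi₀⟩ : F.Nonempty := Finset.card_pos.1 (by omega)
  rw [step_apply P hA, Measure.map_apply (measurable_branch_right hA ℓ)
    (measurableSet_big _ _ _).compl]
  have hmeas : MeasurableSet {ω | Big 0 2 (fun j => A j ω) ((ℓ i₀)ᵀ *ᵥ t)}ᶜ :=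
    ((measurableSet_big 0 2 ((ℓ i₀)ᵀ *ᵥ t)).preimage (measurable_pi_lambda _ hA)).compl
  refine le_trans ?_ (hq ((ℓ i₀)ᵀ *ᵥ t) (norm_pos_iff.1 (hb i₀ hi₀)))
  rw [← (measurePreserving_eval_infinitePi (fun _ : ℕ => P) i₀).measure_preimage
    hmeas.nullMeasurableSet]
  refine measure_mono_ae ?_
  filter_upwards [ae_infinitePi P hne] with ω hω hnot h2
  exact hnot (big_branch_succ hω hF hb hi₀ h2)

/-- Uniformly in the direction, many particles survive after a long time. -/
lemma exists_time_big (hA : ∀ i, Measurable (A i))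
    (hne : ∀ᵐ ω ∂P, ∀ t : Fin d → ℝ, t ≠ 0 → ∃ j, (A j ω)ᵀ *ᵥ t ≠ 0) {q : ℝ≥0∞} (hq1 : q < 1)
    (hq : ∀ t : Fin d → ℝ, t ≠ 0 → P {ω | Big 0 2 (fun j => A j ω) t}ᶜ ≤ q)
    {ε : ℝ≥0∞} (hε : ε ≠ 0) (k : ℕ) :
    ∃ m : ℕ, ∀ n, m ≤ n → ∀ (t : Fin d → ℝ) (ℓ : St d), Big 0 1 ℓ t →
      (step P A ^ n) ℓ {ℓ' | Big 0 k ℓ' t}ᶜ ≤ ε := by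
  have := isMarkovKernel_step P hA
  obtain ⟨m, hm⟩ := exists_time_pow_compl_le (step P A) hq1 hε k
  refine ⟨m, fun n hn t ℓ hℓ => ?_⟩
  -- The k-th set is survival along k + 1 particles, because the chain starts with one; the
  -- conclusion is then weakened from k + 1 to k.
  refine le_trans (measure_mono (Set.compl_subset_compl.2 fun ℓ' h => Big.of_le (Nat.le_succ k) h))
    (hm (fun k => {ℓ | Big 0 (k + 1) ℓ t}) (fun k => measurableSet_big _ _ _) (fun k x hx => ?_)
      (fun k x hx => step_compl_big_le P hA hne hq hx) n hn ℓ hℓ)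
  have := step_forall_big P hA hne (C := {t}) isCompact_singleton.isSigmaCompact
    (k := k + 1) (ℓ := x) (by simpa using hx)
  simpa using this

/-- All directions in a subspace eventually survive along many particles. -/
lemma tendsto_pow_compl_forall_big (hA : ∀ i, Measurable (A i)) {N : Ω → ℕ}
    (h0 : ∀ᵐ ω ∂P, ∀ i, N ω ≤ i → A i ω = 0)
    (hne : ∀ᵐ ω ∂P, ∀ t : Fin d → ℝ, t ≠ 0 → ∃ j, (A j ω)ᵀ *ᵥ t ≠ 0) {q : ℝ≥0∞} (hq1 : q < 1)
    (hq : ∀ t : Fin d → ℝ, t ≠ 0 → P {ω | Big 0 2 (fun j => A j ω) t}ᶜ ≤ q) (k : ℕ)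
    (W : Submodule ℝ (Fin d → ℝ)) :
    ∀ ℓ ∈ finStates d, (∀ t : Fin d → ℝ, t ≠ 0 → Big 0 1 ℓ t) →
      Tendsto (fun n => (step P A ^ n) ℓ {ℓ' | ∀ t ∈ (W : Set (Fin d → ℝ)) ∩ {0}ᶜ, Big 0 k ℓ' t}ᶜ)
        atTop (𝓝 0) := by
  have hmk := isMarkovKernel_step P hA
  have hmkp := isMarkovKernel_pow (step P A)
  induction hw : Module.finrank ℝ W using Nat.strong_induction_on generalizing W with
  | _ w ih =>
  intro ℓ hfin hℓ
  have hWm : ∀ W : Submodule ℝ (Fin d → ℝ), IsSigmaCompact ((W : Set (Fin d → ℝ)) ∩ {0}ᶜ) :=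
    fun W => isSigmaCompact_inter_isOpen W.closed_of_finiteDimensional isOpen_compl_singleton
  rcases eq_or_ne W ⊥ with rfl | hWne
  · simp
  obtain ⟨t₀, ht₀W, ht₀⟩ := W.exists_mem_ne_zero_of_ne_bot hWne
  set bad : Submodule ℝ (Fin d → ℝ) → Set (St d) := fun W =>
    {ℓ' | ∀ t ∈ (W : Set (Fin d → ℝ)) ∩ {0}ᶜ, Big 0 k ℓ' t}ᶜ with hbad
  have hbm : ∀ W, MeasurableSet (bad W) := fun W => (measurableSet_forall_big 0 k (hWm W)).compl
  -- convergence from a state in which `t₀` survives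
  have key : ∀ ℓ' ∈ finStates d, (∀ t : Fin d → ℝ, t ≠ 0 → Big 0 1 ℓ' t) → Big 0 k ℓ' t₀ →
      Tendsto (fun n => (step P A ^ n) ℓ' (bad W)) atTop (𝓝 0) := by
    rintro ℓ' ⟨K, hK⟩ hℓ' hb₀
    -- `sub J` collects the directions of W that are alive only along particles of J. A direction
    -- alive along fewer than k particles of ℓ' lies in some `sub J` with `J.card < k`. Since t₀ is
    -- alive along k particles it is not in `sub J`, so the dimension drops and the induction
    -- applies. Only finitely many J matter because ℓ' has finitely many nonzero weights.
    let sub : Finset ℕ → Submodule ℝ (Fin d → ℝ) := fun J =>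
      W ⊓ ⨅ u : ℕ, ⨅ _ : u ∉ J, LinearMap.ker (Matrix.mulVecLin (ℓ' u)ᵀ)
    have hmem : ∀ J t, t ∈ sub J ↔ t ∈ W ∧ ∀ u ∉ J, (ℓ' u)ᵀ *ᵥ t = 0 := by
      intro J t
      simp only [sub, Submodule.mem_inf, Submodule.mem_iInf, LinearMap.mem_ker,
        Matrix.mulVecLin_apply]
    set JJ := (Finset.range K).powerset.filter fun J => J.card < k with hJJ
    have hlt : ∀ J ∈ JJ, Tendsto (fun n => (step P A ^ n) ℓ' (bad (sub J))) atTop (𝓝 0) := by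
      intro J hJ
      have hJk : J.card < k := (Finset.mem_filter.1 hJ).2
      refine ih (Module.finrank ℝ (sub J)) ?_ (sub J) rfl ℓ' ⟨K, hK⟩ hℓ'
      rw [← hw]
      refine Submodule.finrank_lt_finrank_of_lt (lt_of_le_of_ne inf_le_left fun heq => ?_)
      have ht : t₀ ∈ sub J := by rw [heq]; exact ht₀W
      obtain ⟨F, hF, hFb⟩ := hb₀
      have : F ⊆ J := fun j hj => by
        by_contra hjJ
        have := hFb j hj
        rw [((hmem J t₀).1 ht).2 j hjJ] at this
        simp at this
      have := Finset.card_le_card this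
      omega
    have hU : IsSigmaCompact {t : Fin d → ℝ | Big 0 k ℓ' t} := by
      have ho : IsOpen {t : Fin d → ℝ | Big 0 k ℓ' t} :=
        (isOpen_big 0 k).preimage (f := fun t => (ℓ', t)) (by fun_prop)
      simpa using isSigmaCompact_inter_isOpen isClosed_univ ho
    have hM : ∀ n, ∀ᵐ x ∂((step P A ^ n) ℓ'), ∀ t, Big 0 k ℓ' t → Big 0 k x t := fun n =>
      ae_pow_of_absorbing (step P A) (measurableSet_forall_big 0 k hU)
        (fun x hx => step_forall_big P hA hne hU hx) n ℓ' (fun t ht => ht)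
    have hle : ∀ n, (step P A ^ n) ℓ' (bad W) ≤ ∑ J ∈ JJ, (step P A ^ n) ℓ' (bad (sub J)) := by
      intro n
      refine le_trans (measure_mono_ae ?_) (measure_biUnion_finset_le JJ fun J => bad (sub J))
      filter_upwards [hM n] with x hx hxb
      obtain ⟨t, ht, htb⟩ : ∃ t ∈ (W : Set (Fin d → ℝ)) ∩ {0}ᶜ, ¬ Big 0 k x t := by
        by_contra! h
        exact hxb h
      have htb' : ¬ Big 0 k ℓ' t := fun h => htb (hx t h)
      set J := (Finset.range K).filter fun u => (ℓ' u)ᵀ *ᵥ t ≠ 0 with hJ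
      refine Set.mem_biUnion (x := J) ?_ ?_
      · rw [hJJ, Finset.mem_coe, Finset.mem_filter, Finset.mem_powerset]
        refine ⟨Finset.filter_subset _ _, ?_⟩
        by_contra hcard
        exact htb' (Big.of_le (not_lt.1 hcard) ⟨J, rfl, fun j hj =>
          norm_pos_iff.2 (Finset.mem_filter.1 hj).2⟩)
      · refine fun hall => htb (hall t ⟨(hmem J t).2 ⟨ht.1, fun u hu => ?_⟩, ht.2⟩)
        by_cases huK : u < K
        · by_contra hne0
          exact hu (Finset.mem_filter.2 ⟨Finset.mem_range.2 huK, hne0⟩)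
        · simp [hK u (not_lt.1 huK)]
    refine tendsto_of_tendsto_of_tendsto_of_le_of_le tendsto_const_nhds ?_ (fun n => zero_le) hle
    simpa using tendsto_finsetSum JJ hlt
  -- Up to probability ε/2, t₀ is alive along k particles at time m. From such states `key` gives
  -- convergence, and dominated convergence averages it over the state at time m.
  refine ENNReal.tendsto_atTop_zero.2 fun ε hε => ?_
  have hε2 : 0 < ε / 2 := ENNReal.half_pos hε.ne'
  obtain ⟨m, hm⟩ := exists_time_big P hA hne hq1 hq hε2.ne' k
  set B : Set (St d) := {ℓ' | Big 0 k ℓ' t₀} with hBdef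
  have hB : MeasurableSet B := measurableSet_big 0 k t₀
  have hlim : Tendsto (fun n => ∫⁻ y, B.indicator (fun y => (step P A ^ n) y (bad W)) y
      ∂((step P A ^ m) ℓ)) atTop (𝓝 0) := by
    have : (0 : ℝ≥0∞) = ∫⁻ _, 0 ∂((step P A ^ m) ℓ) := by simp
    rw [this]
    refine tendsto_lintegral_of_dominated_convergence (fun _ => 1)
      (fun n => ((step P A ^ n).measurable_coe (hbm W)).indicator hB)
      (fun n => ae_of_all _ fun y => ?_) (by simp) ?_
    · by_cases hy : y ∈ B
      · simpa [hy] using prob_le_one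
      · simp [hy]
    · have hG : IsSigmaCompact ({0}ᶜ : Set (Fin d → ℝ)) := by
        simpa using isSigmaCompact_inter_isOpen isClosed_univ
          (isOpen_compl_singleton (x := (0 : Fin d → ℝ)))
      filter_upwards [ae_pow_of_absorbing (step P A) measurableSet_finStates
          (fun x hx => step_finStates P hA h0 hx) m ℓ hfin,
        ae_pow_of_absorbing (step P A) (measurableSet_forall_big 0 1 hG)
          (fun x hx => step_forall_big P hA hne hG hx) m ℓ (fun t ht => hℓ t ht)] with y hy1 hy2
      by_cases hy : y ∈ B
      · simpa [hy] using key y hy1 (fun t ht => hy2 t ht) hy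
      · simp [hy]
  obtain ⟨n₀, hn₀⟩ := ENNReal.tendsto_atTop_zero.1 hlim _ hε2
  refine ⟨m + n₀, fun n hn => ?_⟩
  obtain ⟨j, rfl⟩ := Nat.exists_eq_add_of_le hn
  rw [add_assoc, Kernel.pow_add_apply_eq_lintegral _ m (n₀ + j) ℓ (hbm W)]
  calc ∫⁻ y, (step P A ^ (n₀ + j)) y (bad W) ∂((step P A ^ m) ℓ)
      ≤ ∫⁻ y, (B.indicator (fun y => (step P A ^ (n₀ + j)) y (bad W)) y + Bᶜ.indicator 1 y)
          ∂((step P A ^ m) ℓ) := by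
        refine lintegral_mono fun y => ?_
        by_cases hy : y ∈ B
        · simp [hy]
        · simpa [hy] using prob_le_one
    _ ≤ ε / 2 + ε / 2 := by
        rw [lintegral_add_right _ (measurable_one.indicator hB.compl),
          lintegral_indicator_one hB.compl]
        exact add_le_add (hn₀ _ (Nat.le_add_right _ _)) (hm m le_rfl t₀ ℓ (hℓ t₀ ht₀))
    _ = ε := ENNReal.add_halves ε

end Survival

end SmoothingTransform
end

noncomputable section

namespace SmoothingTransform

/-! ### Integrable characteristic functions -/

section FourierInversion

open FourierTransform SchwartzMap
open scoped Manifold ContDiff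

variable {E : Type*} [NormedAddCommGroup E] [InnerProductSpace ℝ E] [FiniteDimensional ℝ E]
  [MeasurableSpace E] [BorelSpace E]

/-- Parseval's identity: write f as the Fourier transform of g, exchange the two integrals, and
bound |g| by the L¹ norm of f. -/
lemma norm_integral_schwartz_le (η : Measure E) [IsProbabilityMeasure η]
    (h : Integrable (charFun η)) (f : 𝓢(E, ℂ)) :
    ‖∫ x, f x ∂η‖ ≤ (∫ v, ‖charFun η (-(2 * Real.pi) • v)‖) * ∫ x, ‖f x‖ := by
  set g : 𝓢(E, ℂ) := 𝓕⁻ f with hg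
  have hf : 𝓕 g = f := fourier_fourierInv_eq f
  have hgb : ∀ v, ‖g v‖ ≤ ∫ x, ‖f x‖ := fun v => by
    rw [hg, SchwartzMap.fourierInv_coe, Real.fourierInv_eq_fourier_neg]
    exact VectorFourier.norm_fourierIntegral_le_integral_norm _ _ _ _ _
  have hcf : ∀ v : E, VectorFourier.fourierIntegral Real.fourierChar η (innerₗ E).flip
      (fun _ => (1 : ℂ)) v = charFun η (-(2 * Real.pi) • v) := fun v => by
    rw [charFun_eq_fourierIntegral', smul_smul]
    have : -(2 * Real.pi)⁻¹ * -(2 * Real.pi) = 1 := by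
      field_simp
    rw [this, one_smul]
    have hflip : (innerₗ E).flip = innerₗ E := by ext x y; simp
    rw [hflip]
    rfl
  have hswap := VectorFourier.integral_fourierIntegral_smul_eq_flip (μ := volume) (ν := η)
    (e := Real.fourierChar) (L := innerₗ E) (f := g) (g := fun _ => (1 : ℂ))
    Real.continuous_fourierChar (by simpa using continuous_inner) g.integrable
    (integrable_const _)
  have hint : Integrable fun v : E => ‖charFun η (-(2 * Real.pi) • v)‖ :=
    (h.comp_smul (by simp [Real.pi_ne_zero] : -(2 * Real.pi) ≠ 0)).norm
  have hl : ∫ x, f x ∂η = ∫ v, g v • charFun η (-(2 * Real.pi) • v) := by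
    simp only [hcf, smul_eq_mul, mul_one] at hswap
    simp only [smul_eq_mul, ← hswap]
    refine integral_congr_ae (ae_of_all _ fun x => ?_)
    rw [← hf]
    rfl
  rw [hl]
  refine (norm_integral_le_integral_norm _).trans ?_
  rw [← integral_mul_const]
  refine integral_mono_of_nonneg (ae_of_all _ fun _ => norm_nonneg _) (hint.mul_const _)
    (ae_of_all _ fun v => ?_)
  change ‖g v • _‖ ≤ _
  rw [norm_smul, mul_comm]
  exact mul_le_mul_of_nonneg_left (hgb v) (norm_nonneg _)

/-- A smooth bump equal to 1 on K and vanishing off U compares the two measures. U is intersected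
with a ball so that the bump has compact support and is a Schwartz function. -/
lemma measure_compact_le (η : Measure E) [IsProbabilityMeasure η]
    (h : Integrable (charFun η)) {K U : Set E} (hK : IsCompact K) (hU : IsOpen U) (hKU : K ⊆ U) :
    η K ≤ ENNReal.ofReal (∫ v, ‖charFun η (-(2 * Real.pi) • v)‖) * volume U := by
  obtain ⟨R, hR⟩ := hK.isBounded.subset_ball 0
  obtain ⟨f, hfs, hfr, hfsupp, hf1⟩ := exists_contMDiff_support_eq_eq_one_iff (n := ⊤) 𝓘(ℝ, E)
    (hU.inter (Metric.isOpen_ball (x := (0 : E)) (ε := R))) hK.isClosed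
    (Set.subset_inter hKU hR)
  have hf01 : ∀ x, f x ∈ Set.Icc (0 : ℝ) 1 := fun x => hfr ⟨x, rfl⟩
  have hfc : HasCompactSupport f := by
    refine HasCompactSupport.of_support_subset_isCompact
      (isCompact_closedBall (0 : E) R) ?_
    rw [hfsupp]
    exact Set.inter_subset_right.trans Metric.ball_subset_closedBall
  have hFs : ContDiff ℝ ((⊤ : ℕ∞) : WithTop ℕ∞) fun x => (f x : ℂ) :=
    Complex.ofRealCLM.contDiff.comp hfs.contDiff
  have hFc : HasCompactSupport fun x => (f x : ℂ) :=
    hfc.comp_left (g := fun r : ℝ => (r : ℂ)) Complex.ofReal_zero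
  set F : 𝓢(E, ℂ) := hFc.toSchwartzMap hFs with hF
  have hFx : ∀ x, F x = (f x : ℂ) := fun x => rfl
  set C := ∫ v, ‖charFun η (-(2 * Real.pi) • v)‖ with hC
  have hC0 : 0 ≤ C := integral_nonneg fun _ => norm_nonneg _
  have hb := norm_integral_schwartz_le η h F
  simp only [hFx] at hb
  rw [integral_complex_ofReal, Complex.norm_real,
    Real.norm_of_nonneg (integral_nonneg fun x => (hf01 x).1)] at hb
  have hn : ∀ x, ‖(f x : ℂ)‖ = f x := fun x => by
    rw [Complex.norm_real, Real.norm_of_nonneg (hf01 x).1]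
  simp only [hn] at hb
  have hfi : Integrable f η := by
    refine Integrable.of_bound (C := 1) hfs.contDiff.continuous.aestronglyMeasurable
      (ae_of_all _ fun x => ?_)
    rw [Real.norm_of_nonneg (hf01 x).1]
    exact (hf01 x).2
  have hfv : Integrable f volume := hfs.contDiff.continuous.integrable_of_hasCompactSupport hfc
  calc η K ≤ ∫⁻ x, ENNReal.ofReal (f x) ∂η := by
        rw [← lintegral_indicator_one hK.measurableSet]
        refine lintegral_mono fun x => ?_
        by_cases hx : x ∈ K
        · simp [hx, (hf1 x).1 hx]
        · simp [hx]
    _ = ENNReal.ofReal (∫ x, f x ∂η) :=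
        (ofReal_integral_eq_lintegral_ofReal hfi (ae_of_all _ fun x => (hf01 x).1)).symm
    _ ≤ ENNReal.ofReal (C * ∫ x, f x) := ENNReal.ofReal_le_ofReal hb
    _ = ENNReal.ofReal C * ∫⁻ x, ENNReal.ofReal (f x) := by
        rw [ENNReal.ofReal_mul hC0,
          ofReal_integral_eq_lintegral_ofReal hfv (ae_of_all _ fun x => (hf01 x).1)]
    _ ≤ ENNReal.ofReal C * volume U := by
        gcongr
        rw [← lintegral_indicator_one hU.measurableSet]
        refine lintegral_mono fun x => ?_
        by_cases hx : x ∈ U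
        · simpa [hx] using (hf01 x).2
        · have : f x = 0 := by
            rw [← Function.notMem_support, hfsupp]
            exact fun h => hx h.1
          simp [this]

/-- Inner regularity of η reduces a null set to a compact K, and outer regularity of Lebesgue
measure encloses K in an open set of arbitrarily small volume. -/
lemma absolutelyContinuous_of_integrable_charFun (η : Measure E) [IsProbabilityMeasure η]
    (h : Integrable (charFun η)) : η ≪ volume := by
  refine Measure.AbsolutelyContinuous.mk fun B hB hB0 => ?_
  rw [hB.measure_eq_iSup_isCompact]
  simp only [ENNReal.iSup_eq_zero]
  intro K hKB hK
  have hK0 : volume K = 0 := measure_mono_null hKB hB0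
  refine le_antisymm (le_of_forall_gt fun ε hε => ?_) zero_le
  set C := ∫ v, ‖charFun η (-(2 * Real.pi) • v)‖ with hC
  have hδ : 0 < ε / (ENNReal.ofReal C + 1) := ENNReal.div_pos hε.ne' (by simp)
  obtain ⟨U, hKU, hU, hUv⟩ := K.exists_isOpen_lt_of_lt _ (hK0 ▸ hδ)
  refine (measure_compact_le η h hK hU hKU).trans_lt ?_
  calc ENNReal.ofReal C * volume U ≤ (ENNReal.ofReal C + 1) * volume U := by
        gcongr; exact le_self_add
    _ < ε := by
        rw [mul_comm]
        exact (ENNReal.lt_div_iff_mul_lt (by simp) (by simp)).1 hUv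

end FourierInversion

lemma absolutelyContinuous_of_integrable_cf {d : ℕ} (η : Measure (Fin d → ℝ))
    [IsProbabilityMeasure η] (h : Integrable (cf η)) : η ≪ volume := by
  set e : (Fin d → ℝ) → EuclideanSpace ℝ (Fin d) := WithLp.toLp 2 with he
  have hmp := PiLp.volume_preserving_toLp (Fin d)
  have hmp' := PiLp.volume_preserving_ofLp (Fin d)
  have : IsProbabilityMeasure (η.map e) :=
    Measure.isProbabilityMeasure_map hmp.measurable.aemeasurable
  have hcf : charFun (η.map e) = fun t => cf η (WithLp.ofLp t) := by
    ext t
    rw [charFun_apply, integral_map hmp.measurable.aemeasurable (by fun_prop), cf]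
    refine integral_congr_ae (ae_of_all _ fun x => ?_)
    simp [EuclideanSpace.inner_eq_star_dotProduct]
  have hac : η.map e ≪ volume := by
    refine absolutelyContinuous_of_integrable_charFun _ ?_
    rw [hcf]
    exact hmp'.integrable_comp_of_integrable h
  refine Measure.AbsolutelyContinuous.mk fun B hB hB0 => ?_
  have h1 : volume (WithLp.ofLp ⁻¹' B : Set (EuclideanSpace ℝ (Fin d))) = 0 := by
    rw [hmp'.measure_preimage hB.nullMeasurableSet, hB0]
  have h2 := hac h1
  rwa [Measure.map_apply hmp.measurable (hmp'.measurable hB)] at h2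

end SmoothingTransform
end

noncomputable section

namespace SmoothingTransform

open ProbabilityTheory

/-! ### The operator norm -/

section OpNorm

variable {d : ℕ}

/-- A matrix as a continuous linear map of `ℝ^d` with the `L¹` norm. -/
def toL1 : Mat d →ₗ[ℝ] (PiLp 1 (fun _ : Fin d => ℝ) →L[ℝ] PiLp 1 (fun _ : Fin d => ℝ)) :=
  (LinearMap.toContinuousLinearMap (𝕜 := ℝ) (E := PiLp 1 (fun _ : Fin d => ℝ))
    (F' := PiLp 1 (fun _ : Fin d => ℝ))).toLinearMap ∘ₗ (Matrix.toLpLin 1 1).toLinearMap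

lemma opNorm_eq (a : Mat d) : opNorm a = ‖toL1 a‖ := rfl

lemma opNorm_nonneg (a : Mat d) : 0 ≤ opNorm a := norm_nonneg _

lemma opNorm_zero : opNorm (0 : Mat d) = 0 := by rw [opNorm_eq, map_zero, norm_zero]

lemma continuous_opNorm : Continuous (opNorm (d := d)) :=
  continuous_norm.comp (toL1 (d := d)).continuous_of_finiteDimensional

lemma toL1_mul (a b : Mat d) : toL1 (a * b) = (toL1 a).comp (toL1 b) := by
  ext x i
  simp [toL1, Matrix.mulVec_mulVec]

lemma opNorm_mul_le (a b : Mat d) : opNorm (a * b) ≤ opNorm a * opNorm b := by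
  rw [opNorm_eq, toL1_mul]
  exact ContinuousLinearMap.opNorm_comp_le _ _

/-- The norm on `Fin d → ℝ` is the supremum norm, dual to the L¹ norm. The columns of a, being
images of the unit vectors, have L¹ norm at most `opNorm a`. -/
lemma norm_transpose_mulVec_le (a : Mat d) (t : Fin d → ℝ) :
    ‖aᵀ *ᵥ t‖ ≤ opNorm a * ‖t‖ := by
  rw [pi_norm_le_iff_of_nonneg (mul_nonneg (opNorm_nonneg a) (norm_nonneg t))]
  intro j
  have h1 : ∑ i, |a i j| ≤ opNorm a := by
    have := (toL1 a).le_opNorm (PiLp.single 1 j (1 : ℝ))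
    rw [PiLp.norm_single, norm_one, mul_one] at this
    refine le_trans (le_of_eq ?_) this
    rw [PiLp.norm_eq_of_L1]
    simp [toL1]
  calc ‖(aᵀ *ᵥ t) j‖ ≤ ∑ i, |a i j| * ‖t‖ := by
        simp only [Matrix.mulVec, dotProduct, Matrix.transpose_apply]
        refine (norm_sum_le _ _).trans (Finset.sum_le_sum fun i _ => ?_)
        rw [norm_mul, Real.norm_eq_abs]
        gcongr
        exact norm_le_pi_norm t i
    _ ≤ opNorm a * ‖t‖ := by
        rw [← Finset.sum_mul]; gcongr

end OpNorm

/-! ### Moments of the weights -/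

lemma measurable_list_prod {d : ℕ} (n : ℕ) :
    Measurable fun M : Fin n → Mat d => (List.ofFn M).reverse.prod := by
  have : Continuous fun M : Fin n → Mat d => (List.ofFn M).reverse.prod := by
    have h := continuous_list_prod (f := fun (i : Fin n) (M : Fin n → Mat d) => M i)
      (List.finRange n).reverse (fun i _ => continuous_apply i)
    simpa [List.ofFn_eq_map, List.map_reverse] using h
  exact this.measurable


section Moments

variable {d : ℕ} {Ω : Type*} [MeasurableSpace Ω] (P : Measure Ω) [IsProbabilityMeasure P]
  {N : Ω → ℕ} {A : ℕ → Ω → Mat d}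

omit [IsProbabilityMeasure P] in
lemma meanN_eq_tsum (hN : Measurable N) : meanN P N = ∑' i : ℕ, P {ω | i < N ω} := by
  have h : ∀ ω, (N ω : ℝ≥0∞) = ∑' i : ℕ, {ω | i < N ω}.indicator 1 ω := fun ω => by
    rw [tsum_eq_sum (s := Finset.range (N ω))]
    · rw [Finset.sum_congr rfl (g := fun _ => 1)]
      · simp
      · intro i hi
        rw [Set.indicator_of_mem (by simpa using hi)]
        rfl
    · intro i hi
      rw [Set.indicator_of_notMem (by simpa using hi)]
  rw [meanN, lintegral_congr h, lintegral_tsum]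
  · congr 1; ext i
    exact lintegral_indicator_one (hN measurableSet_Ioi)
  · exact fun i => (measurable_one.indicator (hN measurableSet_Ioi)).aemeasurable

omit [IsProbabilityMeasure P] in
lemma isProbabilityMeasure_mu (hN : Measurable N) (hA : ∀ i, Measurable (A i))
    (h1 : 1 < meanN P N) (h2 : meanN P N < ⊤) : IsProbabilityMeasure (mu P N A) := by
  refine ⟨?_⟩
  rw [mu, Measure.smul_apply, Measure.sum_apply _ .univ]
  simp only [Measure.map_apply (hA _) .univ, Set.preimage_univ, Measure.restrict_apply_univ]
  rw [← meanN_eq_tsum P hN, smul_eq_mul]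
  exact ENNReal.inv_mul_cancel (one_pos.trans h1).ne' h2.ne

omit [IsProbabilityMeasure P] in
lemma tsum_lintegral_eq (hN : Measurable N) (hA : ∀ i, Measurable (A i))
    (h1 : 1 < meanN P N) (h2 : meanN P N < ⊤)
    (h0 : ∀ᵐ ω ∂P, ∀ i, N ω ≤ i → A i ω = 0) {f : Mat d → ℝ≥0∞} (hf : Measurable f)
    (hf0 : f 0 = 0) :
    ∑' j, ∫⁻ ω, f (A j ω) ∂P = meanN P N * ∫⁻ a, f a ∂(mu P N A) := by
  rw [mu, lintegral_smul_measure, lintegral_sum_measure, smul_eq_mul, ← mul_assoc,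
    ENNReal.mul_inv_cancel (one_pos.trans h1).ne' h2.ne, one_mul]
  congr 1; ext j
  have hm : MeasurableSet {ω | j < N ω} := hN measurableSet_Ioi
  rw [lintegral_map hf (hA j), ← lintegral_indicator hm]
  refine lintegral_congr_ae ?_
  filter_upwards [h0] with ω hω
  by_cases h : j < N ω
  · rw [Set.indicator_of_mem (by exact h)]
  · rw [Set.indicator_of_notMem (by exact h), hω j (not_lt.1 h), hf0]

lemma lintegral_step_tsum (hN : Measurable N) (hA : ∀ i, Measurable (A i))
    (h1 : 1 < meanN P N) (h2 : meanN P N < ⊤)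
    (h0 : ∀ᵐ ω ∂P, ∀ i, N ω ≤ i → A i ω = 0) {f : Mat d → ℝ≥0∞} (hf : Measurable f)
    (hf0 : f 0 = 0) (ℓ : St d) :
    ∫⁻ ℓ', ∑' k, f (ℓ' k) ∂(step P A ℓ)
      = ∑' k, meanN P N * ∫⁻ b, f (ℓ k * b) ∂(mu P N A) := by
  have hmul : ∀ a : Mat d, Measurable fun b => f (a * b) := fun a =>
    hf.comp (Measurable.matMul measurable_const measurable_id)
  have hk : ∀ k, AEMeasurable (fun ω : ℕ → Ω => f (branch A (ℓ, ω) k))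
      (Measure.infinitePi fun _ : ℕ => P) := fun k =>
    (hf.comp ((measurable_pi_apply k).comp (measurable_branch_right hA ℓ))).aemeasurable
  rw [step_apply P hA, lintegral_map (by fun_prop) (measurable_branch_right hA ℓ),
    lintegral_tsum hk]
  have h : ∀ k : ℕ, ∫⁻ ω : ℕ → Ω, f (branch A (ℓ, ω) k) ∂(Measure.infinitePi fun _ : ℕ => P)
      = ∫⁻ ω, f (ℓ k.unpair.1 * A k.unpair.2 ω) ∂P := fun k =>
    (measurePreserving_eval_infinitePi (fun _ : ℕ => P) k.unpair.1).lintegral_comp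
      ((hmul (ℓ k.unpair.1)).comp (hA k.unpair.2))
  simp only [h]
  rw [← Nat.pairEquiv.tsum_eq]
  simp only [Nat.pairEquiv_apply, Function.uncurry, Nat.unpair_pair]
  rw [ENNReal.tsum_prod (f := fun i j => ∫⁻ ω, f (ℓ i * A j ω) ∂P)]
  congr 1; ext i
  exact tsum_lintegral_eq P hN hA h1 h2 h0 (hmul (ℓ i)) (by simpa using hf0)

/-- Many-to-one formula: a sum over the n-th generation has the expectation of E[N]^n times one term
along a lineage of i.i.d. matrices of law μ. This connects the chain with κ. -/
lemma lintegral_step_pow_tsum (hN : Measurable N) (hA : ∀ i, Measurable (A i))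
    (h1 : 1 < meanN P N) (h2 : meanN P N < ⊤)
    (h0 : ∀ᵐ ω ∂P, ∀ i, N ω ≤ i → A i ω = 0) (n : ℕ) {f : Mat d → ℝ≥0∞} (hf : Measurable f)
    (hf0 : f 0 = 0) (ℓ : St d) :
    ∫⁻ ℓ', ∑' k, f (ℓ' k) ∂((step P A ^ n) ℓ)
      = ∑' k, meanN P N ^ n * ∫⁻ M : Fin n → Mat d, f (ℓ k * (List.ofFn M).reverse.prod)
          ∂(Measure.pi fun _ => mu P N A) := by
  have := isProbabilityMeasure_mu P hN hA h1 h2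
  induction n generalizing f with
  | zero =>
    have hm : Measurable fun ℓ' : St d => ∑' k, f (ℓ' k) := by fun_prop
    rw [kernel_pow_zero_apply, lintegral_dirac' _ hm]
    simp
  | succ n ih =>
    have hmk := isMarkovKernel_step P hA
    have hm : Measurable fun ℓ' : St d => ∑' k, f (ℓ' k) := by fun_prop
    rw [kernel_pow_succ_apply, Measure.lintegral_bind (Kernel.aemeasurable _) hm.aemeasurable,
      lintegral_congr fun ℓ' => lintegral_step_tsum P hN hA h1 h2 h0 hf hf0 ℓ']
    have hm2 : Measurable fun p : Mat d × Mat d => f (p.1 * p.2) :=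
      hf.comp (Measurable.matMul measurable_fst measurable_snd)
    rw [ih (f := fun a => meanN P N * ∫⁻ b, f (a * b) ∂(mu P N A))
      (hm2.lintegral_prod_right'.const_mul _) (by simp [hf0])]
    congr 1; ext k
    have hprod := measurable_list_prod (d := d) n
    -- The newest factor stands on the right of the product. After reversal of the list this is the
    -- entry of index 0, so that coordinate is split off.
    have hmp := measurePreserving_piFinSuccAbove (fun _ : Fin (n + 1) => mu P N A) 0
    have hm3 : Measurable fun p : Mat d × (Fin n → Mat d) =>
        f (ℓ k * (List.ofFn p.2).reverse.prod * p.1) :=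
      hf.comp (Measurable.matMul (Measurable.matMul measurable_const (hprod.comp measurable_snd))
        measurable_fst)
    have hR : ∫⁻ M : Fin (n + 1) → Mat d, f (ℓ k * (List.ofFn M).reverse.prod)
          ∂(Measure.pi fun _ => mu P N A)
        = ∫⁻ M : Fin n → Mat d, ∫⁻ b, f (ℓ k * (List.ofFn M).reverse.prod * b) ∂(mu P N A)
          ∂(Measure.pi fun _ => mu P N A) := by
      rw [← lintegral_prod_symm' _ hm3, ← hmp.lintegral_comp hm3]
      refine lintegral_congr fun M => ?_
      congr 1
      rw [List.ofFn_succ, List.reverse_cons, List.prod_append, List.prod_singleton, ← mul_assoc]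
      rfl
    rw [hR, lintegral_const_mul, pow_succ, mul_assoc]
    exact (hm2.lintegral_prod_right').comp (Measurable.matMul measurable_const hprod)

/-- `E ‖M_n ⋯ M_1‖^s` as an extended nonnegative number. -/
def lnormMoment (μ : Measure (Mat d)) (s : ℝ) (n : ℕ) : ℝ≥0∞ :=
  ∫⁻ M : Fin n → Mat d, ENNReal.ofReal (opNorm (List.ofFn M).reverse.prod ^ s)
    ∂(Measure.pi fun _ => μ)

lemma normMoment_eq (μ : Measure (Mat d)) (s : ℝ) (n : ℕ) :
    normMoment μ s n = (lnormMoment μ s n).toReal := by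
  rw [normMoment, lnormMoment, integral_eq_lintegral_of_nonneg_ae
    (ae_of_all _ fun M => Real.rpow_nonneg (opNorm_nonneg _) s)]
  exact ((continuous_opNorm.measurable.comp
    (measurable_list_prod n)).pow_const s).aestronglyMeasurable

/-- The sum of the norms of the weights to the power `s`. -/
def weightMoment (s : ℝ) (ℓ : St d) : ℝ≥0∞ := ∑' k, ENNReal.ofReal (opNorm (ℓ k) ^ s)

lemma measurable_opNorm_rpow (s : ℝ) :
    Measurable fun a : Mat d => ENNReal.ofReal (opNorm a ^ s) :=
  (continuous_opNorm.measurable.pow_const s).ennreal_ofReal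

lemma measurable_weightMoment (s : ℝ) : Measurable (weightMoment (d := d) s) :=
  Measurable.tsum fun k => (measurable_opNorm_rpow s).comp (measurable_pi_apply k)

lemma opNorm_rpow_zero {s : ℝ} (hs : 0 < s) : ENNReal.ofReal (opNorm (0 : Mat d) ^ s) = 0 := by
  rw [opNorm_zero, Real.zero_rpow hs.ne', ENNReal.ofReal_zero]

lemma opNorm_rpow_mul_le {s : ℝ} (hs : 0 < s) (a b : Mat d) :
    ENNReal.ofReal (opNorm (a * b) ^ s)
      ≤ ENNReal.ofReal (opNorm a ^ s) * ENNReal.ofReal (opNorm b ^ s) := by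
  rw [← ENNReal.ofReal_mul (Real.rpow_nonneg (opNorm_nonneg _) _),
    ← Real.mul_rpow (opNorm_nonneg _) (opNorm_nonneg _)]
  exact ENNReal.ofReal_le_ofReal
    (Real.rpow_le_rpow (opNorm_nonneg _) (opNorm_mul_le a b) hs.le)

lemma lintegral_weightMoment_le (hN : Measurable N) (hA : ∀ i, Measurable (A i))
    (h1 : 1 < meanN P N) (h2 : meanN P N < ⊤)
    (h0 : ∀ᵐ ω ∂P, ∀ i, N ω ≤ i → A i ω = 0) (n : ℕ) {s : ℝ} (hs : 0 < s) (ℓ : St d) :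
    ∫⁻ ℓ', weightMoment s ℓ' ∂((step P A ^ n) ℓ)
      ≤ meanN P N ^ n * lnormMoment (mu P N A) s n * weightMoment s ℓ := by
  unfold weightMoment
  rw [lintegral_step_pow_tsum P hN hA h1 h2 h0 n (measurable_opNorm_rpow s) (opNorm_rpow_zero hs),
    ← ENNReal.tsum_mul_left]
  refine ENNReal.tsum_le_tsum fun k => ?_
  rw [mul_assoc]
  gcongr
  rw [mul_comm, lnormMoment, ← lintegral_const_mul]
  · exact lintegral_mono fun M => opNorm_rpow_mul_le hs _ _
  · exact (measurable_opNorm_rpow s).comp (measurable_list_prod n)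

lemma weightMoment_root (s : ℝ) (hs : 0 < s) :
    weightMoment s (root d) = ENNReal.ofReal (opNorm (1 : Mat d) ^ s) := by
  rw [weightMoment, tsum_eq_single 0]
  · simp [root]
  · intro k hk
    simpa [root, Pi.single_apply, hk] using opNorm_rpow_zero (d := d) hs

lemma lintegral_weightMoment_root (hN : Measurable N) (hA : ∀ i, Measurable (A i))
    (h1 : 1 < meanN P N) (h2 : meanN P N < ⊤)
    (h0 : ∀ᵐ ω ∂P, ∀ i, N ω ≤ i → A i ω = 0) (n : ℕ) {s : ℝ} (hs : 0 < s) :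
    ∫⁻ ℓ', weightMoment s ℓ' ∂((step P A ^ n) (root d))
      = meanN P N ^ n * lnormMoment (mu P N A) s n := by
  unfold weightMoment
  rw [lintegral_step_pow_tsum P hN hA h1 h2 h0 n (measurable_opNorm_rpow s) (opNorm_rpow_zero hs),
    tsum_eq_single 0]
  · simp [root, lnormMoment]
  · intro k hk
    simp [root, hk, opNorm_zero, Real.zero_rpow hs.ne']

/-- By the Markov property, generation m + n descends in n steps from generation m; each of the two
stretches contributes its own moment. -/
lemma lnormMoment_add_le (hN : Measurable N) (hA : ∀ i, Measurable (A i))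
    (h1 : 1 < meanN P N) (h2 : meanN P N < ⊤)
    (h0 : ∀ᵐ ω ∂P, ∀ i, N ω ≤ i → A i ω = 0) (m n : ℕ) {s : ℝ} (hs : 0 < s) :
    lnormMoment (mu P N A) s (m + n)
      ≤ lnormMoment (mu P N A) s m * lnormMoment (mu P N A) s n := by
  have hc0 : meanN P N ^ (m + n) ≠ 0 := pow_ne_zero _ (one_pos.trans h1).ne'
  have hct : meanN P N ^ (m + n) ≠ ⊤ := ENNReal.pow_ne_top h2.ne
  rw [← ENNReal.mul_le_mul_iff_right hc0 hct,
    ← lintegral_weightMoment_root P hN hA h1 h2 h0 (m + n) hs]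
  have hpow : (step P A ^ (m + n)) (root d) = ((step P A ^ m) (root d)).bind (step P A ^ n) := by
    rw [add_comm, Kernel.pow_add, Kernel.comp_apply]
  rw [hpow, Measure.lintegral_bind (Kernel.aemeasurable _)
    (measurable_weightMoment s).aemeasurable]
  calc ∫⁻ ℓ, ∫⁻ ℓ', weightMoment s ℓ' ∂((step P A ^ n) ℓ) ∂((step P A ^ m) (root d))
      ≤ ∫⁻ ℓ, meanN P N ^ n * lnormMoment (mu P N A) s n * weightMoment s ℓ
          ∂((step P A ^ m) (root d)) :=
        lintegral_mono fun ℓ => lintegral_weightMoment_le P hN hA h1 h2 h0 n hs ℓ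
    _ = meanN P N ^ (m + n) * (lnormMoment (mu P N A) s m * lnormMoment (mu P N A) s n) := by
        rw [lintegral_const_mul _ (measurable_weightMoment s),
          lintegral_weightMoment_root P hN hA h1 h2 h0 m hs, pow_add]
        ring

/-- If `m(s) < 1` then the weights of some generation have a small moment of order `s`. -/
lemma exists_moment_lt_one (hN : Measurable N) (hA : ∀ i, Measurable (A i))
    (h1 : 1 < meanN P N) (h2 : meanN P N < ⊤)
    (h0 : ∀ᵐ ω ∂P, ∀ i, N ω ≤ i → A i ω = 0) {s : ℝ} (hs : 0 < s)
    (hmem : s ∈ momentSet (mu P N A)) (hlt : mFun P N A s < 1) :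
    ∃ n : ℕ, 1 ≤ n ∧ meanN P N ^ n * lnormMoment (mu P N A) s n < 1 := by
  have hprob := isProbabilityMeasure_mu P hN hA h1 h2
  -- If c^n E‖M_n ⋯ M_1‖^s ≥ 1 for all n ≥ 1, where c = E[N], then the logarithms of the moments are
  -- finite, subadditive and at least -n log c. Fekete's lemma shows that the limit in `kappa`
  -- exists and is at least 1/c, against m(s) < 1.
  by_contra! hge
  set μ := mu P N A
  set c := (meanN P N).toReal with hc
  have hcm : ENNReal.ofReal c = meanN P N := ENNReal.ofReal_toReal h2.ne
  have hc1 : 1 < c := by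
    rw [← ENNReal.ofReal_lt_ofReal_iff_of_nonneg zero_le_one, hcm, ENNReal.ofReal_one]; exact h1
  have hc0 : 0 < c := one_pos.trans hc1
  have hW1 : lnormMoment μ s 1 < ⊤ := by
    have h := lintegral_weightMoment_root P hN hA h1 h2 h0 1 hs
    rw [pow_one, pow_one] at h
    unfold weightMoment at h
    rw [lintegral_step_tsum P hN hA h1 h2 h0 (measurable_opNorm_rpow s) (opNorm_rpow_zero hs),
      tsum_eq_single 0] at h
    · have h' := (ENNReal.mul_right_inj (one_pos.trans h1).ne' h2.ne).1 h
      rw [← h']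
      simpa [root] using hmem.2
    · intro k hk
      simp [root, hk, opNorm_zero, Real.zero_rpow hs.ne']
  have hWtop : ∀ n, 1 ≤ n → lnormMoment μ s n < ⊤ := by
    intro n hn
    induction n, hn using Nat.le_induction with
    | base => exact hW1
    | succ n hn ih =>
      exact (lnormMoment_add_le P hN hA h1 h2 h0 n 1 hs).trans_lt (ENNReal.mul_lt_top ih hW1)
  have hW0 : lnormMoment μ s 0 < ⊤ := by
    simp [lnormMoment]
  have hWt : ∀ n, lnormMoment μ s n < ⊤ := fun n => by
    rcases Nat.eq_zero_or_pos n with rfl | hn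
    · exact hW0
    · exact hWtop n hn
  have hlow : ∀ n, 1 ≤ n → 1 ≤ c ^ n * normMoment μ s n := fun n hn => by
    have := ENNReal.toReal_mono (ENNReal.mul_lt_top (ENNReal.pow_lt_top h2) (hWt n)).ne (hge n hn)
    rwa [ENNReal.toReal_one, ENNReal.toReal_mul, ENNReal.toReal_pow, ← normMoment_eq] at this
  have hpos1 : ∀ n, 1 ≤ n → 0 < normMoment μ s n := fun n hn => by
    by_contra hle
    have := hlow n hn
    have h3 : c ^ n * normMoment μ s n ≤ 0 :=
      mul_nonpos_of_nonneg_of_nonpos (pow_pos hc0 n).le (not_lt.1 hle)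
    linarith
  have hsub' : ∀ m n, normMoment μ s (m + n) ≤ normMoment μ s m * normMoment μ s n := fun m n => by
    rw [normMoment_eq, normMoment_eq, normMoment_eq, ← ENNReal.toReal_mul]
    exact ENNReal.toReal_mono (ENNReal.mul_lt_top (hWt m) (hWt n)).ne
      (lnormMoment_add_le P hN hA h1 h2 h0 m n hs)
  have hpos : ∀ n, 0 < normMoment μ s n := fun n => by
    rcases Nat.eq_zero_or_pos n with rfl | hn
    · have := hsub' 0 1
      have h' := hpos1 1 le_rfl
      rw [zero_add] at this
      by_contra hle
      have h3 : normMoment μ s 0 * normMoment μ s 1 ≤ 0 :=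
        mul_nonpos_of_nonpos_of_nonneg (not_lt.1 hle) h'.le
      linarith
    · exact hpos1 n hn
  have hsub : Subadditive fun n => Real.log (normMoment μ s n) := fun m n => by
    rw [← Real.log_mul (hpos m).ne' (hpos n).ne']
    exact Real.log_le_log (hpos _) (hsub' m n)
  have hbd : ∀ n : ℕ, 1 ≤ n → -Real.log c ≤ Real.log (normMoment μ s n) / n := fun n hn => by
    have hn0 : (0 : ℝ) < n := by exact_mod_cast hn
    rw [le_div_iff₀ hn0]
    have := Real.log_nonneg (hlow n hn)
    rw [Real.log_mul (pow_pos hc0 n).ne' (hpos n).ne', Real.log_pow] at this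
    linarith
  have hbdd : BddBelow (Set.range fun n : ℕ => Real.log (normMoment μ s n) / n) := by
    refine ⟨-Real.log c, ?_⟩
    rintro _ ⟨n, rfl⟩
    rcases Nat.eq_zero_or_pos n with rfl | hn
    · simpa using Real.log_nonneg hc1.le
    · exact hbd n hn
  have hlim := hsub.tendsto_lim hbdd
  have hle : -Real.log c ≤ hsub.lim :=
    ge_of_tendsto hlim (eventually_atTop.2 ⟨1, hbd⟩)
  have hkappa : kappa μ s = Real.exp hsub.lim := by
    refine Tendsto.limUnder_eq ?_
    refine ((Real.continuous_exp.tendsto _).comp hlim).congr fun n => ?_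
    rw [Real.rpow_def_of_pos (hpos n), mul_one_div]
    rfl
  rw [mFun, hkappa] at hlt
  have h3 : c⁻¹ ≤ Real.exp hsub.lim := by
    rw [← Real.exp_log (inv_pos.2 hc0), Real.log_inv]
    exact Real.exp_le_exp.2 hle
  have h4 : 1 ≤ c * Real.exp hsub.lim := by
    calc 1 = c * c⁻¹ := (mul_inv_cancel₀ hc0.ne').symm
      _ ≤ _ := by gcongr
  exact absurd hlt (not_lt.2 h4)

-- Since m(α) = 1 and m'(α) < 0, the function m is below 1 just to the right of α, and nearby
-- exponents remain in I_μ because α is interior.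
omit [IsProbabilityMeasure P] in
lemma exists_exponent {N : Ω → ℕ} {A : ℕ → Ω → Mat d} (h : CondAlpha P N A) :
    ∃ s : ℝ, 0 < s ∧ s ∈ momentSet (mu P N A) ∧ mFun P N A s < 1 := by
  obtain ⟨α, hα, -, hint, hm, m', hd, hm'⟩ := h
  have hslope := (hasDerivAt_iff_tendsto_slope.1 hd).eventually_lt_const hm'
  have h1 : ∀ᶠ s in 𝓝[>] α, slope (mFun P N A) α s < 0 :=
    hslope.filter_mono (nhdsWithin_mono _ fun x hx => ne_of_gt hx)
  have h2 : ∀ᶠ s in 𝓝[>] α, s ∈ momentSet (mu P N A) :=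
    nhdsWithin_le_nhds (mem_interior_iff_mem_nhds.1 hint)
  obtain ⟨s, h1, h2, h3⟩ := (h1.and (h2.and self_mem_nhdsWithin)).exists
  have h3 : α < s := h3
  refine ⟨s, hα.trans h3, h2, ?_⟩
  rw [slope_def_field, hm, div_neg_iff] at h1
  rcases h1 with h1 | h1
  · linarith [h1.2]
  · linarith [h1.1]

/-- The weights become small along a sequence of generations. -/
lemma exists_time_small (hN : Measurable N) (hA : ∀ i, Measurable (A i))
    (h1 : 1 < meanN P N) (h2 : meanN P N < ⊤)
    (h0 : ∀ᵐ ω ∂P, ∀ i, N ω ≤ i → A i ω = 0) (h4 : CondAlpha P N A) (m : ℕ) {ε : ℝ} (hε : 0 < ε)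
    {δ : ℝ≥0∞} (hδ : δ ≠ 0) :
    ∃ n, m ≤ n ∧ (step P A ^ n) (root d) {ℓ | ∃ k, ε < opNorm (ℓ k)} ≤ δ := by
  obtain ⟨s, hs, hmem, hlt⟩ := exists_exponent P h4
  obtain ⟨n, hn, hlt⟩ := exists_moment_lt_one P hN hA h1 h2 h0 hs hmem hlt
  set c := meanN P N ^ n * lnormMoment (mu P N A) s n with hc
  set D := ENNReal.ofReal (opNorm (1 : Mat d) ^ s) with hD
  -- Along multiples of n the moment contracts by the factor c < 1, and Markov's inequality then
  -- controls the largest weight. Only multiples of n are reached, so the conclusion gives some time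
  -- beyond m and not all large times.
  have hiter : ∀ j : ℕ, ∫⁻ ℓ, weightMoment s ℓ ∂((step P A ^ (n * j)) (root d)) ≤ c ^ j * D := by
    intro j
    induction j with
    | zero =>
      rw [mul_zero, kernel_pow_zero_apply, lintegral_dirac' _ (measurable_weightMoment s),
        weightMoment_root s hs, pow_zero, one_mul]
    | succ j ih =>
      have hpow : (step P A ^ (n * (j + 1))) (root d)
          = ((step P A ^ (n * j)) (root d)).bind (step P A ^ n) := by
        rw [mul_add, mul_one, add_comm, Kernel.pow_add, Kernel.comp_apply]
      rw [hpow, Measure.lintegral_bind (Kernel.aemeasurable _)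
        (measurable_weightMoment s).aemeasurable]
      calc _ ≤ ∫⁻ ℓ, c * weightMoment s ℓ ∂((step P A ^ (n * j)) (root d)) :=
            lintegral_mono fun ℓ => lintegral_weightMoment_le P hN hA h1 h2 h0 n hs ℓ
        _ ≤ c * (c ^ j * D) := by
            rw [lintegral_const_mul _ (measurable_weightMoment s)]; gcongr
        _ = c ^ (j + 1) * D := by rw [pow_succ]; ring
  have hεs : 0 < ENNReal.ofReal (ε ^ s) := ENNReal.ofReal_pos.2 (Real.rpow_pos_of_pos hε s)
  have hlim : Tendsto (fun j => c ^ j * D / ENNReal.ofReal (ε ^ s)) atTop (𝓝 0) := by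
    have h := ENNReal.Tendsto.mul_const (b := D / ENNReal.ofReal (ε ^ s))
      (ENNReal.tendsto_pow_atTop_nhds_zero_of_lt_one hlt)
      (Or.inr (ENNReal.div_ne_top ENNReal.ofReal_ne_top hεs.ne'))
    rw [zero_mul] at h
    simpa only [mul_div_assoc] using h
  obtain ⟨j, hj, hmj⟩ :=
    ((hlim.eventually_lt_const (pos_iff_ne_zero.2 hδ)).and (eventually_ge_atTop m)).exists
  refine ⟨n * j, hmj.trans (Nat.le_mul_of_pos_left j hn), ?_⟩
  calc (step P A ^ (n * j)) (root d) {ℓ | ∃ k, ε < opNorm (ℓ k)}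
      ≤ (step P A ^ (n * j)) (root d) {ℓ | ENNReal.ofReal (ε ^ s) ≤ weightMoment s ℓ} := by
        refine measure_mono fun ℓ => ?_
        rintro ⟨k, hk⟩
        exact (ENNReal.ofReal_le_ofReal (Real.rpow_le_rpow hε.le hk.le hs.le)).trans
          (ENNReal.le_tsum k)
    _ ≤ (∫⁻ ℓ, weightMoment s ℓ ∂((step P A ^ (n * j)) (root d))) / ENNReal.ofReal (ε ^ s) :=
        meas_ge_le_lintegral_div (measurable_weightMoment s).aemeasurable hεs.ne'
          ENNReal.ofReal_ne_top
    _ ≤ c ^ j * D / ENNReal.ofReal (ε ^ s) := by gcongr; exact hiter j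
    _ ≤ δ := hj.le

end Moments

end SmoothingTransform
end

noncomputable section

namespace SmoothingTransform

open ProbabilityTheory

/-! ### Directions in which the characteristic function has modulus one -/

section Lattice

variable {d : ℕ}

lemma ae_eq_one_of_one_le_integral {X : Type*} [MeasurableSpace X] {m : Measure X}
    [IsProbabilityMeasure m] {F : X → ℝ} (hF : Integrable F m) (h1 : ∀ x, F x ≤ 1)
    (h : 1 ≤ ∫ x, F x ∂m) : ∀ᵐ x ∂m, F x = 1 := by
  have h0 : ∫ x, (1 - F x) ∂m = 0 := by
    refine le_antisymm ?_ (integral_nonneg fun x => sub_nonneg.2 (h1 x))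
    rw [integral_sub (integrable_const _) hF]
    simpa using h
  rw [integral_eq_zero_iff_of_nonneg (fun x => sub_nonneg.2 (h1 x))
    ((integrable_const _).sub hF)] at h0
  filter_upwards [h0] with x hx
  have : 1 - F x = 0 := hx
  linarith

variable (η : Measure (Fin d → ℝ)) [IsProbabilityMeasure η]

/-- Equality case of the triangle inequality: after multiplication by the conjugate of c, the
integrand has modulus one and integral one, so it equals one almost surely. -/
lemma ae_exp_eq_cf {t : Fin d → ℝ} (ht : ‖cf η t‖ = 1) :
    ∀ᵐ x ∂η, Complex.exp ((t ⬝ᵥ x : ℝ) * Complex.I) = cf η t := by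
  set c := cf η t with hc
  have hcc : (starRingEnd ℂ) c * c = 1 := by
    rw [mul_comm, Complex.mul_conj, Complex.normSq_eq_norm_sq, ht]; simp
  have hi : Integrable (fun x => (starRingEnd ℂ) c * Complex.exp ((t ⬝ᵥ x : ℝ) * Complex.I)) η :=
    (integrable_cf η t).const_mul _
  have hn : ∀ x : Fin d → ℝ,
      ‖(starRingEnd ℂ) c * Complex.exp ((t ⬝ᵥ x : ℝ) * Complex.I)‖ = 1 := fun x => by
    rw [norm_mul, Complex.norm_exp_ofReal_mul_I, RCLike.norm_conj, ht, mul_one]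
  have hint : ∫ x, ((starRingEnd ℂ) c * Complex.exp ((t ⬝ᵥ x : ℝ) * Complex.I)).re ∂η = 1 := by
    have := integral_re hi
    simp only [RCLike.re_eq_complex_re] at this
    rw [this, integral_const_mul]
    change ((starRingEnd ℂ) c * c).re = 1
    rw [hcc, Complex.one_re]
  have hae := ae_eq_one_of_one_le_integral hi.re
    (fun x => (Complex.re_le_norm _).trans (hn x).le) hint.ge
  filter_upwards [hae] with x hx
  have hx : ((starRingEnd ℂ) c * Complex.exp ((t ⬝ᵥ x : ℝ) * Complex.I)).re = 1 := hx
  have h1 : (starRingEnd ℂ) c * Complex.exp ((t ⬝ᵥ x : ℝ) * Complex.I) = 1 := by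
    have him : ((starRingEnd ℂ) c * Complex.exp ((t ⬝ᵥ x : ℝ) * Complex.I)).im = 0 := by
      have := Complex.sq_norm ((starRingEnd ℂ) c * Complex.exp ((t ⬝ᵥ x : ℝ) * Complex.I))
      rw [hn x, Complex.normSq_apply, hx] at this
      nlinarith
    exact Complex.ext hx him
  calc Complex.exp ((t ⬝ᵥ x : ℝ) * Complex.I)
      = ((starRingEnd ℂ) c * c) * Complex.exp ((t ⬝ᵥ x : ℝ) * Complex.I) := by rw [hcc, one_mul]
    _ = c * ((starRingEnd ℂ) c * Complex.exp ((t ⬝ᵥ x : ℝ) * Complex.I)) := by ring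
    _ = c := by rw [h1, mul_one]

lemma ae_dotProduct_sub_mem {t : Fin d → ℝ} (ht : ‖cf η t‖ = 1) :
    ∀ᵐ p ∂(η.prod η), ∃ m : ℤ, t ⬝ᵥ p.1 - t ⬝ᵥ p.2 = m * (2 * Real.pi) := by
  have h := ae_exp_eq_cf η ht
  filter_upwards [Measure.quasiMeasurePreserving_fst.ae h, Measure.quasiMeasurePreserving_snd.ae h]
    with p h1 h2
  rw [← h2, Complex.exp_eq_exp_iff_exists_int] at h1
  obtain ⟨m, hm⟩ := h1
  refine ⟨m, ?_⟩
  have h3 := congrArg Complex.im hm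
  simp at h3
  linarith

/-- The directions in which the measure is degenerate. -/
def degenerate : Submodule ℝ (Fin d → ℝ) where
  carrier := {t | ∀ᵐ p ∂(η.prod η), t ⬝ᵥ p.1 = t ⬝ᵥ p.2}
  add_mem' := by
    intro s t hs ht
    change ∀ᵐ p ∂(η.prod η), (s + t) ⬝ᵥ p.1 = (s + t) ⬝ᵥ p.2
    filter_upwards [hs, ht] with p h1 h2
    rw [add_dotProduct, add_dotProduct, h1, h2]
  zero_mem' := ae_of_all _ fun p => by simp
  smul_mem' := by
    intro c t ht
    change ∀ᵐ p ∂(η.prod η), (c • t) ⬝ᵥ p.1 = (c • t) ⬝ᵥ p.2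
    filter_upwards [ht] with p h1
    rw [smul_dotProduct, smul_dotProduct, h1]

variable {η}

omit [IsProbabilityMeasure η] in
lemma mem_degenerate {t : Fin d → ℝ} :
    t ∈ degenerate η ↔ ∀ᵐ p ∂(η.prod η), t ⬝ᵥ p.1 = t ⬝ᵥ p.2 := Iff.rfl

lemma norm_cf_eq_one_of_mem_degenerate {t : Fin d → ℝ} (ht : t ∈ degenerate η) :
    ‖cf η t‖ = 1 := by
  obtain ⟨y, hy⟩ := (Measure.ae_ae_of_ae_prod (mem_degenerate.1 ht)).exists
  have : cf η t = Complex.exp ((t ⬝ᵥ y : ℝ) * Complex.I) := by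
    rw [cf, integral_congr_ae (g := fun _ => Complex.exp ((t ⬝ᵥ y : ℝ) * Complex.I))]
    · simp
    · filter_upwards [hy] with x hx
      rw [hx]
  rw [this, Complex.norm_exp_ofReal_mul_I]

/-- For almost every pair (x, y) the numbers s n ⬝ (x - y) are multiples of 2π, and they tend to 0,
so they vanish from some index on. -/
lemma ae_eventually_eq {s : ℕ → Fin d → ℝ} (hs : ∀ n, ‖cf η (s n)‖ = 1)
    (hs0 : Tendsto s atTop (𝓝 0)) :
    ∀ᵐ p ∂(η.prod η), ∀ᶠ n in atTop, s n ⬝ᵥ p.1 = s n ⬝ᵥ p.2 := by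
  filter_upwards [ae_all_iff.2 fun n => ae_dotProduct_sub_mem η (hs n)] with p hp
  have hc : Continuous fun t : Fin d → ℝ => t ⬝ᵥ p.1 - t ⬝ᵥ p.2 := by
    unfold dotProduct; fun_prop
  have hlim : Tendsto (fun n => |s n ⬝ᵥ p.1 - s n ⬝ᵥ p.2|) atTop (𝓝 0) := by
    have := (hc.abs.tendsto 0).comp hs0
    simpa [Function.comp_def] using this
  filter_upwards [hlim.eventually_lt_const (show (0 : ℝ) < 2 * Real.pi by positivity)] with n hn
  obtain ⟨m, hm⟩ := hp n
  rw [hm, abs_mul, abs_of_pos (show (0 : ℝ) < 2 * Real.pi by positivity)] at hn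
  have h1 : |(m : ℝ)| < 1 := by
    by_contra h
    have : 1 * (2 * Real.pi) ≤ |(m : ℝ)| * (2 * Real.pi) :=
      mul_le_mul_of_nonneg_right (not_lt.1 h) (by positivity)
    linarith
  have h2 : m = 0 := Int.abs_lt_one_iff.1 (by exact_mod_cast h1)
  rw [h2] at hm
  simp at hm
  linarith

/-- The set where |`cf η`| = 1 need not be a subspace. Testing it along the multiples t/(n+1)
transfers its invariance properties to `degenerate η`. -/
lemma mem_degenerate_of_forall_smul {t : Fin d → ℝ}
    (ht : ∀ n : ℕ, ‖cf η ((1 / ((n : ℝ) + 1)) • t)‖ = 1) : t ∈ degenerate η := by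
  have h0 : Tendsto (fun n : ℕ => (1 / ((n : ℝ) + 1)) • t) atTop (𝓝 0) := by
    have := (tendsto_one_div_add_atTop_nhds_zero_nat (𝕜 := ℝ)).smul_const t
    simpa using this
  refine mem_degenerate.2 ?_
  filter_upwards [ae_eventually_eq ht h0] with p hp
  obtain ⟨n, hn⟩ := hp.exists
  rw [smul_dotProduct, smul_dotProduct] at hn
  have : (1 / ((n : ℝ) + 1)) ≠ 0 := by positivity
  exact smul_right_injective ℝ this hn

lemma transpose_mulVec_mem_degenerate {a : Mat d}
    (ha : ∀ t, ‖cf η t‖ = 1 → ‖cf η (aᵀ *ᵥ t)‖ = 1) {t : Fin d → ℝ} (ht : t ∈ degenerate η) :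
    aᵀ *ᵥ t ∈ degenerate η := by
  refine mem_degenerate_of_forall_smul fun n => ?_
  rw [← Matrix.mulVec_smul]
  exact ha _ (norm_cf_eq_one_of_mem_degenerate (Submodule.smul_mem _ _ ht))

/-- Normalise a sequence tending to 0 on which the modulus is one. A limit point of the unit vectors
inherits the equality u ⬝ x = u ⬝ y for almost every pair. -/
lemma degenerate_ne_bot (h : ∀ δ : ℝ, 0 < δ → ∃ s, s ≠ 0 ∧ ‖s‖ ≤ δ ∧ ‖cf η s‖ = 1) :
    degenerate η ≠ ⊥ := by
  choose s hs0 hsle hs1 using fun n : ℕ => h (1 / ((n : ℝ) + 1)) (by positivity)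
  have hlim : Tendsto s atTop (𝓝 0) :=
    squeeze_zero_norm hsle tendsto_one_div_add_atTop_nhds_zero_nat
  have hsph : ∀ n, ‖s n‖⁻¹ • s n ∈ Metric.sphere (0 : Fin d → ℝ) 1 := fun n => by
    rw [mem_sphere_zero_iff_norm, norm_smul, norm_inv, norm_norm,
      inv_mul_cancel₀ (norm_ne_zero_iff.2 (hs0 n))]
  obtain ⟨u, hu, φ, hφ, hφu⟩ := (isCompact_sphere (0 : Fin d → ℝ) 1).tendsto_subseq hsph
  refine (Submodule.ne_bot_iff _).2 ⟨u, mem_degenerate.2 ?_, ?_⟩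
  · filter_upwards [ae_eventually_eq hs1 hlim] with p hp
    have hc : ∀ x : Fin d → ℝ, Continuous fun t : Fin d → ℝ => t ⬝ᵥ x := fun x => by
      unfold dotProduct; fun_prop
    refine tendsto_nhds_unique_of_eventuallyEq (((hc p.1).tendsto u).comp hφu)
      (((hc p.2).tendsto u).comp hφu) ?_
    filter_upwards [hφ.tendsto_atTop.eventually hp] with n hn
    simp only [Function.comp_apply, smul_dotProduct, hn]
  · rintro rfl
    simp at hu

omit [IsProbabilityMeasure η] in
lemma ae_forall_mem_degenerate :
    ∀ᵐ p ∂(η.prod η), ∀ t ∈ degenerate η, t ⬝ᵥ p.1 = t ⬝ᵥ p.2 := by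
  set b := Module.finBasis ℝ (degenerate η)
  filter_upwards [ae_all_iff.2 fun i => mem_degenerate.1 (b i).2] with p hp t ht
  have hrep := congrArg Subtype.val (b.sum_repr ⟨t, ht⟩)
  change _ = t at hrep
  rw [← hrep]
  simp only [Submodule.coe_sum, Submodule.coe_smul, sum_dotProduct, smul_dotProduct, hp]

end Lattice

/-! ### Positivity: a Perron–Frobenius argument -/

section Positivity

variable {d : ℕ}

lemma mulVec_nonneg {a : Mat d} (ha : ∀ i j, 0 ≤ a i j) {y : Fin d → ℝ} (hy : ∀ i, 0 ≤ y i)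
    (i : Fin d) : 0 ≤ (a *ᵥ y) i :=
  Finset.sum_nonneg (s := Finset.univ) fun k _ => mul_nonneg (ha i k) (hy k)

/-- The total negative mass of a vector. -/
def negMass (y : Fin d → ℝ) : ℝ := ∑ i, max (-y i) 0

/-- Doeblin's minorisation: removing δ from every entry leaves a nonnegative kernel with row sums 1
- dδ, and the removed part adds δ Σ y_i ≥ 0 to each coordinate, which only helps. -/
lemma negMass_vecMul_le {p : Mat d} {δ : ℝ} (hδ : 0 ≤ δ) (hp : ∀ i j, δ ≤ p i j)
    (hrow : ∀ i, ∑ j, p i j = 1) {y : Fin d → ℝ} (hy : 0 ≤ ∑ i, y i) :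
    negMass (y ᵥ* p) ≤ (1 - d * δ) * negMass y := by
  have hj : ∀ j, max (-(y ᵥ* p) j) 0 ≤ ∑ i, max (-y i) 0 * (p i j - δ) := by
    intro j
    refine max_le ?_ (Finset.sum_nonneg fun i _ =>
      mul_nonneg (le_max_right _ _) (sub_nonneg.2 (hp i j)))
    have : -(y ᵥ* p) j = ∑ i, -y i * (p i j - δ) - δ * ∑ i, y i := by
      simp only [Matrix.vecMul, dotProduct, mul_sub, Finset.sum_sub_distrib, neg_mul,
        Finset.sum_neg_distrib, Finset.mul_sum]
      simp only [mul_comm δ]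
      ring
    rw [this]
    have h2 : ∑ i, -y i * (p i j - δ) ≤ ∑ i, max (-y i) 0 * (p i j - δ) :=
      Finset.sum_le_sum fun i _ =>
        mul_le_mul_of_nonneg_right (le_max_left _ _) (sub_nonneg.2 (hp i j))
    have h3 : 0 ≤ δ * ∑ i, y i := mul_nonneg hδ hy
    linarith
  calc negMass (y ᵥ* p) ≤ ∑ j, ∑ i, max (-y i) 0 * (p i j - δ) :=
        Finset.sum_le_sum fun j _ => hj j
    _ = ∑ i, max (-y i) 0 * (1 - d * δ) := by
        rw [Finset.sum_comm]
        refine Finset.sum_congr rfl fun i _ => ?_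
        rw [← Finset.mul_sum, Finset.sum_sub_distrib, hrow]
        simp
    _ = (1 - d * δ) * negMass y := by
        rw [negMass, Finset.mul_sum]
        exact Finset.sum_congr rfl fun i _ => mul_comm _ _

lemma sum_vecMul {p : Mat d} (hrow : ∀ i, ∑ j, p i j = 1) (y : Fin d → ℝ) :
    ∑ j, (y ᵥ* p) j = ∑ i, y i := by
  simp only [Matrix.vecMul, dotProduct]
  rw [Finset.sum_comm]
  exact Finset.sum_congr rfl fun i _ => by rw [← Finset.mul_sum, hrow, mul_one]

/-- The total mass is conserved while the negative mass decays geometrically. Once the latter is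
below δ times the total, one more step makes every coordinate positive. -/
lemma exists_pow_vecMul_pos {p : Mat d} (hp : StrictlyPos p)
    (hrow : ∀ i, ∑ j, p i j = 1) {y : Fin d → ℝ} (hy : 0 < ∑ i, y i) :
    ∃ n : ℕ, ∀ j, 0 < (y ᵥ* p ^ n) j := by
  rcases isEmpty_or_nonempty (Fin d) with he | hne
  · exact ⟨0, fun j => (he.false j).elim⟩
  obtain ⟨⟨i₀, j₀⟩, hmin⟩ := Finite.exists_min fun ij : Fin d × Fin d => p ij.1 ij.2
  set δ := p i₀ j₀ with hδd
  have hδ : 0 < δ := hp i₀ j₀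
  have hpd : ∀ i j, δ ≤ p i j := fun i j => hmin (i, j)
  have hd : (0 : ℝ) < d := by exact_mod_cast Fin.pos i₀
  have hsum : ∀ n : ℕ, ∑ j, (y ᵥ* p ^ n) j = ∑ i, y i := by
    intro n
    induction n with
    | zero => simp
    | succ n ih => rw [pow_succ, ← Matrix.vecMul_vecMul, sum_vecMul hrow, ih]
  have hq0 : 0 ≤ 1 - d * δ := by
    have : ∑ _j : Fin d, δ ≤ ∑ j, p i₀ j := Finset.sum_le_sum fun j _ => hpd i₀ j
    rw [hrow] at this
    simp at this
    linarith
  have hq1 : 1 - d * δ < 1 := by have := mul_pos hd hδ; linarith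
  have hneg : ∀ n : ℕ, negMass (y ᵥ* p ^ n) ≤ (1 - d * δ) ^ n * negMass y := by
    intro n
    induction n with
    | zero => simp
    | succ n ih =>
      rw [pow_succ, ← Matrix.vecMul_vecMul, pow_succ' (1 - d * δ), mul_assoc]
      exact (negMass_vecMul_le hδ.le hpd hrow (by rw [hsum]; exact hy.le)).trans
        (mul_le_mul_of_nonneg_left ih hq0)
  have hlim : Tendsto (fun n : ℕ => (1 - d * δ) ^ n * negMass y) atTop (𝓝 0) := by
    simpa using (tendsto_pow_atTop_nhds_zero_of_lt_one hq0 hq1).mul_const (negMass y)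
  obtain ⟨n, hn⟩ := (hlim.eventually_lt_const (mul_pos hδ hy)).exists
  refine ⟨n + 1, fun j => ?_⟩
  set z := y ᵥ* p ^ n with hz
  have hzn : negMass z < δ * ∑ i, y i := (hneg n).trans_lt hn
  have hp1 : ∀ i, p i j ≤ 1 := fun i => by
    rw [← hrow i]
    exact Finset.single_le_sum (f := fun j => p i j) (fun j _ => (hp i j).le) (Finset.mem_univ j)
  rw [pow_succ, ← Matrix.vecMul_vecMul]
  have hterm : ∀ i, δ * z i - max (-z i) 0 ≤ z i * p i j := fun i => by
    rcases le_total 0 (z i) with h | h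
    · rw [max_eq_right (by linarith)]
      have := mul_le_mul_of_nonneg_left (hpd i j) h
      linarith
    · rw [max_eq_left (by linarith)]
      have h1 := mul_le_mul_of_nonpos_left (hp1 i) h
      have h2 : δ * z i ≤ 0 := mul_nonpos_of_nonneg_of_nonpos hδ.le h
      linarith
  have h1 : δ * (∑ i, z i) - negMass z ≤ (z ᵥ* p) j := by
    rw [Finset.mul_sum, negMass, ← Finset.sum_sub_distrib]
    exact Finset.sum_le_sum fun i _ => hterm i
  rw [hz, hsum n, ← hz] at h1
  linarith

/-- If `a` is strictly positive with positive eigenvector `x` then `(aᵀ)^n t` is eventually strictly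
positive as soon as `x ⬝ t > 0`. -/
lemma exists_pow_transpose_mulVec_pos {a : Mat d} (ha : StrictlyPos a) {x t : Fin d → ℝ} {r : ℝ}
    (hx : ∀ i, 0 < x i) (hax : a *ᵥ x = r • x) (ht : 0 < x ⬝ᵥ t) :
    ∃ n : ℕ, ∀ j, 0 < ((a ^ n)ᵀ *ᵥ t) j := by
  rcases isEmpty_or_nonempty (Fin d) with he | hne
  · exact ⟨0, fun j => (he.false j).elim⟩
  obtain ⟨i₀⟩ := hne
  have hr : 0 < r := by
    have h1 : 0 < (a *ᵥ x) i₀ := by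
      simp only [Matrix.mulVec, dotProduct]
      exact Finset.sum_pos (fun j _ => mul_pos (ha i₀ j) (hx j)) ⟨i₀, Finset.mem_univ _⟩
    rw [hax] at h1
    exact pos_of_mul_pos_left h1 (hx i₀).le
  -- Doob transform: conjugating by the positive eigenvector x and dividing by r turns a into a
  -- stochastic matrix.
  set p : Mat d := fun i j => a i j * x j / (r * x i) with hpdef
  have hp : StrictlyPos p := fun i j =>
    div_pos (mul_pos (ha i j) (hx j)) (mul_pos hr (hx i))
  have hrow : ∀ i, ∑ j, p i j = 1 := fun i => by
    simp only [hpdef]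
    rw [← Finset.sum_div, div_eq_one_iff_eq (mul_pos hr (hx i)).ne']
    exact congrFun hax i
  have hconj : ∀ s : Fin d → ℝ, ∀ n : ℕ, ∀ j,
      ((fun i => s i * x i) ᵥ* p ^ n) j = ((s ᵥ* a ^ n) j) * x j / r ^ n := by
    intro s n
    induction n with
    | zero => intro j; simp
    | succ n ih =>
      intro j
      rw [pow_succ, ← Matrix.vecMul_vecMul, pow_succ, ← Matrix.vecMul_vecMul]
      rw [Matrix.vecMul, Matrix.vecMul, dotProduct, dotProduct, Finset.sum_mul, Finset.sum_div]
      refine Finset.sum_congr rfl fun i _ => ?_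
      have := (hx i).ne'
      rw [ih]
      change (s ᵥ* a ^ n) i * x i / r ^ n * (a i j * x j / (r * x i)) = _
      field_simp
      ring
  obtain ⟨n, hn⟩ := exists_pow_vecMul_pos hp hrow (y := fun i => t i * x i) (by
    simpa [dotProduct, mul_comm] using ht)
  refine ⟨n, fun j => ?_⟩
  have := hn j
  rw [hconj] at this
  rw [Matrix.mulVec_transpose]
  have h2 := (div_pos_iff_of_pos_right (pow_pos hr n)).1 this
  exact pos_of_mul_pos_left h2 (hx j).le

/-- As Λ spans, a nonzero t in V is not orthogonal to all of it. By density some Perron eigenvector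
x of a positive a ∈ Γ has x ⬝ t ≠ 0, and large powers of aᵀ push t or -t into the open positive cone
without leaving V. -/
lemma exists_pos_mem {μ : Measure (Mat d)} {V : Submodule ℝ (Fin d → ℝ)} (hV : V ≠ ⊥)
    (hinv : ∀ a ∈ Gam μ, ∀ t ∈ V, aᵀ *ᵥ t ∈ V)
    (hΛ : ∃ v : Fin d → (Fin d → ℝ), (∀ i, v i ∈ Lam μ) ∧ LinearIndependent ℝ v) :
    ∃ w ∈ V, ∀ i, 0 < w i := by
  obtain ⟨t, htV, ht0⟩ := V.exists_mem_ne_zero_of_ne_bot hV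
  obtain ⟨v, hv, hli⟩ := hΛ
  have hspan : Submodule.span ℝ (Set.range v) = ⊤ :=
    hli.span_eq_top_of_card_eq_finrank' (by simp)
  obtain ⟨i, hi⟩ : ∃ i, v i ⬝ᵥ t ≠ 0 := by
    by_contra! h
    have hall : ∀ u : Fin d → ℝ, u ⬝ᵥ t = 0 := fun u => by
      have hu : u ∈ Submodule.span ℝ (Set.range v) := hspan ▸ Submodule.mem_top
      induction hu using Submodule.span_induction with
      | mem x hx => obtain ⟨i, rfl⟩ := hx; exact h i
      | zero => simp
      | add x y _ _ hx hy => rw [add_dotProduct, hx, hy, add_zero]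
      | smul c x _ hx => rw [smul_dotProduct, hx, smul_zero]
    exact ht0 (dotProduct_self_eq_zero.1 (hall t))
  have hopen : IsOpen {x : Fin d → ℝ | x ⬝ᵥ t ≠ 0} := by
    have : Continuous fun x : Fin d → ℝ => x ⬝ᵥ t := by unfold dotProduct; fun_prop
    exact isOpen_ne_fun this continuous_const
  obtain ⟨x, hxt, a, haG, hapos, hxpos, -, hax⟩ := mem_closure_iff.1 (hv i) _ hopen hi
  have key : ∀ s ∈ V, 0 < x ⬝ᵥ s → ∃ w ∈ V, ∀ i, 0 < w i := fun s hs hpos => by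
    obtain ⟨n, hn⟩ := exists_pow_transpose_mulVec_pos hapos hxpos hax hpos
    exact ⟨_, hinv _ (pow_mem haG n) s hs, hn⟩
  rcases lt_or_gt_of_ne (show x ⬝ᵥ t ≠ 0 from hxt) with h | h
  · exact key (-t) (neg_mem htV) (by rw [dotProduct_neg]; linarith)
  · exact key t htV h

/-- The vector y = l z is strictly positive, and its iterates l^n y stay bounded because w is
strictly positive. Any complex eigenvector is dominated entrywise by a multiple of y, so its
eigenvalue has bounded powers. -/
lemma specRad_le_one_of_bounded {l : Mat d} (hl : StrictlyPos l) {z w : Fin d → ℝ}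
    (hz : ∀ i, 0 ≤ z i) (hz0 : z ≠ 0) (hw : ∀ i, 0 < w i)
    (hb : ∀ n : ℕ, w ⬝ᵥ (l ^ n *ᵥ z) ≤ w ⬝ᵥ z) : specRad l ≤ 1 := by
  have hpownn : ∀ n : ℕ, ∀ i j, 0 ≤ (l ^ n) i j := by
    intro n
    induction n with
    | zero => intro i j; rw [pow_zero, Matrix.one_apply]; split_ifs <;> norm_num
    | succ n ih =>
      intro i j
      rw [pow_succ, Matrix.mul_apply]
      exact Finset.sum_nonneg fun k _ => mul_nonneg (ih i k) (hl k j).le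
  have hnn : ∀ n : ℕ, ∀ y : Fin d → ℝ, (∀ i, 0 ≤ y i) → ∀ i, 0 ≤ (l ^ n *ᵥ y) i :=
    fun n y hy => mulVec_nonneg (hpownn n) hy
  obtain ⟨i₁, hi₁⟩ : ∃ i, 0 < z i := by
    by_contra! h
    exact hz0 (funext fun i => le_antisymm (h i) (hz i))
  set y := l *ᵥ z with hy
  have hypos : ∀ i, 0 < y i := fun i =>
    Finset.sum_pos' (fun k _ => mul_nonneg (hl i k).le (hz k))
      ⟨i₁, Finset.mem_univ _, mul_pos (hl i i₁) hi₁⟩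
  have hybd : ∀ n : ℕ, ∀ i, (l ^ n *ᵥ y) i ≤ w ⬝ᵥ z / w i := fun n i => by
    rw [hy, Matrix.mulVec_mulVec, ← pow_succ, le_div_iff₀ (hw i), mul_comm]
    refine le_trans ?_ (hb (n + 1))
    exact Finset.single_le_sum (f := fun i => w i * (l ^ (n + 1) *ᵥ z) i)
      (fun i _ => mul_nonneg (hw i).le (hnn _ z hz i)) (Finset.mem_univ i)
  have hspec : ∀ k ∈ spectrum ℂ (l.map (algebraMap ℝ ℂ)), ‖k‖ ≤ 1 := by
    intro k hk
    rw [← Matrix.spectrum_toLin', ← Module.End.hasEigenvalue_iff_mem_spectrum] at hk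
    obtain ⟨u, hu⟩ := hk.exists_hasEigenvector
    have hpow : ∀ n : ℕ, (l ^ n).map (algebraMap ℝ ℂ) *ᵥ u = k ^ n • u := by
      intro n
      induction n with
      | zero => simp
      | succ n ih =>
        have h1 : l.map (algebraMap ℝ ℂ) *ᵥ u = k • u := by
          simpa using hu.apply_eq_smul
        rw [pow_succ, Matrix.map_mul, ← Matrix.mulVec_mulVec, h1, Matrix.mulVec_smul, ih,
          smul_smul, pow_succ, mul_comm]
    obtain ⟨i, hi⟩ : ∃ i, u i ≠ 0 := by
      by_contra! h
      exact hu.2 (funext h)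
    obtain ⟨K, hK⟩ : ∃ K : ℝ, ∀ j, ‖u j‖ ≤ K * y j := by
      refine ⟨∑ j, ‖u j‖ / y j, fun j => ?_⟩
      rw [← div_le_iff₀ (hypos j)]
      exact Finset.single_le_sum (f := fun j => ‖u j‖ / y j)
        (fun j _ => div_nonneg (norm_nonneg _) (hypos j).le) (Finset.mem_univ j)
    have hK0 : 0 ≤ K := by
      have := (norm_nonneg _).trans (hK i)
      exact nonneg_of_mul_nonneg_left this (hypos i)
    by_contra hk1
    obtain ⟨n, hn⟩ := pow_unbounded_of_one_lt (K * (w ⬝ᵥ z / w i) / ‖u i‖) (not_le.1 hk1)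
    rw [div_lt_iff₀ (norm_pos_iff.2 hi), ← norm_pow, ← norm_mul] at hn
    have h1 : k ^ n * u i = ∑ j, ((l ^ n) i j : ℂ) * u j := by
      have := congrFun (hpow n) i
      rw [Pi.smul_apply, smul_eq_mul] at this
      exact this.symm
    have h2 : ‖k ^ n * u i‖ ≤ K * (l ^ n *ᵥ y) i := by
      rw [h1, Matrix.mulVec, dotProduct, Finset.mul_sum]
      refine (norm_sum_le _ _).trans (Finset.sum_le_sum fun j _ => ?_)
      rw [norm_mul, Complex.norm_real, Real.norm_of_nonneg (hpownn n i j)]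
      calc (l ^ n) i j * ‖u j‖ ≤ (l ^ n) i j * (K * y j) :=
            mul_le_mul_of_nonneg_left (hK j) (hpownn n i j)
        _ = K * ((l ^ n) i j * y j) := by ring
    have h3 := mul_le_mul_of_nonneg_left (hybd n i) hK0
    linarith
  have : spectralRadius ℂ (l.map (algebraMap ℝ ℂ)) ≤ 1 := by
    unfold spectralRadius
    refine iSup₂_le fun k hk => ?_
    exact_mod_cast hspec k hk
  exact ENNReal.toReal_le_of_le_ofReal zero_le_one (by simpa using this)

end Positivity

/-! ### Cover sums -/

section Cover

variable {d : ℕ}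

lemma pathProd_nil (a : List ℕ → ℕ → Mat d) : pathProd a [] = 1 := rfl

lemma pathProd_cons (a : List ℕ → ℕ → Mat d) (i : ℕ) (u : List ℕ) :
    pathProd a (i :: u) = a [] i * pathProd (fun v => a (i :: v)) u := by
  simp [pathProd, List.ofFn_succ]

/-- Continue the longer word by zeros: both words are prefixes in U of one infinite sequence, so
they have the same length. -/
lemma IsCoverSet.eq_of_prefix {U : Set (List ℕ)} (hU : IsCoverSet U) {u u' : List ℕ} (hu : u ∈ U)
    (hu' : u' ∈ U) (h : u <+: u') : u = u' := by
  obtain ⟨v, rfl⟩ := h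
  obtain ⟨k, -, hk⟩ := hU fun k => (u ++ v).getD k 0
  have hmap : ∀ w : List ℕ, w <+: u ++ v →
      (List.range w.length).map (fun k => (u ++ v).getD k 0) = w := by
    rintro w ⟨w', hw⟩
    refine List.ext_getElem (by simp) fun n h1 h2 => ?_
    simp only [List.getElem_map, List.getElem_range, ← hw]
    simp [List.getElem?_append_left h2, h2]
  have h1 := hk u.length (by beta_reduce; rw [hmap u ⟨v, rfl⟩]; exact hu)
  have h2 := hk (u ++ v).length (by
    beta_reduce; rw [hmap (u ++ v) ⟨[], List.append_nil _⟩]; exact hu')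
  have h3 : v.length = 0 := by
    have := h1.trans h2.symm
    simp at this
    simp [this]
  rw [List.length_eq_zero_iff.1 h3, List.append_nil]

variable {S : Set (ℕ → Mat d)} {V : Submodule ℝ (Fin d → ℝ)} {z : Fin d → ℝ}

lemma pathProd_transpose_mulVec_mem (hSV : ∀ a ∈ S, ∀ w ∈ V, ∀ i, (a i)ᵀ *ᵥ w ∈ V)
    (u : List ℕ) : ∀ a : List ℕ → ℕ → Mat d, (∀ v, a v ∈ S) → ∀ w ∈ V,
      (pathProd a u)ᵀ *ᵥ w ∈ V := by
  induction u with
  | nil => intro a _ w hw; simpa [pathProd_nil] using hw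
  | cons i u ih =>
    intro a ha w hw
    rw [pathProd_cons, Matrix.transpose_mul, ← Matrix.mulVec_mulVec]
    exact ih _ (fun v => ha _) _ (hSV _ (ha []) w hw i)

/-- Induction on the length, stripping the first letter i: the words below i form an antichain of
smaller level, tested against (a_i)ᵀ w, which is again nonnegative and in V. Summing over i uses the
one-generation inequality at w. Working with prefix antichains rather than cover sets makes finite
subfamilies admissible. -/
lemma sum_pathProd_le (hz : ∀ i, 0 ≤ z i) (hSV : ∀ a ∈ S, ∀ w ∈ V, ∀ i, (a i)ᵀ *ᵥ w ∈ V)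
    (hSn : ∀ a ∈ S, ∀ i j k, 0 ≤ a i j k)
    (hSs : ∀ a ∈ S, ∀ w ∈ V, (∀ i, 0 ≤ w i) → ∀ n, ∑ i ∈ Finset.range n, w ⬝ᵥ (a i *ᵥ z) ≤ w ⬝ᵥ z)
    (L : ℕ) : ∀ (F : Finset (List ℕ)) (a : List ℕ → ℕ → Mat d) (w : Fin d → ℝ),
      (∀ u ∈ F, u.length ≤ L) → (∀ u ∈ F, ∀ u' ∈ F, u <+: u' → u = u') → (∀ v, a v ∈ S) →
      w ∈ V → (∀ i, 0 ≤ w i) → ∑ u ∈ F, w ⬝ᵥ (pathProd a u *ᵥ z) ≤ w ⬝ᵥ z := by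
  induction L with
  | zero =>
    intro F a w hL _ _ _ hw
    have hF : F ⊆ {[]} := fun u hu => by
      simpa using hL u hu
    have hwz : 0 ≤ w ⬝ᵥ z := Finset.sum_nonneg fun i _ => mul_nonneg (hw i) (hz i)
    rcases Finset.subset_singleton_iff.1 hF with rfl | rfl
    · simpa using hwz
    · simp [pathProd_nil]
  | succ L ih =>
    intro F a w hL hanti ha hwV hw
    have hwz : 0 ≤ w ⬝ᵥ z := Finset.sum_nonneg fun i _ => mul_nonneg (hw i) (hz i)
    by_cases hnil : [] ∈ F
    · have hF : F = {[]} := by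
        refine Finset.eq_singleton_iff_unique_mem.2 ⟨hnil, fun u hu => ?_⟩
        exact (hanti [] hnil u hu (List.nil_prefix)).symm
      simp [hF, pathProd_nil]
    have hcons : ∀ u ∈ F, u = u.headI :: u.tail := fun u hu => by
      cases u with
      | nil => exact (hnil hu).elim
      | cons i u => rfl
    set H := F.image List.headI with hH
    rw [← Finset.sum_fiberwise_of_maps_to (g := List.headI) (t := H)
      (fun u hu => Finset.mem_image_of_mem _ hu)]
    have hfib : ∀ i ∈ H, ∑ u ∈ F with u.headI = i, w ⬝ᵥ (pathProd a u *ᵥ z)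
        ≤ w ⬝ᵥ (a [] i *ᵥ z) := by
      intro i _
      set Fi := F.filter fun u => u.headI = i with hFi
      have hmem : ∀ u ∈ Fi, u ∈ F ∧ u = i :: u.tail := fun u hu => by
        obtain ⟨h1, h2⟩ := Finset.mem_filter.1 hu
        exact ⟨h1, by conv_lhs => rw [hcons u h1, h2]⟩
      have hinj : Set.InjOn List.tail (Fi : Set (List ℕ)) := fun u hu u' hu' h => by
        rw [(hmem u hu).2, (hmem u' hu').2, h]
      have hsum : ∑ u ∈ Fi, w ⬝ᵥ (pathProd a u *ᵥ z) = ∑ u ∈ Fi.image List.tail,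
          ((a [] i)ᵀ *ᵥ w) ⬝ᵥ (pathProd (fun v => a (i :: v)) u *ᵥ z) := by
        rw [Finset.sum_image hinj]
        refine Finset.sum_congr rfl fun u hu => ?_
        conv_lhs => rw [(hmem u hu).2, pathProd_cons]
        rw [← Matrix.mulVec_mulVec, dotProduct_mulVec_transpose]
      rw [hsum, dotProduct_mulVec_transpose]
      refine ih _ _ _ ?_ ?_ (fun v => ha _) (hSV _ (ha []) w hwV i) ?_
      · intro u hu
        obtain ⟨u', hu', rfl⟩ := Finset.mem_image.1 hu
        have := hL u' (hmem u' hu').1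
        rw [List.length_tail]
        omega
      · intro u hu v hv huv
        obtain ⟨u', hu', rfl⟩ := Finset.mem_image.1 hu
        obtain ⟨v', hv', rfl⟩ := Finset.mem_image.1 hv
        have h1 : u' <+: v' := by
          rw [(hmem u' hu').2, (hmem v' hv').2]
          exact (List.prefix_cons_inj i).2 huv
        rw [hanti u' (hmem u' hu').1 v' (hmem v' hv').1 h1]
      · exact mulVec_nonneg (fun j k => hSn _ (ha []) i k j) hw
    have hnn : ∀ i, 0 ≤ w ⬝ᵥ (a [] i *ᵥ z) := fun i =>
      Finset.sum_nonneg fun j _ => mul_nonneg (hw j)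
        (mulVec_nonneg (hSn _ (ha []) i) hz j)
    calc _ ≤ ∑ i ∈ H, w ⬝ᵥ (a [] i *ᵥ z) := Finset.sum_le_sum hfib
      _ ≤ ∑ i ∈ Finset.range (H.sup id + 1), w ⬝ᵥ (a [] i *ᵥ z) := by
          refine Finset.sum_le_sum_of_subset_of_nonneg (fun i hi => ?_) fun i _ _ => hnn i
          have := Finset.le_sup (f := id) hi
          simp only [id] at this
          exact Finset.mem_range.2 (by omega)
      _ ≤ w ⬝ᵥ z := hSs _ (ha []) w hwV hw _

lemma coverSum_step (hz : ∀ i, 0 ≤ z i) (hSV : ∀ a ∈ S, ∀ w ∈ V, ∀ i, (a i)ᵀ *ᵥ w ∈ V)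
    (hSn : ∀ a ∈ S, ∀ i j k, 0 ≤ a i j k)
    (hSs : ∀ a ∈ S, ∀ w ∈ V, (∀ i, 0 ≤ w i) → ∀ n, ∑ i ∈ Finset.range n, w ⬝ᵥ (a i *ᵥ z) ≤ w ⬝ᵥ z)
    {U : Set (List ℕ)} (hU : IsCoverSet U) (hfin : FiniteLevel U) {a : List ℕ → ℕ → Mat d}
    (ha : ∀ v, a v ∈ S) {l : Mat d} (hl : HasSum (fun u : U => pathProd a u) l)
    {w : Fin d → ℝ} (hwV : w ∈ V) (hw : ∀ i, 0 ≤ w i) :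
    lᵀ *ᵥ w ∈ V ∧ w ⬝ᵥ (l *ᵥ z) ≤ w ⬝ᵥ z := by
  classical
  obtain ⟨L, hL⟩ := hfin
  constructor
  · have hc : Continuous fun M : Mat d => Mᵀ *ᵥ w := by fun_prop
    have hs := (hc.tendsto l).comp hl
    refine V.closed_of_finiteDimensional.mem_of_tendsto hs (Eventually.of_forall fun F => ?_)
    change (∑ u ∈ F, pathProd a u)ᵀ *ᵥ w ∈ V
    rw [Matrix.transpose_sum, Matrix.sum_mulVec]
    exact V.sum_mem fun u _ => pathProd_transpose_mulVec_mem hSV _ a ha w hwV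
  · have hc : Continuous fun M : Mat d => w ⬝ᵥ (M *ᵥ z) :=
      (continuous_dotProduct_left w).comp (by fun_prop)
    have hs := (hc.tendsto l).comp hl
    refine le_of_tendsto hs (Eventually.of_forall fun F => ?_)
    change w ⬝ᵥ ((∑ u ∈ F, pathProd a u) *ᵥ z) ≤ _
    rw [Matrix.sum_mulVec, dotProduct_sum]
    have := sum_pathProd_le hz hSV hSn hSs L (F.image Subtype.val) a w
      (fun u hu => by
        obtain ⟨u, -, rfl⟩ := Finset.mem_image.1 hu
        exact hL u u.2)
      (fun u hu u' hu' h => by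
        obtain ⟨u, -, rfl⟩ := Finset.mem_image.1 hu
        obtain ⟨u', -, rfl⟩ := Finset.mem_image.1 hu'
        exact hU.eq_of_prefix u.2 u'.2 h) ha hwV hw
    rwa [Finset.sum_image Subtype.val_injective.injOn] at this

end Cover

end SmoothingTransform
end

noncomputable section

namespace SmoothingTransform

open ProbabilityTheory

/-! ### The characteristic function has modulus less than one -/

section Strict

variable {d : ℕ} {Ω : Type*} [MeasurableSpace Ω]

/-- A fixed point of the smoothing transform with the basic properties of its weights. -/
structure IsModel (P : Measure Ω) (N : Ω → ℕ) (A : ℕ → Ω → Mat d) (η : Measure (Fin d → ℝ)) :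
    Prop where
  measN : Measurable N
  measA : ∀ i, Measurable (A i)
  one_lt : 1 < meanN P N
  lt_top : meanN P N < ⊤
  zero : ∀ᵐ ω ∂P, ∀ i, N ω ≤ i → A i ω = 0
  nonneg : ∀ᵐ ω ∂P, ∀ i j k, 0 ≤ A i ω j k
  survive : ∀ᵐ ω ∂P, ∀ t : Fin d → ℝ, t ≠ 0 → ∃ j, (A j ω)ᵀ *ᵥ t ≠ 0
  fixed : smoothing P N A η = η

variable {P : Measure Ω} [IsProbabilityMeasure P] {N : Ω → ℕ} {A : ℕ → Ω → Mat d}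
  {η : Measure (Fin d → ℝ)} [IsProbabilityMeasure η]

namespace IsModel

lemma norm_cf_le (H : IsModel P N A η) (t : Fin d → ℝ) :
    ‖cf η t‖ ≤ ∫ ω, ‖∏ j ∈ Finset.range (N ω), cf η ((A j ω)ᵀ *ᵥ t)‖ ∂P := by
  conv_lhs => rw [← H.fixed, cf_smoothing P H.measN H.measA]
  exact norm_integral_le_integral_norm _

omit [IsProbabilityMeasure P] in
lemma norm_prod_cf_le (s : Finset ℕ) (f : ℕ → Fin d → ℝ) : ‖∏ j ∈ s, cf η (f j)‖ ≤ 1 := by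
  rw [norm_prod]
  exact Finset.prod_le_one (fun _ _ => norm_nonneg _) fun _ _ => norm_cf_le_one η _

lemma integrable_norm_prod (H : IsModel P N A η) (t : Fin d → ℝ) :
    Integrable (fun ω => ‖∏ j ∈ Finset.range (N ω), cf η ((A j ω)ᵀ *ᵥ t)‖) P := by
  refine Integrable.of_bound (C := 1)
    (measurable_prod_cf H.measN H.measA t).norm.aestronglyMeasurable (ae_of_all _ fun ω => ?_)
  rw [norm_norm]
  exact norm_prod_cf_le _ _

/-- The set where the characteristic function has modulus one is invariant under the weights. -/
lemma ae_norm_cf_eq_one (H : IsModel P N A η) {t : Fin d → ℝ} (ht : ‖cf η t‖ = 1) :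
    ∀ᵐ ω ∂P, ∀ j, ‖cf η ((A j ω)ᵀ *ᵥ t)‖ = 1 := by
  have h := ae_eq_one_of_one_le_integral (H.integrable_norm_prod t)
    (fun ω => norm_prod_cf_le _ _) (ht ▸ H.norm_cf_le t)
  filter_upwards [h, H.zero] with ω hω hz j
  by_cases hj : j < N ω
  · refine le_antisymm (norm_cf_le_one _ _) ?_
    rw [norm_prod] at hω
    rw [← hω]
    have := Finset.prod_le_prod_of_subset_of_le_one (s := {j}) (t := Finset.range (N ω))
      (f := fun j => ‖cf η ((A j ω)ᵀ *ᵥ t)‖) (by simpa using hj) (fun _ _ => norm_nonneg _)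
      (fun _ _ _ => norm_cf_le_one η _)
    simpa using this
  · simp [hz j (not_lt.1 hj)]

lemma exists_small_norm_cf_eq_one (H : IsModel P N A η) (h4 : CondAlpha P N A) {t : Fin d → ℝ}
    (ht0 : t ≠ 0) (ht : ‖cf η t‖ = 1) (δ : ℝ) (hδ : 0 < δ) :
    ∃ s, s ≠ 0 ∧ ‖s‖ ≤ δ ∧ ‖cf η s‖ = 1 := by
  have hmk := isMarkovKernel_step P H.measA
  have htn : 0 < ‖t‖ := norm_pos_iff.2 ht0
  -- At this time, with probability at least 1/2, all weights are below δ/|t|. Almost surely all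
  -- ℓ_kᵀ t lie in the set of modulus one and at least one of them is nonzero; that one is the
  -- required s.
  obtain ⟨n, -, hn⟩ := exists_time_small P H.measN H.measA H.one_lt H.lt_top H.zero h4 0
    (div_pos hδ htn) (δ := 1 / 2) (by simp)
  have hmkn := isMarkovKernel_pow (step P A) n
  set B : Set (St d) := {ℓ | ∀ k, ‖cf η ((ℓ k)ᵀ *ᵥ t)‖ = 1} with hB
  have hBm : MeasurableSet B := by
    have : IsClosed B := by
      rw [hB, Set.ofPred_forall]
      refine isClosed_iInter fun k => isClosed_eq ?_ continuous_const
      exact ((continuous_cf η).comp (by fun_prop : Continuous fun ℓ : St d => (ℓ k)ᵀ *ᵥ t)).norm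
    exact this.measurableSet
  have hBabs : ∀ ℓ ∈ B, ∀ᵐ ℓ' ∂(step P A ℓ), ℓ' ∈ B := by
    intro ℓ hℓ
    rw [step_apply P H.measA, ae_map_iff (measurable_branch_right H.measA ℓ).aemeasurable
      (p := fun ℓ' => ℓ' ∈ B) hBm]
    have h1 : ∀ k : ℕ, ∀ᵐ ω ∂(Measure.infinitePi fun _ : ℕ => P),
        ‖cf η ((A k.unpair.2 (ω k.unpair.1))ᵀ *ᵥ ((ℓ k.unpair.1)ᵀ *ᵥ t))‖ = 1 := fun k =>
      (measurePreserving_eval_infinitePi (fun _ : ℕ => P) k.unpair.1).quasiMeasurePreserving.ae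
        ((H.ae_norm_cf_eq_one (hℓ k.unpair.1)).mono fun ω h => h k.unpair.2)
    filter_upwards [ae_all_iff.2 h1] with ω hω k
    simpa [branch, Matrix.transpose_mul, Matrix.mulVec_mulVec] using hω k
  have hBn := ae_pow_of_absorbing (step P A) hBm hBabs n (root d) (by
    intro k
    by_cases hk : k = 0
    · simpa [hk, root] using ht
    · simp [root, hk])
  have hC : IsSigmaCompact ({t} : Set (Fin d → ℝ)) := isCompact_singleton.isSigmaCompact
  have hbig := ae_pow_of_absorbing (step P A) (measurableSet_forall_big 0 1 hC)
    (fun x hx => step_forall_big P H.measA H.survive hC hx) n (root d) (by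
      intro s hs
      rw [Set.mem_singleton_iff.1 hs]
      exact ⟨{0}, rfl, fun j hj => by
        rw [Finset.mem_singleton.1 hj]; simpa [root] using htn⟩)
  have hex : ∃ᵐ ℓ ∂((step P A ^ n) (root d)), ¬ ∃ k, δ / ‖t‖ < opNorm (ℓ k) := by
    intro hcon
    have h1 : (step P A ^ n) (root d) {ℓ | ∃ k, δ / ‖t‖ < opNorm (ℓ k)}
        = (step P A ^ n) (root d) Set.univ :=
      measure_congr (by
        filter_upwards [hcon] with ℓ hℓ
        exact propext ⟨fun _ => trivial, fun _ => not_not.1 hℓ⟩)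
    rw [measure_univ] at h1
    rw [h1] at hn
    norm_num at hn
  obtain ⟨ℓ, hℓ, h1, h2⟩ := (hex.and_eventually (hBn.and hbig)).exists
  obtain ⟨F, hF, hFb⟩ := h2 t rfl
  obtain ⟨k, hk⟩ : F.Nonempty := Finset.card_pos.1 (by omega)
  refine ⟨(ℓ k)ᵀ *ᵥ t, norm_pos_iff.1 (hFb k hk), ?_, h1 k⟩
  refine (norm_transpose_mulVec_le _ _).trans ?_
  push Not at hℓ
  calc opNorm (ℓ k) * ‖t‖ ≤ δ / ‖t‖ * ‖t‖ := by gcongr; exact hℓ k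
    _ = δ := div_mul_cancel₀ _ htn.ne'

lemma norm_cf_eq_one_of_mem_support (H : IsModel P N A η) {a : Mat d}
    (ha : a ∈ (mu P N A).support) {t : Fin d → ℝ} (ht : ‖cf η t‖ = 1) :
    ‖cf η (aᵀ *ᵥ t)‖ = 1 := by
  have hcl : IsClosed {a : Mat d | ‖cf η (aᵀ *ᵥ t)‖ = 1} := by
    refine isClosed_eq ?_ continuous_const
    exact ((continuous_cf η).comp (by fun_prop : Continuous fun a : Mat d => aᵀ *ᵥ t)).norm
  refine Measure.support_subset_of_isClosed hcl ?_ ha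
  rw [mem_ae_iff, mu, Measure.smul_apply, Measure.sum_apply _ hcl.measurableSet.compl]
  have h0 : ∀ i, ((P.restrict {ω | i < N ω}).map (A i))
      {a : Mat d | ‖cf η (aᵀ *ᵥ t)‖ = 1}ᶜ = 0 := fun i => by
    rw [Measure.map_apply (H.measA i) hcl.measurableSet.compl]
    refine Measure.absolutelyContinuous_of_le Measure.restrict_le_self ?_
    exact (H.ae_norm_cf_eq_one ht).mono fun ω h => h i
  simp [h0]

lemma norm_cf_eq_one_of_mem_Gam (H : IsModel P N A η) {a : Mat d}
    (ha : a ∈ Gam (mu P N A)) : ∀ t : Fin d → ℝ, ‖cf η t‖ = 1 → ‖cf η (aᵀ *ᵥ t)‖ = 1 := by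
  induction ha using Submonoid.closure_induction with
  | mem x hx => exact fun t ht => H.norm_cf_eq_one_of_mem_support hx ht
  | one => intro t ht; simpa using ht
  | mul x y _ _ hx hy =>
    intro t ht
    rw [Matrix.transpose_mul, ← Matrix.mulVec_mulVec]
    exact hy _ (hx t ht)

omit [IsProbabilityMeasure P] [IsProbabilityMeasure η] in
lemma mem_of_mem_seqSupport (H : IsModel P N A η) {C : Set (ℕ → Mat d)} (hC : IsClosed C)
    (h : ∀ᵐ ω ∂P, (fun i => A i ω) ∈ C) {a : ℕ → Mat d} (ha : a ∈ seqSupport P A) : a ∈ C :=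
  Measure.support_subset_of_isClosed hC
    ((ae_map_iff (measurable_pi_lambda _ H.measA).aemeasurable hC.measurableSet).2 h) ha

lemma norm_cf_eq_one_of_mem_seqSupport (H : IsModel P N A η) {a : ℕ → Mat d}
    (ha : a ∈ seqSupport P A) (i : ℕ) (t : Fin d → ℝ) (ht : ‖cf η t‖ = 1) :
    ‖cf η ((a i)ᵀ *ᵥ t)‖ = 1 := by
  have hcl : IsClosed {a : ℕ → Mat d | ‖cf η ((a i)ᵀ *ᵥ t)‖ = 1} := by
    refine isClosed_eq ?_ continuous_const
    exact ((continuous_cf η).comp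
      (by fun_prop : Continuous fun a : ℕ → Mat d => (a i)ᵀ *ᵥ t)).norm
  exact H.mem_of_mem_seqSupport hcl ((H.ae_norm_cf_eq_one ht).mono fun ω h => h i) ha

omit [IsProbabilityMeasure P] [IsProbabilityMeasure η] in
lemma nonneg_of_mem_seqSupport (H : IsModel P N A η) {a : ℕ → Mat d}
    (ha : a ∈ seqSupport P A) (i : ℕ) (j k : Fin d) : 0 ≤ a i j k := by
  have hcl : IsClosed {a : ℕ → Mat d | 0 ≤ a i j k} := by
    have hc : Continuous fun a : ℕ → Mat d => a i j k := by fun_prop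
    exact isClosed_le continuous_const hc
  exact H.mem_of_mem_seqSupport hcl (H.nonneg.mono fun ω h => h i j k) ha

/-- Both w and the vectors A_iᵀ w lie in the degenerate space, so on both sides of the fixed-point
equation, tested against w, the copies of Z may be replaced by z. -/
lemma sum_eq_of_mem_degenerate (H : IsModel P N A η) {z w : Fin d → ℝ}
    (hz : ∀ᵐ x ∂η, ∀ t ∈ degenerate η, t ⬝ᵥ x = t ⬝ᵥ z) (hw : w ∈ degenerate η) :
    ∀ᵐ ω ∂P, ∑ i ∈ Finset.range (N ω), w ⬝ᵥ (A i ω *ᵥ z) = w ⬝ᵥ z := by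
  have h1 : ∀ᵐ x ∂(smoothing P N A η), w ⬝ᵥ x = w ⬝ᵥ z := by
    rw [H.fixed]; exact hz.mono fun x h => h w hw
  have h2 := ae_of_ae_map (measurable_smoothing_sum H.measN H.measA).aemeasurable h1
  have h3 : ∀ᵐ ω ∂P, ∀ i, (A i ω)ᵀ *ᵥ w ∈ degenerate η := by
    have hw1 : ∀ n : ℕ, ‖cf η ((1 / ((n : ℝ) + 1)) • w)‖ = 1 := fun n =>
      norm_cf_eq_one_of_mem_degenerate (Submodule.smul_mem _ _ hw)
    filter_upwards [ae_all_iff.2 fun n => H.ae_norm_cf_eq_one (hw1 n)] with ω h i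
    exact mem_degenerate_of_forall_smul fun n => by
      rw [← Matrix.mulVec_smul]; exact h n i
  filter_upwards [Measure.ae_ae_of_ae_prod h2, h3] with ω hω hA
  obtain ⟨zz, h4, h5⟩ := (hω.and (ae_infinitePi η hz)).exists
  rw [← h4, dotProduct_sum]
  refine Finset.sum_congr rfl fun i _ => ?_
  rw [dotProduct_mulVec_transpose, dotProduct_mulVec_transpose, h5 i _ (hA i)]

/-- The number of summands is not controlled by finitely many coordinates of the sequence, so the
equality need not pass to the support. The inequality for partial sums is a closed condition and
does. -/
lemma sum_le_of_mem_seqSupport (H : IsModel P N A η) {z w : Fin d → ℝ}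
    (hz : ∀ᵐ x ∂η, ∀ t ∈ degenerate η, t ⬝ᵥ x = t ⬝ᵥ z) (hz0 : ∀ i, 0 ≤ z i)
    (hw : w ∈ degenerate η) (hw0 : ∀ i, 0 ≤ w i) {a : ℕ → Mat d} (ha : a ∈ seqSupport P A)
    (n : ℕ) : ∑ i ∈ Finset.range n, w ⬝ᵥ (a i *ᵥ z) ≤ w ⬝ᵥ z := by
  have hcl : IsClosed {a : ℕ → Mat d | ∑ i ∈ Finset.range n, w ⬝ᵥ (a i *ᵥ z) ≤ w ⬝ᵥ z} := by
    refine isClosed_le (continuous_finsetSum _ fun i _ => ?_) continuous_const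
    exact (continuous_dotProduct_left w).comp (by fun_prop)
  refine H.mem_of_mem_seqSupport hcl ?_ ha
  filter_upwards [H.sum_eq_of_mem_degenerate hz hw, H.nonneg, H.zero] with ω h1 h2 h3
  have hnn : ∀ i, 0 ≤ w ⬝ᵥ (A i ω *ᵥ z) := fun i =>
    Finset.sum_nonneg fun j _ => mul_nonneg (hw0 j) (mulVec_nonneg (h2 i) hz0 j)
  change ∑ i ∈ Finset.range n, w ⬝ᵥ (A i ω *ᵥ z) ≤ _
  rw [← h1]
  calc ∑ i ∈ Finset.range n, w ⬝ᵥ (A i ω *ᵥ z)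
      ≤ ∑ i ∈ Finset.range (max n (N ω)), w ⬝ᵥ (A i ω *ᵥ z) :=
        Finset.sum_le_sum_of_subset_of_nonneg
          (Finset.range_subset_range.2 (le_max_left _ _)) fun i _ _ => hnn i
    _ = ∑ i ∈ Finset.range (N ω), w ⬝ᵥ (A i ω *ᵥ z) := by
        refine (Finset.sum_subset (Finset.range_subset_range.2 (le_max_right _ _)) ?_).symm
        intro i _ hi
        rw [h3 i (by simpa using hi)]
        simp

lemma norm_cf_lt_one (H : IsModel P N A η) (hη0 : ∀ᵐ z ∂η, ∀ i, 0 ≤ z i) (hηz : η {0} = 0)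
    (h3 : CondCover P A) (h4 : CondAlpha P N A)
    (hΛ : ∃ v : Fin d → (Fin d → ℝ), (∀ i, v i ∈ Lam (mu P N A)) ∧ LinearIndependent ℝ v)
    {t : Fin d → ℝ} (ht : t ≠ 0) : ‖cf η t‖ < 1 := by
  refine lt_of_le_of_ne (norm_cf_le_one η t) fun h1 => ?_
  have hV : degenerate η ≠ ⊥ := degenerate_ne_bot (H.exists_small_norm_cf_eq_one h4 ht h1)
  obtain ⟨w, hwV, hw⟩ := exists_pos_mem (μ := mu P N A) hV (fun a ha t ht =>
    transpose_mulVec_mem_degenerate (H.norm_cf_eq_one_of_mem_Gam ha) ht) hΛ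
  have hae : ∀ᵐ z ∂η, ∀ᵐ x ∂η, ∀ t ∈ degenerate η, t ⬝ᵥ x = t ⬝ᵥ z := by
    filter_upwards [Measure.ae_ae_of_ae_prod (ae_forall_mem_degenerate (η := η))] with z hz
    filter_upwards [hz] with x hx t ht using (hx t ht).symm
  have hne : ∀ᵐ z ∂η, z ≠ 0 := by rw [ae_iff]; simpa using hηz
  obtain ⟨z, hz, hz0, hzne⟩ := (hae.and (hη0.and hne)).exists
  obtain ⟨-, l, -, ⟨U, hU, hUf, a, ha, hl⟩, -, hlpos, -, hlr⟩ := h3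
  have hstep : ∀ w ∈ degenerate η, (∀ i, 0 ≤ w i) →
      lᵀ *ᵥ w ∈ degenerate η ∧ w ⬝ᵥ (l *ᵥ z) ≤ w ⬝ᵥ z := fun w hwV hw =>
    coverSum_step (S := seqSupport P A) hz0
      (fun a ha w hw i => transpose_mulVec_mem_degenerate
        (H.norm_cf_eq_one_of_mem_seqSupport ha i) hw)
      (fun a ha => H.nonneg_of_mem_seqSupport ha)
      (fun a ha w hw hw0 n => H.sum_le_of_mem_seqSupport hz hz0 hw hw0 ha n) hU hUf ha hl hwV hw
  have hiter : ∀ n : ℕ, ∀ w ∈ degenerate η, (∀ i, 0 ≤ w i) → w ⬝ᵥ (l ^ n *ᵥ z) ≤ w ⬝ᵥ z := by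
    intro n
    induction n with
    | zero => intro w _ _; simp
    | succ n ih =>
      intro w hwV hw
      obtain ⟨h1, h2⟩ := hstep w hwV hw
      have h3 := ih _ h1 (mulVec_nonneg (fun i j => (hlpos j i).le) hw)
      rw [← dotProduct_mulVec_transpose, ← dotProduct_mulVec_transpose] at h3
      rw [pow_succ', ← Matrix.mulVec_mulVec]
      exact h3.trans h2
  have := specRad_le_one_of_bounded hlpos hz0 hzne hw
    (fun n => hiter n w hwV fun i => (hw i).le)
  linarith

end IsModel

end Strict

end SmoothingTransform
end

noncomputable section

namespace SmoothingTransform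

open ProbabilityTheory

/-! ### Decay of the characteristic function -/

section Decay

variable {d : ℕ} {Ω : Type*} [MeasurableSpace Ω] {P : Measure Ω} [IsProbabilityMeasure P]
  {N : Ω → ℕ} {A : ℕ → Ω → Mat d} {η : Measure (Fin d → ℝ)} [IsProbabilityMeasure η]

omit [MeasurableSpace Ω] in
lemma exists_ne_zero_of_one_le_countNonzero {ω : Ω} {t : Fin d → ℝ}
    (h : 1 ≤ countNonzero A t ω) : ∃ j, (A j ω)ᵀ *ᵥ t ≠ 0 := by
  rw [countNonzero, Set.one_le_encard_iff_nonempty] at h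
  exact h

omit [MeasurableSpace Ω] in
lemma big_two_of_countNonzero {ω : Ω} {t : Fin d → ℝ}
    (h : 1 ≤ countNonzero A t ω) (h1 : countNonzero A t ω ≠ 1) :
    Big 0 2 (fun j => A j ω) t := by
  have h2 : 1 < {i : ℕ | (A i ω)ᵀ *ᵥ t ≠ 0}.encard := lt_of_le_of_ne h (Ne.symm h1)
  obtain ⟨a, b, ha, hb, hab⟩ := Set.one_lt_encard_iff.1 h2
  refine ⟨{a, b}, Finset.card_pair hab, fun j hj => norm_pos_iff.2 ?_⟩
  rcases Finset.mem_insert.1 hj with rfl | hj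
  · exact ha
  · rw [Finset.mem_singleton.1 hj]; exact hb

/-- Almost surely N(t) ≥ 1, and N(t) = 1 has probability below one, so two particles survive with
positive probability. Compactness of the unit sphere makes size and probability uniform, and
homogeneity extends this to all t ≠ 0. -/
lemma exists_two (hA : ∀ i, Measurable (A i))
    (h1 : ∀ᵐ ω ∂P, ∀ t : Fin d → ℝ, t ≠ 0 → 1 ≤ countNonzero A t ω)
    (h2 : ∀ t : Fin d → ℝ, t ≠ 0 → P {ω | countNonzero A t ω = 1} < 1) :
    ∃ r : ℝ, 0 < r ∧ ∃ p : ℝ≥0∞, 0 < p ∧ ∀ t : Fin d → ℝ, t ≠ 0 →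
      p ≤ P {ω | Big (‖t‖ * r) 2 (fun j => A j ω) t} := by
  have hmA : Measurable fun ω i => A i ω := measurable_pi_lambda _ hA
  obtain ⟨r, hr, p, hp, h⟩ := exists_radius_big (P.map fun ω i => A i ω)
    (isCompact_sphere (0 : Fin d → ℝ) 1) 2 (c := 0) (by simp) (fun t ht => by
      have ht0 : t ≠ 0 := ne_zero_of_mem_unit_sphere ⟨t, ht⟩
      rw [Measure.map_apply hmA (measurableSet_big _ _ _)]
      refine pos_iff_ne_zero.2 fun h0 => (h2 t ht0).ne ?_
      rw [← measure_univ (μ := P)]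
      refine measure_congr ?_
      have h0' : ∀ᵐ ω ∂P, ¬ Big 0 2 (fun j => A j ω) t := by
        rw [ae_iff]; simpa using h0
      filter_upwards [h1, h0'] with ω hω h0
      refine propext ⟨fun _ => trivial, fun _ => ?_⟩
      by_contra hne
      exact h0 (big_two_of_countNonzero (hω t ht0) hne))
  refine ⟨r, hr, p, hp, fun t ht => ?_⟩
  have htn : 0 < ‖t‖ := norm_pos_iff.2 ht
  have hu := h (‖t‖⁻¹ • t) (by simp [norm_smul, htn.ne'])
  rw [Measure.map_apply hmA (measurableSet_big _ _ _)] at hu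
  refine hu.trans (measure_mono fun ω hω => ?_)
  have := (big_smul_iff htn).2 (show Big r 2 (fun j => A j ω) (‖t‖⁻¹ • t) from hω)
  rwa [smul_inv_smul₀ htn.ne'] at this

lemma integral_le_of_le_on {X : Type*} [MeasurableSpace X] {Q : Measure X}
    [IsProbabilityMeasure Q] {f : X → ℝ} (hfi : Integrable f Q) (hf1 : ∀ x, f x ≤ 1)
    {E : Set X} (hE : MeasurableSet E) {x p : ℝ} (hx : x ≤ 1) (hp : p ≤ Q.real E)
    (hfE : ∀ᵐ y ∂Q, y ∈ E → f y ≤ x) : ∫ y, f y ∂Q ≤ 1 - p * (1 - x) := by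
  have hi : Integrable (fun y => 1 - E.indicator (fun _ => 1 - x) y) Q :=
    (integrable_const _).sub ((integrable_const _).indicator hE)
  calc ∫ y, f y ∂Q ≤ ∫ y, (1 - E.indicator (fun _ => 1 - x) y) ∂Q := by
        refine integral_mono_ae hfi hi ?_
        filter_upwards [hfE] with y hy
        by_cases h : y ∈ E
        · simpa [h] using hy h
        · simpa [h] using hf1 y
    _ = 1 - Q.real E * (1 - x) := by
        rw [integral_sub (integrable_const _) ((integrable_const _).indicator hE),
          integral_indicator_const _ hE]
        simp
    _ ≤ 1 - p * (1 - x) := by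
        have : 0 ≤ 1 - x := by linarith
        gcongr

lemma integrable_norm_cf_sumLaw (Q : Measure (St d)) [IsProbabilityMeasure Q] (t : Fin d → ℝ) :
    Integrable (fun ℓ => ‖cf (sumLaw η ℓ) t‖) Q := by
  refine Integrable.of_bound (C := 1)
    (measurable_cf_kernel (sumLaw η) t).norm.aestronglyMeasurable (ae_of_all _ fun ℓ => ?_)
  rw [norm_norm]
  exact norm_cf_le_one _ _

lemma IsModel.norm_cf_le_integral_pow (H : IsModel P N A η) (n : ℕ) (t : Fin d → ℝ) :
    ‖cf η t‖ ≤ ∫ ℓ, ‖cf (sumLaw η ℓ) t‖ ∂((step P A ^ n) (root d)) := by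
  have := isMarkovKernel_step P H.measA
  have := isMarkovKernel_pow (step P A) n
  conv_lhs => rw [← bind_step_pow_root P H.measN H.measA H.zero H.fixed n, cf_bind]
  exact norm_integral_le_integral_norm _

omit [IsProbabilityMeasure η] in
lemma IsModel.ae_finStates (H : IsModel P N A η) (n : ℕ) :
    ∀ᵐ ℓ ∂((step P A ^ n) (root d)), ℓ ∈ finStates d :=
  ae_pow_of_absorbing (step P A) measurableSet_finStates
    (fun _ hx => step_finStates P H.measA H.zero hx) n _ root_mem_finStates

lemma big_root {t : Fin d → ℝ} (ht : t ≠ 0) : Big 0 1 (root d) t :=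
  ⟨{0}, rfl, fun j hj => by
    rw [Finset.mem_singleton.1 hj]; simpa [root] using ht⟩

omit [IsProbabilityMeasure η] in
/-- After a suitable time, in each direction two particles are typically present whose weights
are neither too small nor larger than one. -/
lemma IsModel.exists_time_two (H : IsModel P N A η) (h4 : CondAlpha P N A) {q : ℝ≥0∞}
    (hq1 : q < 1)
    (hq : ∀ t : Fin d → ℝ, t ≠ 0 → P {ω | Big 0 2 (fun j => A j ω) t}ᶜ ≤ q) :
    ∃ n : ℕ, ∃ r : ℝ, 0 < r ∧ ∀ t : Fin d → ℝ, t ≠ 0 → ∃ E : Set (St d), MeasurableSet E ∧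
      3 / 5 ≤ ((step P A ^ n) (root d)).real E ∧
      ∀ ℓ ∈ E, Big (‖t‖ * r) 2 ℓ t ∧ ∀ k, opNorm (ℓ k) ≤ 1 := by
  have := isMarkovKernel_step P H.measA
  have hmk := isMarkovKernel_pow (step P A)
  have h5 : (1 / 5 : ℝ≥0∞) ≠ 0 := by simp
  -- Survival holds with probability at least 9/10 at all times beyond m, so one of the times with
  -- small weights can be chosen there. Since 9/10 > 4/5, a uniform radius keeps probability 4/5;
  -- discarding weights above one costs 1/5 and leaves 3/5.
  obtain ⟨m, hm⟩ := exists_time_big P H.measA H.survive hq1 hq (ε := 1 / 10) (by simp) 2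
  obtain ⟨n, hmn, hn⟩ := exists_time_small P H.measN H.measA H.one_lt H.lt_top H.zero h4 m
    one_pos h5
  set Q := (step P A ^ n) (root d) with hQ
  obtain ⟨r, hr, b, hb, h⟩ := exists_radius_big Q (isCompact_sphere (0 : Fin d → ℝ) 1) 2
    (c := 4 / 5) (ENNReal.div_lt_top (by simp) (by simp)) (fun t ht => by
      have ht0 : t ≠ 0 := ne_zero_of_mem_unit_sphere ⟨t, ht⟩
      have h1 := hm n hmn t _ (big_root ht0)
      have h2 := ENNReal.toReal_mono (by simp) h1
      have h3 := probReal_compl_eq_one_sub (μ := Q) (measurableSet_big 0 2 t)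
      rw [← hQ, ← measureReal_def, h3] at h2
      rw [← ENNReal.toReal_lt_toReal (ENNReal.div_lt_top (by simp) (by simp)).ne
        (measure_ne_top _ _), ← measureReal_def]
      norm_num at h2 ⊢
      linarith)
  refine ⟨n, r, hr, fun t ht => ?_⟩
  have htn : 0 < ‖t‖ := norm_pos_iff.2 ht
  set S := toMeasurable Q {ℓ | ∃ k, 1 < opNorm (ℓ k)} with hS
  refine ⟨{ℓ | Big r 2 ℓ (‖t‖⁻¹ • t)} \ S,
    (measurableSet_big _ _ _).diff (measurableSet_toMeasurable _ _), ?_, fun ℓ hℓ => ⟨?_, ?_⟩⟩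
  · have hu := hb.le.trans (h (‖t‖⁻¹ • t) (by simp [norm_smul, htn.ne']))
    have hu' : 4 / 5 ≤ Q.real {ℓ | Big r 2 ℓ (‖t‖⁻¹ • t)} := by
      have := ENNReal.toReal_mono (measure_ne_top _ _) hu
      simpa [Measure.real] using this
    have hs : Q.real S ≤ 1 / 5 := by
      have := ENNReal.toReal_mono (by simp) ((measure_toMeasurable _).trans_le hn)
      simpa only [ENNReal.toReal_div, ENNReal.toReal_one, ENNReal.toReal_ofNat,
        ← measureReal_def] using this
    have := le_measureReal_sdiff (μ := Q) (s₁ := {ℓ | Big r 2 ℓ (‖t‖⁻¹ • t)}) (s₂ := S)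
    linarith
  · have := (big_smul_iff htn).2 (show Big r 2 ℓ (‖t‖⁻¹ • t) from hℓ.1)
    rwa [smul_inv_smul₀ htn.ne'] at this
  · intro k
    by_contra hk
    exact hℓ.2 (subset_toMeasurable _ _ ⟨k, not_le.1 hk⟩)

/-- The characteristic function is bounded away from one outside the unit ball. -/
lemma IsModel.exists_norm_cf_le (H : IsModel P N A η) (h4 : CondAlpha P N A) {q : ℝ≥0∞}
    (hq1 : q < 1)
    (hq : ∀ t : Fin d → ℝ, t ≠ 0 → P {ω | Big 0 2 (fun j => A j ω) t}ᶜ ≤ q)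
    (hlt : ∀ t : Fin d → ℝ, t ≠ 0 → ‖cf η t‖ < 1) :
    ∃ ρ < 1, ∀ t : Fin d → ℝ, 1 ≤ ‖t‖ → ‖cf η t‖ ≤ ρ := by
  have := isMarkovKernel_step P H.measA
  have hmk := isMarkovKernel_pow (step P A)
  obtain ⟨n, r, hr, hE⟩ := H.exists_time_two h4 hq1 hq
  have hcomp : ∀ R : ℝ, IsCompact {t : Fin d → ℝ | 1 ≤ ‖t‖ ∧ ‖t‖ ≤ R} := fun R => by
    refine (isCompact_closedBall (0 : Fin d → ℝ) R).of_isClosed_subset ?_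
      fun t ht => by simpa using ht.2
    exact (isClosed_le continuous_const continuous_norm).inter
      (isClosed_le continuous_norm continuous_const)
  have hmax : ∀ R : ℝ, ∀ t : Fin d → ℝ, 1 ≤ ‖t‖ → ‖t‖ ≤ R → ∃ s : Fin d → ℝ, 1 ≤ ‖s‖ ∧ ‖s‖ ≤ R ∧
      ∀ u : Fin d → ℝ, 1 ≤ ‖u‖ → ‖u‖ ≤ R → ‖cf η u‖ ≤ ‖cf η s‖ := fun R t h1 h2 => by
    obtain ⟨s, hs, hmax⟩ := (hcomp R).exists_isMaxOn ⟨t, h1, h2⟩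
      (continuous_cf η).norm.continuousOn
    exact ⟨s, hs.1, hs.2, fun u hu1 hu2 => hmax ⟨hu1, hu2⟩⟩
  obtain ⟨x, hx1, hx⟩ : ∃ x < 1, ∀ t : Fin d → ℝ, 1 ≤ ‖t‖ → ‖t‖ ≤ 1 / r → ‖cf η t‖ ≤ x := by
    by_cases h : ∃ t : Fin d → ℝ, 1 ≤ ‖t‖ ∧ ‖t‖ ≤ 1 / r
    · obtain ⟨t, ht1, ht2⟩ := h
      obtain ⟨s, hs1, -, hs⟩ := hmax _ t ht1 ht2
      exact ⟨_, hlt s (norm_pos_iff.1 (by linarith)), hs⟩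
    · exact ⟨0, one_pos, fun t h1 h2 => (h ⟨t, h1, h2⟩).elim⟩
  -- Let s maximise |`cf η`| on 1 ≤ |u| ≤ |t|, with value y. If |s| > 1/r, then on E two factors are
  -- evaluated inside the same annulus, so y ≤ 1 - (3/5)(1 - y²), that is (1 - y)(2 - 3y) ≥ 0. As y
  -- < 1, this gives y ≤ 2/3. A probability above 1/2 is what makes this work.
  refine ⟨max x (2 / 3), max_lt hx1 (by norm_num), fun t ht => ?_⟩
  obtain ⟨s, hs1, hs2, hs⟩ := hmax ‖t‖ t ht le_rfl
  refine (hs t ht le_rfl).trans ?_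
  by_cases hsr : ‖s‖ ≤ 1 / r
  · exact (hx s hs1 hsr).trans (le_max_left _ _)
  refine le_trans ?_ (le_max_right _ _)
  have hs0 : s ≠ 0 := norm_pos_iff.1 (by linarith)
  obtain ⟨E, hEm, hEp, hEb⟩ := hE s hs0
  have hsr' : 1 ≤ ‖s‖ * r := by
    rw [not_le, div_lt_iff₀ hr] at hsr
    exact hsr.le
  have hy0 := norm_nonneg (cf η s)
  have hy1 := hlt s hs0
  have key := (H.norm_cf_le_integral_pow n s).trans
    (integral_le_of_le_on (x := ‖cf η s‖ ^ 2) (p := 3 / 5) (integrable_norm_cf_sumLaw _ s)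
      (fun _ => norm_cf_le_one _ _) hEm (by nlinarith) hEp (by
        filter_upwards [H.ae_finStates n] with ℓ hℓ hℓE
        obtain ⟨⟨F, hF, hFb⟩, hop⟩ := hEb ℓ hℓE
        refine (norm_cf_sumLaw_le η hℓ s F).trans ?_
        rw [← hF]
        rw [← Finset.prod_const]
        refine Finset.prod_le_prod (fun _ _ => norm_nonneg _) fun j hj =>
          hs _ (hsr'.trans (hFb j hj).le) ?_
        refine (norm_transpose_mulVec_le _ _).trans (le_trans ?_ hs2)
        exact mul_le_of_le_one_left (norm_nonneg _) (hop j)))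
  nlinarith

end Decay

end SmoothingTransform
end

noncomputable section

namespace SmoothingTransform

open ProbabilityTheory

/-! ### Polynomial decay of the characteristic function -/

section Polynomial

/-- Bernoulli's inequality gives X^(-a) ≤ 1 + (a/ε) X^(-ε). The loss caused by a small X thus
carries the factor a/ε, which can be made small. The truncation at T is compatible with this. -/
lemma rpow_min_le {a ε s X T : ℝ} (ha : 0 < a) (haε : a ≤ ε) (hs : 0 < s) (hX : 0 < X)
    (hT : 0 < T) : min s T ^ a ≤ min (s * X) T ^ a * (1 + a / ε * X ^ (-ε)) := by
  have hε : 0 < ε := ha.trans_le haε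
  have hXε : 0 ≤ X ^ (-ε) := Real.rpow_nonneg hX.le _
  have h0 : 0 < min (s * X) T := lt_min (mul_pos hs hX) hT
  rcases le_total 1 X with h | h
  · calc min s T ^ a ≤ min (s * X) T ^ a := by
          refine Real.rpow_le_rpow (lt_min hs hT).le (min_le_min_right _ ?_) ha.le
          exact le_mul_of_one_le_right hs.le h
      _ ≤ _ := le_mul_of_one_le_right (Real.rpow_nonneg h0.le _)
          (le_add_of_nonneg_right (by positivity))
  · have h1 : min s T * X ≤ min (s * X) T :=
      le_min (by gcongr; exact min_le_left _ _)
        ((mul_le_of_le_one_right (lt_min hs hT).le h).trans (min_le_right _ _))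
    have h2 : X ^ (-a) ≤ 1 + a / ε * X ^ (-ε) := by
      have hle : a / ε ≤ 1 := (div_le_one hε).2 haε
      have h := rpow_one_add_le_one_add_mul_self (s := X ^ (-ε) - 1) (by linarith)
        (p := a / ε) (by positivity) hle
      rw [add_sub_cancel, ← Real.rpow_mul hX.le, neg_mul, mul_div_cancel₀ _ hε.ne'] at h
      have : 0 ≤ a / ε := by positivity
      nlinarith
    calc min s T ^ a = (min s T * X) ^ a * X ^ (-a) := by
          rw [Real.mul_rpow (lt_min hs hT).le hX.le, mul_assoc, ← Real.rpow_add hX]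
          simp
      _ ≤ _ := by
          gcongr

variable {d : ℕ} {Ω : Type*} [MeasurableSpace Ω] {P : Measure Ω} [IsProbabilityMeasure P]
  {N : Ω → ℕ} {A : ℕ → Ω → Mat d} {η : Measure (Fin d → ℝ)} [IsProbabilityMeasure η]

lemma l1_smul (c : ℝ) (x : Fin d → ℝ) : l1 (c • x) = |c| * l1 x := by
  simp [l1, abs_mul, Finset.mul_sum]

lemma norm_le_l1 (x : Fin d → ℝ) : ‖x‖ ≤ l1 x :=
  (pi_norm_le_iff_of_nonneg (Finset.sum_nonneg fun _ _ => abs_nonneg _)).2 fun i =>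
    Finset.single_le_sum (f := fun i => |x i|) (fun _ _ => abs_nonneg _) (Finset.mem_univ i)

lemma l1_le_norm (x : Fin d → ℝ) : l1 x ≤ d * ‖x‖ := by
  have : ∑ i, |x i| ≤ ∑ _ : Fin d, ‖x‖ := Finset.sum_le_sum fun i _ => norm_le_pi_norm x i
  simpa [l1] using this

omit [IsProbabilityMeasure P] in
/-- A negative moment of the size of a suitably chosen weight, uniformly in the direction. -/
lemma exists_negative_moment (hd : 1 ≤ d) (hA : ∀ i, Measurable (A i))
    (h : ∃ ε : ℝ, 0 < ε ∧ ∃ i : (Fin d → ℝ) → Ω → ℕ,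
      (∀ t, l1 t = 1 → Measurable (i t) ∧ ∀ᵐ ω ∂P, (A (i t ω) ω)ᵀ *ᵥ t ≠ 0) ∧
      (⨆ (t : Fin d → ℝ) (_ : l1 t = 1),
        ∫⁻ ω, ENNReal.ofReal (l1 ((A (i t ω) ω)ᵀ *ᵥ t)) ^ (-ε) ∂P) < ⊤) :
    ∃ ε : ℝ, 0 < ε ∧ ∃ M : ℝ, 0 ≤ M ∧ ∀ t : Fin d → ℝ, t ≠ 0 → ∃ i : Ω → ℕ, ∃ Y : Ω → ℝ,
      Integrable Y P ∧ ∫ ω, Y ω ∂P ≤ M ∧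
      ∀ᵐ ω ∂P, (A (i ω) ω)ᵀ *ᵥ t ≠ 0 ∧ (‖(A (i ω) ω)ᵀ *ᵥ t‖ / ‖t‖) ^ (-ε) ≤ Y ω := by
  obtain ⟨ε, hε, i, hi, hsup⟩ := h
  have hd0 : (0 : ℝ) < d := by exact_mod_cast hd
  set S := ⨆ (t : Fin d → ℝ) (_ : l1 t = 1),
        ∫⁻ ω, ENNReal.ofReal (l1 ((A (i t ω) ω)ᵀ *ᵥ t)) ^ (-ε) ∂P with hS
  -- The factor d^ε is the price of passing from the L¹ norm to the supremum norm, through l1 ≤ d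
  -- ‖·‖.
  refine ⟨ε, hε, (d : ℝ) ^ ε * S.toReal, by positivity, fun t ht => ?_⟩
  have htn : 0 < ‖t‖ := norm_pos_iff.2 ht
  have hl : 0 < l1 t := htn.trans_le (norm_le_l1 t)
  set u := (l1 t)⁻¹ • t with hu
  have htu : t = l1 t • u := (smul_inv_smul₀ hl.ne' t).symm
  have hul : l1 u = 1 := by rw [hu, l1_smul, abs_of_pos (inv_pos.2 hl), inv_mul_cancel₀ hl.ne']
  obtain ⟨him, hine⟩ := hi u hul
  have hle : ∫⁻ ω, ENNReal.ofReal (l1 ((A (i u ω) ω)ᵀ *ᵥ u)) ^ (-ε) ∂P ≤ S :=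
    le_iSup₂_of_le u hul le_rfl
  have hmeas : Measurable fun ω => ENNReal.ofReal (l1 ((A (i u ω) ω)ᵀ *ᵥ u)) ^ (-ε) := by
    have h1 : Measurable fun p : ℕ × Ω => (A p.1 p.2)ᵀ *ᵥ u := by
      refine measurable_from_prod_countable_right fun n => ?_
      exact Measurable.mulVec' (Measurable.matTranspose (hA n)) measurable_const
    have h2 : Measurable fun ω => (A (i u ω) ω)ᵀ *ᵥ u := by
      simpa only [Function.comp_def, id] using h1.comp (him.prodMk measurable_id)
    have h3 : Measurable (l1 (d := d)) := by unfold l1; fun_prop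
    exact ((h3.comp h2).ennreal_ofReal).pow_const _
  have hne := (hle.trans_lt hsup).ne
  refine ⟨i u, fun ω => (d : ℝ) ^ ε *
    (ENNReal.ofReal (l1 ((A (i u ω) ω)ᵀ *ᵥ u)) ^ (-ε)).toReal,
    (integrable_toReal_of_lintegral_ne_top hmeas.aemeasurable hne).const_mul _, ?_, ?_⟩
  · rw [integral_const_mul, integral_toReal hmeas.aemeasurable
      (ae_lt_top' hmeas.aemeasurable hne)]
    gcongr
    exact hsup.ne
  · filter_upwards [hine] with ω hω
    have hpos : 0 < ‖(A (i u ω) ω)ᵀ *ᵥ u‖ := norm_pos_iff.2 hω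
    have hlpos := hpos.trans_le (norm_le_l1 _)
    refine ⟨?_, ?_⟩
    · rw [htu, Matrix.mulVec_smul]
      exact smul_ne_zero hl.ne' hω
    · rw [← ENNReal.toReal_rpow, ENNReal.toReal_ofReal hlpos.le]
      calc (‖(A (i u ω) ω)ᵀ *ᵥ t‖ / ‖t‖) ^ (-ε)
          ≤ (l1 ((A (i u ω) ω)ᵀ *ᵥ u) / d) ^ (-ε) := by
            refine Real.rpow_le_rpow_of_nonpos (by positivity) ?_ (by linarith)
            rw [div_le_div_iff₀ hd0 htn]
            conv_rhs => rw [htu, Matrix.mulVec_smul, norm_smul, Real.norm_of_nonneg hl.le]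
            calc l1 ((A (i u ω) ω)ᵀ *ᵥ u) * ‖t‖ ≤ (d * ‖(A (i u ω) ω)ᵀ *ᵥ u‖) * l1 t :=
                  mul_le_mul (l1_le_norm _) (norm_le_l1 t) htn.le (by positivity)
              _ = _ := by ring
        _ = _ := by
            rw [Real.div_rpow hlpos.le hd0.le, Real.rpow_neg hd0.le, div_inv_eq_mul, mul_comm]

omit [MeasurableSpace Ω] in
lemma norm_prod_cf_le_prod {ω : Ω} (h0 : ∀ i, N ω ≤ i → A i ω = 0) (t : Fin d → ℝ)
    (F : Finset ℕ) : ‖∏ j ∈ Finset.range (N ω), cf η ((A j ω)ᵀ *ᵥ t)‖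
      ≤ ∏ j ∈ F, ‖cf η ((A j ω)ᵀ *ᵥ t)‖ := by
  rw [← cf_sumLaw η (ℓ := fun j => A j ω) fun k hk => h0 k (by simpa using hk)]
  exact norm_cf_sumLaw_le η ⟨N ω, h0⟩ t F

/-- The characteristic function decays polynomially. -/
lemma IsModel.exists_decay (H : IsModel P N A η) {ρ : ℝ} (hρ1 : ρ < 1)
    (hρ : ∀ t : Fin d → ℝ, 1 ≤ ‖t‖ → ‖cf η t‖ ≤ ρ) {r p : ℝ} (hr : 0 < r) (hp : 0 < p)
    (hbig : ∀ t : Fin d → ℝ, t ≠ 0 → p ≤ P.real {ω | Big (‖t‖ * r) 2 (fun j => A j ω) t})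
    {ε M : ℝ} (hε : 0 < ε) (hM : 0 ≤ M)
    (hneg : ∀ t : Fin d → ℝ, t ≠ 0 → ∃ i : Ω → ℕ, ∃ Y : Ω → ℝ,
      Integrable Y P ∧ ∫ ω, Y ω ∂P ≤ M ∧
      ∀ᵐ ω ∂P, (A (i ω) ω)ᵀ *ᵥ t ≠ 0 ∧ (‖(A (i ω) ω)ᵀ *ᵥ t‖ / ‖t‖) ^ (-ε) ≤ Y ω) :
    ∃ a : ℝ, 0 < a ∧ ∃ C : ℝ, 0 < C ∧ ∀ t : Fin d → ℝ, ‖t‖ ^ a * ‖cf η t‖ ≤ C := by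
  -- The choice of a makes the loss (a/ε) M smaller than the gain p (1 - ρ), so that the contraction
  -- factor q is below 1.
  obtain ⟨a, ha, haε, haq⟩ : ∃ a : ℝ, 0 < a ∧ a ≤ ε ∧ a / ε * M < p * (1 - ρ) := by
    have hc : 0 < p * (1 - ρ) := mul_pos hp (by linarith)
    refine ⟨min ε (ε * (p * (1 - ρ) / (M + 1))), by positivity, min_le_left _ _, ?_⟩
    calc min ε (ε * (p * (1 - ρ) / (M + 1))) / ε * M
        ≤ (ε * (p * (1 - ρ) / (M + 1))) / ε * M := by gcongr; exact min_le_right _ _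
      _ = p * (1 - ρ) * (M / (M + 1)) := by field_simp
      _ < p * (1 - ρ) := mul_lt_of_lt_one_right hc ((div_lt_one (by linarith)).2 (by linarith))
  have hR : 0 < 1 / r := by positivity
  refine ⟨a, ha, (1 / r) ^ a, by positivity, ?_⟩
  set q := 1 - p * (1 - ρ) + a / ε * M with hq
  -- the recursive estimate for truncated weights
  have key : ∀ T : ℝ, 0 < T → ∀ S : ℝ, 0 ≤ S →
      (∀ t : Fin d → ℝ, min ‖t‖ T ^ a * ‖cf η t‖ ≤ S) →
      ∀ t : Fin d → ℝ, 1 / r < ‖t‖ → min ‖t‖ T ^ a * ‖cf η t‖ ≤ q * S := by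
    intro T hT S hS hST t htr
    have htn : 0 < ‖t‖ := hR.trans htr
    have ht0 : t ≠ 0 := norm_pos_iff.1 htn
    have hρ0 : 0 ≤ ρ := (norm_nonneg _).trans (hρ (‖t‖⁻¹ • t) (by simp [norm_smul, htn.ne']))
    have hm : 0 < min ‖t‖ T ^ a := Real.rpow_pos_of_pos (lt_min htn hT) _
    obtain ⟨i, Y, hYi, hYM, hY⟩ := hneg t ht0
    set E : Set Ω := {ω | Big (‖t‖ * r) 2 (fun j => A j ω) t} with hE
    have hEm : MeasurableSet E :=
      (measurableSet_big (‖t‖ * r) 2 t).preimage (measurable_pi_lambda _ H.measA)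
    have hint : Integrable (fun ω => S * (1 - E.indicator (fun _ => 1 - ρ) ω + a / ε * Y ω)) P :=
      (((integrable_const _).sub ((integrable_const _).indicator hEm)).add
        (hYi.const_mul _)).const_mul _
    calc min ‖t‖ T ^ a * ‖cf η t‖
        ≤ min ‖t‖ T ^ a * ∫ ω, ‖∏ j ∈ Finset.range (N ω), cf η ((A j ω)ᵀ *ᵥ t)‖ ∂P := by
          gcongr
          exact H.norm_cf_le t
      _ = ∫ ω, min ‖t‖ T ^ a * ‖∏ j ∈ Finset.range (N ω), cf η ((A j ω)ᵀ *ᵥ t)‖ ∂P :=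
          (integral_const_mul _ _).symm
      _ ≤ ∫ ω, S * (1 - E.indicator (fun _ => 1 - ρ) ω + a / ε * Y ω) ∂P := by
          refine integral_mono_ae ((H.integrable_norm_prod t).const_mul _) hint ?_
          filter_upwards [hY, H.zero] with ω ⟨hne, hYω⟩ h0
          set X := ‖(A (i ω) ω)ᵀ *ᵥ t‖ / ‖t‖ with hXdef
          have hX : 0 < X := div_pos (norm_pos_iff.2 hne) htn
          have hXt : ‖t‖ * X = ‖(A (i ω) ω)ᵀ *ᵥ t‖ := mul_div_cancel₀ _ htn.ne'
          have h1 := rpow_min_le ha haε htn hX hT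
          have h2 := hST ((A (i ω) ω)ᵀ *ᵥ t)
          rw [← hXt] at h2
          -- The factor at the chosen index is kept for the recursion. On E one of the two large
          -- particles differs from it, and since |t| r > 1 that particle contributes at most ρ.
          have hfac : ‖∏ j ∈ Finset.range (N ω), cf η ((A j ω)ᵀ *ᵥ t)‖ ≤
              (1 - E.indicator (fun _ => 1 - ρ) ω) * ‖cf η ((A (i ω) ω)ᵀ *ᵥ t)‖ := by
            by_cases hω : ω ∈ E
            · obtain ⟨F, hF, hFb⟩ := hω
              obtain ⟨j, hj, hji⟩ := Finset.exists_mem_ne (by omega : 1 < F.card) (i ω)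
              refine (norm_prod_cf_le_prod h0 t {j, i ω}).trans ?_
              rw [Finset.prod_pair hji, Set.indicator_of_mem (by exact ⟨F, hF, hFb⟩)]
              gcongr
              rw [sub_sub_cancel]
              refine hρ _ (le_trans ?_ (hFb j hj).le)
              rw [div_lt_iff₀ hr] at htr
              exact htr.le
            · refine (norm_prod_cf_le_prod h0 t {i ω}).trans ?_
              simp [hω]
          set ξ := 1 - E.indicator (fun _ => 1 - ρ) ω with hξ
          have hξ0 : 0 ≤ ξ ∧ ξ ≤ 1 := by
            by_cases hω : ω ∈ E
            · simp only [hξ, Set.indicator_of_mem hω]; constructor <;> linarith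
            · simp [hξ, hω]
          have hXε : 0 ≤ X ^ (-ε) := Real.rpow_nonneg hX.le _
          have haε0 : 0 ≤ a / ε := by positivity
          calc min ‖t‖ T ^ a * ‖∏ j ∈ Finset.range (N ω), cf η ((A j ω)ᵀ *ᵥ t)‖
              ≤ (min (‖t‖ * X) T ^ a * (1 + a / ε * X ^ (-ε))) *
                  (ξ * ‖cf η ((A (i ω) ω)ᵀ *ᵥ t)‖) := by
                refine mul_le_mul h1 hfac (norm_nonneg _) ?_
                exact hm.le.trans h1
            _ = (min (‖t‖ * X) T ^ a * ‖cf η ((A (i ω) ω)ᵀ *ᵥ t)‖) *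
                  (ξ + ξ * (a / ε * X ^ (-ε))) := by ring
            _ ≤ S * (ξ + 1 * (a / ε * Y ω)) := by
                refine mul_le_mul h2 ?_ ?_ hS
                · refine add_le_add le_rfl (mul_le_mul hξ0.2 ?_ (by positivity) zero_le_one)
                  gcongr
                · exact add_nonneg hξ0.1 (mul_nonneg hξ0.1 (by positivity))
            _ = S * (ξ + a / ε * Y ω) := by rw [one_mul]
      _ = S * (1 - P.real E * (1 - ρ) + a / ε * ∫ ω, Y ω ∂P) := by
          have hi : Integrable (fun ω => 1 - E.indicator (fun _ => 1 - ρ) ω) P :=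
            (integrable_const _).sub ((integrable_const _).indicator hEm)
          rw [integral_const_mul, integral_add hi (hYi.const_mul _),
            integral_sub (integrable_const _) ((integrable_const _).indicator hEm),
            integral_indicator_const _ hEm, integral_const_mul]
          simp
      _ ≤ S * q := by
          have h1 : p * (1 - ρ) ≤ P.real E * (1 - ρ) :=
            mul_le_mul_of_nonneg_right (hbig t ht0) (by linarith)
          have h2 : a / ε * ∫ ω, Y ω ∂P ≤ a / ε * M := by gcongr
          refine mul_le_mul_of_nonneg_left ?_ hS
          linarith
      _ = q * S := mul_comm _ _
  have hq1 : q < 1 := by linarith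
  -- Truncation makes the supremum S finite, so S ≤ max ((1/r)^a, q S) with q < 1 can be solved for
  -- S. The bound does not involve T, which is finally set to |t|.
  have hall : ∀ T : ℝ, 0 < T → ∀ t : Fin d → ℝ, min ‖t‖ T ^ a * ‖cf η t‖ ≤ (1 / r) ^ a := by
    intro T hT
    have hnn : ∀ t : Fin d → ℝ, 0 ≤ min ‖t‖ T := fun t => le_min (norm_nonneg _) hT.le
    set f : (Fin d → ℝ) → ℝ := fun t => min ‖t‖ T ^ a * ‖cf η t‖ with hf
    have hbdd : BddAbove (Set.range f) := by
      refine ⟨T ^ a * 1, ?_⟩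
      rintro _ ⟨t, rfl⟩
      exact mul_le_mul (Real.rpow_le_rpow (hnn t) (min_le_right _ _) ha.le) (norm_cf_le_one _ _)
        (norm_nonneg _) (by positivity)
    have hfS : ∀ t, f t ≤ ⨆ t, f t := fun t => le_ciSup hbdd t
    have hS0 : 0 ≤ ⨆ t, f t :=
      (mul_nonneg (Real.rpow_nonneg (hnn 0) _) (norm_nonneg _)).trans (hfS 0)
    have hS : ⨆ t, f t ≤ max ((1 / r) ^ a) (q * ⨆ t, f t) := by
      refine ciSup_le fun t => ?_
      rcases le_or_gt ‖t‖ (1 / r) with h | h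
      · refine le_trans ?_ (le_max_left _ _)
        calc f t ≤ (1 / r) ^ a * 1 := by
              refine mul_le_mul (Real.rpow_le_rpow (hnn t) ((min_le_left _ _).trans h) ha.le)
                (norm_cf_le_one _ _) (norm_nonneg _) (by positivity)
          _ = _ := mul_one _
      · exact (key T hT _ hS0 hfS t h).trans (le_max_right _ _)
    intro t
    refine (hfS t).trans ?_
    rcases le_max_iff.1 hS with h | h
    · exact h
    · have : ⨆ t, f t ≤ 0 := by nlinarith
      exact this.trans (by positivity)
  intro t
  rcases eq_or_ne t 0 with rfl | ht
  · rw [norm_zero, Real.zero_rpow ha.ne', zero_mul]; positivity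
  · simpa using hall ‖t‖ (norm_pos_iff.2 ht) t

/-- If sufficiently many weights are present in each direction, then the weighted sum has a
density. -/
lemma sumLaw_absolutelyContinuous {a C : ℝ} (ha : 0 < a) (hC : 0 < C)
    (hdec : ∀ t : Fin d → ℝ, ‖t‖ ^ a * ‖cf η t‖ ≤ C) {k : ℕ} (hk : (d : ℝ) < a * k) {ℓ : St d}
    (hℓ : ℓ ∈ finStates d) (hb : ∀ t : Fin d → ℝ, t ≠ 0 → Big 0 k ℓ t) :
    sumLaw η ℓ ≪ (volume : Measure (Fin d → ℝ)) := by
  -- Applied to a Dirac mass, the compactness lemma yields one lower bound r for k of the weights,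
  -- valid on the whole unit sphere.
  obtain ⟨r, hr, b, hb0, h⟩ := exists_radius_big (Measure.dirac ℓ)
    (isCompact_sphere (0 : Fin d → ℝ) 1) k (c := 0) (by simp) (fun t ht => by
      rw [Measure.dirac_apply' _ (measurableSet_big _ _ _)]
      rw [Set.indicator_of_mem (by exact hb t (ne_zero_of_mem_unit_sphere ⟨t, ht⟩))]
      simp)
  have hbig : ∀ t : Fin d → ℝ, t ≠ 0 → Big (‖t‖ * r) k ℓ t := fun t ht => by
    have htn : 0 < ‖t‖ := norm_pos_iff.2 ht
    have hu := hb0.trans_le (h (‖t‖⁻¹ • t) (by simp [norm_smul, htn.ne']))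
    rw [Measure.dirac_apply' _ (measurableSet_big _ _ _)] at hu
    have hu' : ℓ ∈ {ℓ : St d | Big r k ℓ (‖t‖⁻¹ • t)} := Set.mem_of_indicator_ne_zero hu.ne'
    have := (big_smul_iff htn).2 hu'
    rwa [smul_inv_smul₀ htn.ne'] at this
  refine absolutelyContinuous_of_integrable_cf _ ?_
  -- The factor 2^(ak) bounds (1 + |t|)^(ak) on the unit ball and compares 1 + |t| with 2|t| outside
  -- it.
  set D : ℝ := 2 ^ (a * k) * max 1 ((C / r ^ a) ^ k) with hD
  have hI : Integrable (fun t : Fin d → ℝ => D * (1 + ‖t‖) ^ (-(a * k))) volume :=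
    (integrable_one_add_norm (by simpa using hk)).const_mul _
  refine hI.mono' (continuous_cf _).aestronglyMeasurable (ae_of_all _ fun t => ?_)
  have h1t : 0 < 1 + ‖t‖ := by positivity
  have hak : 0 ≤ a * k := by positivity
  rw [Real.rpow_neg h1t.le, ← div_eq_mul_inv, le_div_iff₀ (Real.rpow_pos_of_pos h1t _)]
  rcases le_or_gt ‖t‖ 1 with ht | ht
  · calc ‖cf (sumLaw η ℓ) t‖ * (1 + ‖t‖) ^ (a * k) ≤ 1 * 2 ^ (a * k) := by
          refine mul_le_mul (norm_cf_le_one _ _) ?_ (by positivity) zero_le_one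
          exact Real.rpow_le_rpow h1t.le (by linarith) hak
      _ ≤ D := by
          rw [one_mul]
          exact le_mul_of_one_le_right (by positivity) (le_max_left _ _)
  · have ht0 : 0 < ‖t‖ := by linarith
    obtain ⟨F, hF, hFb⟩ := hbig t (norm_pos_iff.1 ht0)
    have hprod : ‖cf (sumLaw η ℓ) t‖ ≤ (C / (‖t‖ * r) ^ a) ^ k := by
      refine (norm_cf_sumLaw_le η hℓ t F).trans ?_
      rw [← hF, ← Finset.prod_const]
      refine Finset.prod_le_prod (fun _ _ => norm_nonneg _) fun j hj => ?_
      rw [le_div_iff₀ (by positivity), mul_comm]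
      refine le_trans ?_ (hdec ((ℓ j)ᵀ *ᵥ t))
      gcongr
      exact (hFb j hj).le
    calc ‖cf (sumLaw η ℓ) t‖ * (1 + ‖t‖) ^ (a * k)
        ≤ (C / (‖t‖ * r) ^ a) ^ k * (2 * ‖t‖) ^ (a * k) := by
          gcongr
          linarith
      _ = 2 ^ (a * k) * (C / r ^ a) ^ k := by
          rw [Real.mul_rpow ht0.le hr.le, Real.mul_rpow two_pos.le ht0.le, Real.rpow_mul ht0.le,
            Real.rpow_natCast, div_pow, div_pow, mul_pow]
          field_simp
      _ ≤ D := by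
          rw [hD]
          gcongr
          exact le_max_right _ _

lemma IsModel.absolutelyContinuous (H : IsModel P N A η) {q : ℝ≥0∞}
    (hq1 : q < 1)
    (hq : ∀ t : Fin d → ℝ, t ≠ 0 → P {ω | Big 0 2 (fun j => A j ω) t}ᶜ ≤ q)
    {a C : ℝ} (ha : 0 < a) (hC : 0 < C) (hdec : ∀ t : Fin d → ℝ, ‖t‖ ^ a * ‖cf η t‖ ≤ C) :
    η ≪ (volume : Measure (Fin d → ℝ)) := by
  have := isMarkovKernel_step P H.measA
  have hmk := isMarkovKernel_pow (step P A)
  obtain ⟨k, hk⟩ := exists_nat_gt (d / a)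
  rw [div_lt_iff₀' ha] at hk
  refine Measure.AbsolutelyContinuous.mk fun B hB hB0 => ?_
  have hC : IsSigmaCompact (((⊤ : Submodule ℝ (Fin d → ℝ)) : Set (Fin d → ℝ)) ∩ {0}ᶜ) :=
    isSigmaCompact_inter_isOpen (by simp) isOpen_compl_singleton
  have hlim := tendsto_pow_compl_forall_big P H.measA H.zero H.survive hq1 hq k ⊤ (root d)
    root_mem_finStates fun t ht => big_root ht
  -- A state in which all directions are alive along k particles gives B no mass; any other state
  -- gives at most 1. Hence η B is at most the probability of the latter, which tends to 0.
  refine le_antisymm (ge_of_tendsto' hlim fun n => ?_) zero_le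
  conv_lhs => rw [← bind_step_pow_root P H.measN H.measA H.zero H.fixed n]
  have hm := (measurableSet_forall_big (d := d) 0 k hC).compl
  rw [Measure.bind_apply hB (Kernel.aemeasurable _), ← lintegral_indicator_one hm]
  refine lintegral_mono_ae ?_
  filter_upwards [H.ae_finStates n] with ℓ hℓ
  by_cases hg : ∀ t ∈ ((⊤ : Submodule ℝ (Fin d → ℝ)) : Set (Fin d → ℝ)) ∩ {0}ᶜ, Big 0 k ℓ t
  · rw [sumLaw_absolutelyContinuous ha ‹0 < C› hdec hk hℓ (fun t ht => hg t ⟨trivial, ht⟩) hB0]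
    exact zero_le
  · rw [Set.indicator_of_mem (by exact hg)]
    exact prob_le_one

end Polynomial

end SmoothingTransform
end

/-! ### Assembly of the theorem -/

theorem mainTheorem6 {d : ℕ} (hd : 1 ≤ d)
    {Ω : Type*} [MeasurableSpace Ω] (P : Measure Ω) [IsProbabilityMeasure P]
    (N : Ω → ℕ) (A : ℕ → Ω → SmoothingTransform.Mat d)
    (hN : Measurable N) (hA : ∀ i, Measurable (A i))
    (h1 : SmoothingTransform.CondN P N A)
    (h2 : SmoothingTransform.CondMu (SmoothingTransform.mu P N A))
    (h3 : SmoothingTransform.CondCover P A)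
    (h4 : SmoothingTransform.CondAlpha P N A)
    (h5 : SmoothingTransform.CondHarmonic P A)
    (hΛ : ∃ v : Fin d → (Fin d → ℝ),
      (∀ i, v i ∈ SmoothingTransform.Lam (SmoothingTransform.mu P N A)) ∧ LinearIndependent ℝ v)
    {Ω' : Type*} [MeasurableSpace Ω'] (P' : Measure Ω') [IsProbabilityMeasure P']
    (Z : Ω' → Fin d → ℝ) (hZ : Measurable Z)
    (hfix : SmoothingTransform.IsFixedPoint P N A (P'.map Z))
    (hZ0 : P' {ω | Z ω = 0} = 0) :
    (P'.map Z) ≪ (volume : Measure (Fin d → ℝ)) := by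
  open SmoothingTransform in
  obtain ⟨hprob, hpos, hfixed⟩ := hfix
  obtain ⟨-, hone, htop, hAe⟩ := h1
  obtain ⟨hs, hs2, hneg⟩ := h5
  have H : IsModel P N A (P'.map Z) :=
    { measN := hN
      measA := hA
      one_lt := hone
      lt_top := htop
      zero := hAe.mono fun ω h i => (h i).2.2
      nonneg := hAe.mono fun ω h i => (h i).1
      survive := hs.mono fun ω h t ht => exists_ne_zero_of_one_le_countNonzero (h t ht)
      fixed := hfixed }
  have hz : (P'.map Z) {0} = 0 := by
    rw [Measure.map_apply hZ (measurableSet_singleton 0)]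
    exact hZ0
  obtain ⟨r, hr, p, hp, hbig⟩ := exists_two hA hs hs2
  obtain ⟨ε, hε, M, hM, hneg⟩ := exists_negative_moment hd hA hneg
  have ht1 : (fun _ => 1 : Fin d → ℝ) ≠ 0 := fun h => by
    simpa using congrFun h ⟨0, hd⟩
  have hp1 : p ≤ 1 := (hbig _ ht1).trans prob_le_one
  have hq : ∀ t : Fin d → ℝ, t ≠ 0 → P {ω | Big 0 2 (fun j => A j ω) t}ᶜ ≤ 1 - p := by
    intro t ht
    have hm : MeasurableSet {ω | Big 0 2 (fun j => A j ω) t} :=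
      (measurableSet_big 0 2 t).preimage (measurable_pi_lambda _ hA)
    rw [prob_compl_eq_one_sub hm]
    refine tsub_le_tsub_left ((hbig t ht).trans (measure_mono fun ω hω => ?_)) _
    exact Big.mono_left (by positivity) hω
  have hq1 : 1 - p < 1 := ENNReal.sub_lt_self (by simp) (by simp) hp.ne'
  obtain ⟨ρ, hρ1, hρ⟩ := H.exists_norm_cf_le h4 hq1 hq fun t ht =>
    H.norm_cf_lt_one hpos hz h3 h4 hΛ ht
  have hp' : 0 < p.toReal := ENNReal.toReal_pos hp.ne' (hp1.trans_lt ENNReal.one_lt_top).ne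
  obtain ⟨a, ha, C, hC, hdec⟩ := H.exists_decay hρ1 hρ hr hp'
    (fun t ht => ENNReal.toReal_mono (measure_ne_top _ _) (hbig t ht)) hε hM hneg
  exact H.absolutelyContinuous hq1 hq ha hC hdec
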